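/- **Proposition.** Let $k$ be an algebraically closed field of characteristic zero, let $n\ge 2$ and $s\ge 1$, and let $Z\subset\mathbb P^{n+s}_k$ be a (possibly reducible, reduced) closed subvariety of pure dimension $n-1$. For an $(n+1)\times(n+s+1)$ matrix $A$ of rank $n+1$ let $\pi:\mathbb P^{n+s}\setminus\Lambda\to\mathbb P^n$, $[x]\mapsto[Ax]$, be the associated linear projection, with center the $(s-1)$-dimensional linear space $\Lambda=\mathbb P(\ker A)$. For a reduced closed subvariety $W$ of a projective space and a point $p\in W$, let $e_pW$ be the multiplicity of $W$ at $p$, that is, the Samuel multiplicity of the maximal ideal of the local ring $\mathcal O_{W,p}$. Then there is a nonempty Zariski open set of matrices $A$ such that for each $A$ in it the following holds: $A$ has rank $n+1$, $\Lambda\cap Z=\emptyset$, the map $g=\pi|_Z: Z\to T:=\pi(Z)$ (where $T$ has its reduced structure) has finite fibers, and the set of (closed) points $$\Delta=\Big\{q\in T \ \Big|\ e_qT>\sum_{p\in g^{-1}(q)}e_pZ\Big\}$$ satisfies $\operatorname{codim}(\Delta,\mathbb P^n)\ge 3$, that is, the closure of $\Delta$ has dimension at most $n-3$, where $\dim\emptyset=-1$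 (so $\Delta=\emptyset$ if $n=2$). -/

import Mathlib

noncomputable section

namespace ProjGeom

open MvPolynomial Filter

attribute [instance] MvPolynomial.gradedAlgebra

/-- The set of (closed) points of the projective space `ℙ^m` over `k`: the lines through the
origin of `k^(m+1)`. For a point `p`, `p.submodule` is the line and `p.rep` is a vector of
homogeneous coordinates. -/
abbrev PSpace (k : Type*) [Field k] (m : ℕ) : Type _ :=
  Projectivization k (Fin (m + 1) → k)

variable {k : Type*} [Field k] {m : ℕ}

/-- The common zeros in `ℙ^m` of a set of polynomials (used for homogeneous ones only, for which
the choice of homogeneous coordinates does not matter). -/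
def zeros (S : Set (MvPolynomial (Fin (m + 1)) k)) : Set (PSpace k m) :=
  {p | ∀ f ∈ S, eval p.rep f = 0}

/-- The Zariski topology on `ℙ^m`: the closed sets are the common zero sets of families of
homogeneous polynomials. -/
instance : TopologicalSpace (PSpace k m) :=
  TopologicalSpace.ofClosed
    {X | ∃ S : Set (MvPolynomial (Fin (m + 1)) k),
      (∀ f ∈ S, ∃ d, f.IsHomogeneous d) ∧ X = zeros S}
    ⟨{1}, by rintro f rfl; exact ⟨0, isHomogeneous_one _ _⟩, by
      ext p; simp [zeros]⟩
    (by
      intro A hA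
      refine ⟨⋃ X : {X // X ∈ A}, (hA X.2).choose, ?_, ?_⟩
      · intro f hf
        simp only [Set.mem_iUnion] at hf
        obtain ⟨X, hf⟩ := hf
        exact (hA X.2).choose_spec.1 f hf
      · ext p
        constructor
        · intro h f hf
          simp only [Set.mem_iUnion] at hf
          obtain ⟨X, hf⟩ := hf
          have h1 : p ∈ X.1 := h X.1 X.2
          rw [(hA X.2).choose_spec.2] at h1
          exact h1 f hf
        · intro h X hXA
          rw [(hA hXA).choose_spec.2]
          refine fun f hf => h f ?_
          simp only [Set.mem_iUnion]
          exact ⟨⟨X, hXA⟩, hf⟩)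
    (by
      rintro _ ⟨S, hS, rfl⟩ _ ⟨S', hS', rfl⟩
      refine ⟨{h | ∃ f ∈ S, ∃ g ∈ S', h = f * g}, ?_, ?_⟩
      · rintro _ ⟨f, hf, g, hg, rfl⟩
        obtain ⟨a, ha⟩ := hS f hf
        obtain ⟨b, hb⟩ := hS' g hg
        exact ⟨a + b, ha.mul hb⟩
      · ext p
        simp only [zeros, Set.mem_union, Set.mem_ofPred_eq]
        constructor
        · rintro (h | h) _ ⟨f, hf, g, hg, rfl⟩
          · simp [h f hf]
          · simp [h g hg]
        · intro h
          by_contra! hc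
          obtain ⟨⟨f, hf, hf0⟩, g, hg, hg0⟩ := hc
          have := h (f * g) ⟨f, hf, g, hg, rfl⟩
          rw [map_mul] at this
          exact (mul_ne_zero hf0 hg0) this)

/-- A projective algebraic set has pure dimension `d` if it is closed and all its irreducible
components have dimension `d`. -/
def IsPureDimVariety (Z : Set (PSpace k m)) (d : ℕ) : Prop :=
  IsClosed Z ∧ ∀ Y ∈ irreducibleComponents Z, topologicalKrullDim Y = d

/-- The affine cone in `k^(m+1)` over a set of points of `ℙ^m`. -/
def affineCone (Z : Set (PSpace k m)) : Set (Fin (m + 1) → k) :=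
  {v | ∃ p ∈ Z, v ∈ p.submodule}

/-- The homogeneous ideal of a set of points of `ℙ^m`. -/
def homIdeal (Z : Set (PSpace k m)) : Ideal (MvPolynomial (Fin (m + 1)) k) :=
  vanishingIdeal k (affineCone Z)

instance [Infinite k] (p : PSpace k m) : (homIdeal {p}).IsPrime := by
  have key : ∀ f : MvPolynomial (Fin (m + 1)) k, f ∈ homIdeal {p} ↔
      aeval (fun i => Polynomial.C (p.rep i) * Polynomial.X) f = (0 : Polynomial k) := by
    intro f
    have hev : ∀ c : k, (aeval (fun i => Polynomial.C (p.rep i) * Polynomial.X) f :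
        Polynomial k).eval c = aeval (c • p.rep) f := by
      intro c
      rw [← Polynomial.coe_aeval_eq_eval]
      have h := MvPolynomial.comp_aeval_apply (R := k)
        (fun i => Polynomial.C (p.rep i) * Polynomial.X) (Polynomial.aeval (R := k) c) f
      rw [h]
      have h2 : (fun i => Polynomial.aeval (R := k) c (Polynomial.C (p.rep i) * Polynomial.X)) =
          c • p.rep := by
        funext i
        rw [map_mul, Polynomial.aeval_C, Polynomial.aeval_X, Pi.smul_apply, smul_eq_mul, mul_comm]
        rfl
      rw [h2]
    constructor
    · intro hf
      refine Polynomial.funext fun c => ?_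
      rw [hev, Polynomial.eval_zero]
      refine hf _ ⟨p, rfl, ?_⟩
      rw [Projectivization.submodule_eq]
      exact Submodule.smul_mem _ _ (Submodule.mem_span_singleton_self _)
    · rintro hf v ⟨q, rfl, hv⟩
      rw [Projectivization.submodule_eq, Submodule.mem_span_singleton] at hv
      obtain ⟨c, rfl⟩ := hv
      have h := hev c
      rw [hf, Polynomial.eval_zero] at h
      exact h.symm
  have : homIdeal {p} = RingHom.ker
      (aeval (fun i => Polynomial.C (p.rep i) * Polynomial.X) :
        MvPolynomial (Fin (m + 1)) k →ₐ[k] Polynomial k) := by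
    ext f
    rw [key, RingHom.mem_ker]
  rw [this]
  exact RingHom.ker_isPrime _

/-- The local ring `𝒪_{ℙ^m, p}`: fractions `a / b` of homogeneous polynomials of the same degree
with `b` not vanishing at `p`. -/
abbrev AmbientLocalRing [Infinite k] (p : PSpace k m) : Type _ :=
  HomogeneousLocalization.AtPrime (homogeneousSubmodule (Fin (m + 1)) k) (homIdeal {p})

/-- The stalk at `p` of the ideal sheaf of `Z` (with its reduced structure): the fractions `a / b`
as above with `a` in the homogeneous ideal of `Z`. -/
def localIdeal [Infinite k] (Z : Set (PSpace k m)) (p : PSpace k m) :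
    Ideal (AmbientLocalRing p) :=
  ((homIdeal Z).map (algebraMap (MvPolynomial (Fin (m + 1)) k)
      (Localization.AtPrime (homIdeal {p})))).comap
    (algebraMap (AmbientLocalRing p) (Localization.AtPrime (homIdeal {p})))

/-- The local ring `𝒪_{Z, p}` of the reduced closed subscheme `Z` of `ℙ^m` at a point
(the zero ring if `p ∉ Z`). -/
abbrev LocalRingAt [Infinite k] (Z : Set (PSpace k m)) (p : PSpace k m) : Type _ :=
  AmbientLocalRing p ⧸ localIdeal Z p

/-- The maximal ideal of `𝒪_{Z, p}` (the unit ideal if `p ∉ Z`). -/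
def maximalIdealAt [Infinite k] (Z : Set (PSpace k m)) (p : PSpace k m) :
    Ideal (LocalRingAt Z p) :=
  (IsLocalRing.maximalIdeal (AmbientLocalRing p)).map (Ideal.Quotient.mk (localIdeal Z p))

/-- The Samuel multiplicity `e(𝔮) = lim_t d! · ℓ(R / 𝔮^t) / t^d`, with `d = dim R`, of an ideal
`𝔮`. It is used for the maximal ideal of a Noetherian local ring, where the limit exists, so that
the upper limit, which needs no existence clause, is the limit. -/
def samuelMultiplicity (R : Type*) [CommRing R] (𝔮 : Ideal R) : ENNReal :=
  limsup (fun t : ℕ =>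
    ((ringKrullDim R).unbotD 0).toNat.factorial *
      ENat.toENNReal (Module.length R (R ⧸ 𝔮 ^ t)) /
      (t : ENNReal) ^ ((ringKrullDim R).unbotD 0).toNat) atTop

/-- The multiplicity `e_p Z` of the reduced closed subscheme `Z` of `ℙ^m` at the point `p`. -/
def mult [Infinite k] (Z : Set (PSpace k m)) (p : PSpace k m) : ENNReal :=
  samuelMultiplicity (LocalRingAt Z p) (maximalIdealAt Z p)

section Projection

variable {n N : ℕ}

/-- The center `Λ ⊆ ℙ^N` of the linear projection given by a matrix. -/
def center (A : Matrix (Fin (n + 1)) (Fin (N + 1)) k) : Set (PSpace k N) :=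
  {p | A.mulVec p.rep = 0}

/-- The linear projection `π : ℙ^N ∖ Λ → ℙ^n`, `[x] ↦ [A x]`. -/
def linProj (A : Matrix (Fin (n + 1)) (Fin (N + 1)) k) (p : {p : PSpace k N // p ∉ center A}) :
    PSpace k n :=
  Projectivization.mk k (A.mulVec p.1.rep) p.2

/-- The image `π(Z) ⊆ ℙ^n`. -/
def projImage (A : Matrix (Fin (n + 1)) (Fin (N + 1)) k) (Z : Set (PSpace k N)) :
    Set (PSpace k n) :=
  linProj A '' {p | p.1 ∈ Z}

/-- The fiber over `q` of the restriction of `π` to `Z`. -/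
def fiber (A : Matrix (Fin (n + 1)) (Fin (N + 1)) k) (Z : Set (PSpace k N)) (q : PSpace k n) :
    Set (PSpace k N) :=
  {p | ∃ hp : p ∉ center A, p ∈ Z ∧ linProj A ⟨p, hp⟩ = q}

/-- The points `q` of `T = π(Z)` with `e_q T > ∑_{p ∈ Z, π(p) = q} e_p Z`. -/
def excessLocus [Infinite k] (A : Matrix (Fin (n + 1)) (Fin (N + 1)) k) (Z : Set (PSpace k N)) :
    Set (PSpace k n) :=
  {q | q ∈ projImage A Z ∧ mult (projImage A Z) q > (∑' p : fiber A Z q, mult Z p.1)}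

end Projection

/-- A subset of `ℙ^n` has codimension at least `c`: its closure has dimension at most `n - c`. Here
the empty set has dimension `-1`, so that its codimension in `ℙ^n` is `n + 1`. -/
def CodimAtLeast {n : ℕ} (c : ℕ) (D : Set (PSpace k n)) : Prop :=
  (D.Nonempty → topologicalKrullDim (closure D) + c ≤ n) ∧ (D = ∅ → c ≤ n + 1)

/-- A property holds for a general matrix: it holds on a nonempty Zariski open subset of the affine
space of all matrices. It is enough to ask this of a nonempty principal open subset. -/
def ForGeneralMatrix {r c : ℕ} (P : Matrix (Fin r) (Fin c) k → Prop) : Prop :=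
  ∃ F : MvPolynomial (Fin r × Fin c) k, (∃ A : Matrix (Fin r) (Fin c) k,
      eval (fun ij => A ij.1 ij.2) F ≠ 0) ∧
    ∀ A : Matrix (Fin r) (Fin c) k, eval (fun ij => A ij.1 ij.2) F ≠ 0 → P A

end ProjGeom

end

namespace ProjGeom

open MvPolynomial

/-! ### Cones, homogeneous components and homogenization -/

section Cones

variable {k : Type*} [Field k] {ι : Type*}

/-! Let `C` be the affine cone over `Z`, of dimension `n`. A limit secant is a pair `(v, x)` in the
fibre over `t = 0` of the closure of `{(t, v, x) : t ≠ 0, x ∈ C, x + t v ∈ C}`. This family is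
governed by `t` and two points of `C`, so it has dimension at most `2n + 1`, and its special fibre
`W`, a closed bihomogeneous set, has dimension at most `2n`
(`le_of_hasIndep_of_zeroLocus_subset_limitSecants`). Over a point `x`, the set `W` contains the
tangent cone of `C` at `x`.

Dimension count: for general `A` the `n + 1` equations `A v = 0` leave dimension at most `n - 1`
among the pairs with `v ≠ 0` and `x ≠ 0`. Since `v` and `x` can be scaled separately, the points `[A
x]` form a closed set `K` of dimension at most `n - 3`. To make this precise, one matrix and `n - 2`
linear forms `c` are built row by row so that no pair satisfies both `A v = 0` and `c (A x) = 0`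
(`exists_matrix_forall_limitSecants`). With `c` fixed, the matrices admitting such a pair form a
closed set by elimination theory (`IsAlgebraicSet.exists_ne_zero`), so a general matrix admits none;
then `K` misses a linear space of codimension `n - 2`.

Multiplicities: let `q` lie in `T` outside `K`, let `𝔪` be its ideal in the coordinate ring of a
chart of `T`, and let `𝔫_p` be the ideals of the points `p` of the fibre in the coordinate ring `B`
of the corresponding chart of `Z`. No limit secant at `p` lies in the kernel of `A`, and comparing
leading forms gives `𝔫_p ^ (D + 1) ≤ 𝔪 𝔫_p ^ D + 𝔫_p ^ (D + 2)` (`exists_pow_pointIdeal_le`):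
locally, `𝔪 B` is a reduction of `𝔫_p`. Hence the intersection of the `𝔫_p ^ (D + t)` lies in `𝔪 ^ t
B`. The chart ring of `T` embeds in the finite algebra `B`, so Artin–Rees bounds the colength of `𝔪
^ t` by the sum of the colengths of the `𝔫_p ^ (t + c)` for a constant `c` (`exists_length_le_sum`).
All the local rings have dimension `n - 1`, by Noether normalization and going down
(`height_pointIdeal_slice`), so dividing by `t ^ (n - 1)` and letting `t` grow gives `e_q T ≤ ∑ e_p
Z`. Thus `Δ` is contained in `K`. -/

theorem mem_vanishingIdeal {V : Set (ι → k)} {f : MvPolynomial ι k} :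
    f ∈ vanishingIdeal k V ↔ ∀ x ∈ V, eval x f = 0 := by
  simp [mem_vanishingIdeal_iff, aeval_eq_eval]

theorem mem_zeroLocus {I : Ideal (MvPolynomial ι k)} {x : ι → k} :
    x ∈ zeroLocus k I ↔ ∀ f ∈ I, eval x f = 0 := by
  simp [mem_zeroLocus_iff, aeval_eq_eval]

/-- A subset of a vector space that is stable under multiplication by scalars. -/
def IsCone {k V : Type*} [SMul k V] (C : Set V) : Prop := ∀ c : k, ∀ x ∈ C, c • x ∈ C

/-- An ideal that contains the homogeneous components of its elements. -/
def HasComponents (I : Ideal (MvPolynomial ι k)) : Prop :=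
  ∀ f ∈ I, ∀ d, homogeneousComponent d f ∈ I

theorem eval_smul_of_isHomogeneous {f : MvPolynomial ι k} {d : ℕ} (hf : f.IsHomogeneous d)
    (c : k) (x : ι → k) : eval (c • x) f = c ^ d * eval x f := by
  rw [eval_eq, eval_eq, Finset.mul_sum]
  refine Finset.sum_congr rfl fun m hm => ?_
  have h : m.degree = d := by
    rw [Finsupp.degree_eq_weight_one]
    exact hf (mem_support_iff.mp hm)
  simp only [Pi.smul_apply, smul_eq_mul, mul_pow, Finset.prod_mul_distrib]
  rw [Finset.prod_pow_eq_pow_sum, ← h, Finsupp.degree_apply]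
  ring

theorem eval_smul_eq_sum (f : MvPolynomial ι k) (c : k) (x : ι → k) :
    eval (c • x) f =
      ∑ d ∈ Finset.range (f.totalDegree + 1), c ^ d * eval x (homogeneousComponent d f) := by
  conv_lhs => rw [← sum_homogeneousComponent f]
  rw [map_sum]
  exact Finset.sum_congr rfl fun d _ =>
    eval_smul_of_isHomogeneous (homogeneousComponent_isHomogeneous d f) c x

/-- The values of the components are the coefficients of `c ↦ f (c x)`, a polynomial with infinitely
many roots. Leaving out `c = 0` allows sets that are stable under nonzero scalars only. -/
theorem eval_homogeneousComponent_eq_zero [Infinite k] {f : MvPolynomial ι k} {x : ι → k}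
    (h : ∀ c : k, c ≠ 0 → eval (c • x) f = 0) (d : ℕ) :
    eval x (homogeneousComponent d f) = 0 := by
  by_cases hd : f.totalDegree < d
  · rw [homogeneousComponent_eq_zero _ _ hd, map_zero]
  have hp : (∑ d ∈ Finset.range (f.totalDegree + 1),
      Polynomial.C (eval x (homogeneousComponent d f)) * Polynomial.X ^ d) = 0 := by
    refine Polynomial.eq_zero_of_infinite_isRoot _ ((Set.finite_singleton (0 : k)).infinite_compl.mono
      fun c hc => ?_)
    have := h c hc
    rw [eval_smul_eq_sum] at this
    simp only [Set.mem_ofPred_eq, Polynomial.IsRoot.def, Polynomial.eval_finsetSum,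
      Polynomial.eval_mul, Polynomial.eval_C, Polynomial.eval_pow, Polynomial.eval_X]
    rw [← this]
    exact Finset.sum_congr rfl fun d _ => mul_comm _ _
  have := congrArg (fun p => Polynomial.coeff p d) hp
  simp only [Polynomial.finsetSum_coeff, Polynomial.coeff_C_mul, Polynomial.coeff_X_pow,
    Polynomial.coeff_zero, mul_ite, mul_one, mul_zero] at this
  rw [Finset.sum_ite_eq] at this
  simpa [Nat.lt_succ_iff, not_lt.mp hd] using this

theorem hasComponents_vanishingIdeal [Infinite k] {C : Set (ι → k)} (hC : IsCone (k := k) C) :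
    HasComponents (vanishingIdeal k C) := by
  intro f hf d
  rw [mem_vanishingIdeal] at hf ⊢
  exact fun x hx => eval_homogeneousComponent_eq_zero (fun c _ => hf _ (hC c x hx)) d

theorem homogeneousComponent_mul_of_left {f g : MvPolynomial ι k} {e : ℕ} (hf : f.IsHomogeneous e)
    (d : ℕ) : homogeneousComponent (e + d) (f * g) = f * homogeneousComponent d g := by
  have h := DirectSum.coe_decompose_mul_add_of_left_mem (homogeneousSubmodule ι k) (a := f) (b := g)
    (i := e) (j := d) hf
  have h2 : ∀ (φ : MvPolynomial ι k) i, ((DirectSum.decompose (homogeneousSubmodule ι k) φ) i :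
      MvPolynomial ι k) = homogeneousComponent i φ := fun φ i => by
    rw [← DirectSum.Decomposition.decompose'_eq]
    exact decomposition.decompose'_apply φ i
  rwa [h2, h2] at h

/-- The homogeneous form of a polynomial of degree one, with given coefficients. -/
noncomputable def linForm [Fintype ι] (a : ι → k) : MvPolynomial ι k := ∑ i, C (a i) * X i

theorem linForm_isHomogeneous [Fintype ι] (a : ι → k) : (linForm a).IsHomogeneous 1 :=
  IsHomogeneous.sum _ _ _ fun _ _ => isHomogeneous_C_mul_X _ _

@[simp] theorem eval_linForm [Fintype ι] (a x : ι → k) : eval x (linForm a) = a ⬝ᵥ x := by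
  simp [linForm, dotProduct]

/-- Composition of polynomials with a linear map given by a matrix. -/
noncomputable def linMap [Fintype ι] {r : Type*} (L : Matrix r ι k) :
    MvPolynomial r k →ₐ[k] MvPolynomial ι k :=
  aeval fun j => linForm (L j)

@[simp] theorem linMap_X [Fintype ι] {r : Type*} (L : Matrix r ι k) (j : r) :
    linMap L (X j) = linForm (L j) := by simp [linMap]

@[simp] theorem eval_linMap [Fintype ι] {r : Type*} (L : Matrix r ι k) (x : ι → k)
    (f : MvPolynomial r k) : eval x (linMap L f) = eval (L.mulVec x) f := by
  have h : (aeval x).comp (linMap L) = (aeval (L.mulVec x) : MvPolynomial r k →ₐ[k] k) := by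
    ext j
    simp only [AlgHom.comp_apply, linMap_X, aeval_eq_eval, aeval_X, eval_linForm, Matrix.mulVec]
  have := AlgHom.congr_fun h f
  simpa [aeval_eq_eval] using this

theorem linMap_isHomogeneous [Fintype ι] {r : Type*} (L : Matrix r ι k) {f : MvPolynomial r k}
    {d : ℕ} (hf : f.IsHomogeneous d) : (linMap L f).IsHomogeneous d := by
  have := hf.aeval (fun j => linForm (L j)) (n := 1) fun j => linForm_isHomogeneous _
  simpa [linMap] using this

/-- A projective Nullstellensatz: an ideal without zeros outside of the origin contains a power of
the irrelevant ideal. -/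
theorem exists_pow_idealOfVars_le [IsAlgClosed k] [Finite ι] {I : Ideal (MvPolynomial ι k)}
    (hI : ∀ x ∈ zeroLocus k I, x = 0) : ∃ D, idealOfVars ι k ^ D ≤ I := by
  refine Ideal.exists_pow_le_of_le_radical_of_fg ?_ (idealOfVars_fg ι k)
  rw [← vanishingIdeal_zeroLocus_eq_radical (K := k), idealOfVars, Ideal.span_le]
  rintro _ ⟨i, rfl⟩
  rw [SetLike.mem_coe, mem_vanishingIdeal]
  intro x hx
  simp [hI x hx]

theorem mem_pow_idealOfVars_of_isHomogeneous {f : MvPolynomial ι k} {d : ℕ}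
    (hf : f.IsHomogeneous d) {D : ℕ} (hD : D ≤ d) : f ∈ idealOfVars ι k ^ D := by
  rw [mem_pow_idealOfVars_iff]
  intro m hm
  rw [Finsupp.degree_eq_weight_one]
  exact hD.trans (hf (mem_support_iff.mp hm)).ge

/-- The homogenization of a polynomial with respect to a linear form. -/
noncomputable def homogenize (h f : MvPolynomial ι k) : MvPolynomial ι k :=
  ∑ d ∈ Finset.range (f.totalDegree + 1), h ^ (f.totalDegree - d) * homogeneousComponent d f

theorem homogenize_isHomogeneous {h : MvPolynomial ι k} (hh : h.IsHomogeneous 1)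
    (f : MvPolynomial ι k) : (homogenize h f).IsHomogeneous f.totalDegree := by
  refine IsHomogeneous.sum _ _ _ fun d hd => ?_
  have := (hh.pow (f.totalDegree - d)).mul (homogeneousComponent_isHomogeneous d f)
  have e : 1 * (f.totalDegree - d) + d = f.totalDegree := by
    rw [Finset.mem_range] at hd; omega
  rwa [e] at this

theorem eval_homogenize {h f : MvPolynomial ι k} {x : ι → k} (hx : eval x h = 1) :
    eval x (homogenize h f) = eval x f := by
  conv_rhs => rw [← sum_homogeneousComponent f]
  simp [homogenize, hx]

end Cones

end ProjGeom

namespace ProjGeom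

open MvPolynomial

/-! ### Lengths over a localization as dimensions over `k` -/

section Length

/-- Length is additive, so the filtration by the powers of `𝔫` reduces the claim to modules over `B
⧸ 𝔫`, onto which `k` surjects. -/
theorem length_eq_of_torsion {k B : Type*} [Field k] [CommRing B] [Algebra k B] (𝔫 : Ideal B)
    (hk : Function.Surjective (algebraMap k (B ⧸ 𝔫))) (t : ℕ) {M : Type*} [AddCommGroup M]
    [Module B M] [Module k M] [IsScalarTower k B M] (hM : ∀ b ∈ 𝔫 ^ t, ∀ x : M, b • x = 0) :
    Module.length B M = Module.length k M := by
  induction t generalizing M with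
  | zero =>
    have : Subsingleton M := ⟨fun x y => by
      rw [← one_smul B x, ← one_smul B y, hM 1 (by simp), hM 1 (by simp)]⟩
    rw [Module.length_eq_zero, Module.length_eq_zero]
  | succ t ih =>
    set N : Submodule B M := 𝔫 • ⊤ with hN
    have h1 : Module.length B N = Module.length k N := by
      refine ih fun b hb x => Subtype.ext ?_
      have hx : (x : M) ∈ 𝔫 • (⊤ : Submodule B M) := x.2
      refine Submodule.smul_induction_on (p := fun y : M => b • y = 0) hx ?_ ?_
      · intro r hr y _
        rw [smul_smul]
        exact hM _ (by rw [pow_succ]; exact Ideal.mul_mem_mul hb hr) y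
      · intro y z hy hz
        rw [smul_add, hy, hz, add_zero]
    have h2 : Module.length B (M ⧸ N) = Module.length k (M ⧸ N) := by
      have htor : Module.IsTorsionBySet B (M ⧸ N) 𝔫 := by
        rintro x ⟨b, hb⟩
        obtain ⟨y, rfl⟩ := Submodule.Quotient.mk_surjective N x
        rw [← Submodule.Quotient.mk_smul, Submodule.Quotient.mk_eq_zero]
        exact Submodule.smul_mem_smul hb trivial
      let := htor.module
      have : IsScalarTower B (B ⧸ 𝔫) (M ⧸ N) := htor.isScalarTower
      have : IsScalarTower k (B ⧸ 𝔫) (M ⧸ N) := htor.isScalarTower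
      rw [Module.length_eq_of_surjective (S := B) (R := B ⧸ 𝔫) Ideal.Quotient.mk_surjective,
        Module.length_eq_of_surjective (S := k) (R := B ⧸ 𝔫) hk]
    rw [Module.length_eq_add_of_exact N.subtype N.mkQ N.injective_subtype N.mkQ_surjective
        (LinearMap.exact_subtype_mkQ N), h1, h2,
      ← Module.length_eq_add_of_exact (N.subtype.restrictScalars k) (N.mkQ.restrictScalars k)
        N.injective_subtype N.mkQ_surjective (LinearMap.exact_subtype_mkQ N)]

/-- If `y s = 1 - i` with `i ∈ 𝔫`, then `1 - i ^ t = (1 - i) c`, so `y c` inverts the denominator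
`s` modulo `𝔫 ^ t`. -/
theorem exists_sub_mem_maximalIdeal_pow {B R : Type*} [CommRing B] [CommRing R]
    [Algebra B R] (𝔫 : Ideal B) [𝔫.IsMaximal] [IsLocalization.AtPrime R 𝔫] [IsLocalRing R]
    (t : ℕ) (x : R) : ∃ b : B, x - algebraMap B R b ∈ IsLocalRing.maximalIdeal R ^ t := by
  obtain ⟨b, s, rfl⟩ := IsLocalization.exists_mk'_eq 𝔫.primeCompl x
  obtain ⟨y, i, hi, hyi⟩ := Ideal.IsMaximal.exists_inv (I := 𝔫) ‹_› s.2
  obtain ⟨c, hc⟩ := sub_dvd_pow_sub_pow 1 i t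
  rw [one_pow] at hc
  have hi' : algebraMap B R (i ^ t) ∈ IsLocalRing.maximalIdeal R ^ t := by
    rw [map_pow]
    refine Ideal.pow_mem_pow ?_ t
    rw [← IsLocalization.AtPrime.map_eq_maximalIdeal 𝔫 R]
    exact Ideal.mem_map_of_mem _ hi
  refine ⟨b * y * c, ?_⟩
  have h1 : IsLocalization.mk' R b s * algebraMap B R s = algebraMap B R b :=
    IsLocalization.mk'_spec _ _ _
  have h2 : algebraMap B R (i ^ t) = 1 - algebraMap B R s * algebraMap B R y * algebraMap B R c := by
    rw [← map_mul, ← map_mul, ← map_one (algebraMap B R), ← map_sub]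
    congr 1
    linear_combination -hc + c * hyi
  have : IsLocalization.mk' R b s - algebraMap B R (b * y * c) =
      IsLocalization.mk' R b s * algebraMap B R (i ^ t) := by
    rw [map_mul, map_mul, h2]
    linear_combination (algebraMap B R y * algebraMap B R c) * h1
  rw [this]
  exact Ideal.mul_mem_left _ _ hi'

theorem length_quotient_maximalIdeal_pow {k B R : Type*} [Field k] [CommRing B] [Algebra k B]
    [CommRing R] [Algebra B R] (𝔫 : Ideal B) [𝔫.IsMaximal] [IsLocalization.AtPrime R 𝔫]
    [IsLocalRing R] (hk : Function.Surjective (algebraMap k (B ⧸ 𝔫))) (t : ℕ) :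
    Module.length R (R ⧸ IsLocalRing.maximalIdeal R ^ t) = Module.length k (B ⧸ 𝔫 ^ t) := by
  set J := IsLocalRing.maximalIdeal R ^ t
  have hsurj : Function.Surjective (algebraMap B (R ⧸ J)) := by
    intro x
    obtain ⟨x, rfl⟩ := Ideal.Quotient.mk_surjective x
    obtain ⟨b, hb⟩ := exists_sub_mem_maximalIdeal_pow 𝔫 t x
    exact ⟨b, ((Ideal.Quotient.mk_eq_mk_iff_sub_mem _ _).mpr hb).symm⟩
  have hker : LinearMap.ker (Algebra.linearMap B (R ⧸ J)) = 𝔫 ^ t := by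
    ext b
    rw [LinearMap.mem_ker, Algebra.linearMap_apply, IsScalarTower.algebraMap_apply B R (R ⧸ J),
      Ideal.Quotient.algebraMap_eq, Ideal.Quotient.eq_zero_iff_mem,
      ← IsLocalization.AtPrime.under_maximalIdeal_pow 𝔫 R t]
    rfl
  rw [Module.length_eq_of_surjective (S := R) (R := R ⧸ J) Ideal.Quotient.mk_surjective,
    ← Module.length_eq_of_surjective (S := B) (R := R ⧸ J) hsurj,
    ← (LinearMap.quotKerEquivOfSurjective (Algebra.linearMap B (R ⧸ J)) hsurj).length_eq, hker]
  refine length_eq_of_torsion 𝔫 hk t fun b hb x => ?_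
  obtain ⟨x, rfl⟩ := Ideal.Quotient.mk_surjective x
  rw [Algebra.smul_def, Ideal.Quotient.algebraMap_eq, ← map_mul, Ideal.Quotient.eq_zero_iff_mem]
  exact Ideal.mul_mem_right _ _ hb

end Length

/-! ### Local rings of projective sets as localizations of affine charts -/

section LocalRing

variable {k : Type*} [Field k] {ι : Type*}

theorem aeval_mul_of_isHomogeneous {S : Type*} [CommRing S] [Algebra k S] {f : MvPolynomial ι k}
    {d : ℕ} (hf : f.IsHomogeneous d) (c : S) (x : ι → S) :
    aeval (fun i => c * x i) f = c ^ d * aeval x f := by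
  rw [aeval_eq_eval₂Hom, aeval_eq_eval₂Hom, coe_eval₂Hom, coe_eval₂Hom, eval₂_eq, eval₂_eq,
    Finset.mul_sum]
  refine Finset.sum_congr rfl fun m hm => ?_
  have h : m.degree = d := by
    rw [Finsupp.degree_eq_weight_one]
    exact hf (mem_support_iff.mp hm)
  simp only [mul_pow, Finset.prod_mul_distrib]
  rw [Finset.prod_pow_eq_pow_sum, ← h, Finsupp.degree_apply]
  ring

/-- The points of `C` where a linear form takes the value `1`. -/
def slice [Fintype ι] (C : Set (ι → k)) (a : ι → k) : Set (ι → k) := {x ∈ C | a ⬝ᵥ x = 1}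

/-- The coordinate ring of a set of points of affine space. -/
abbrev CoordRing (V : Set (ι → k)) : Type _ := MvPolynomial ι k ⧸ vanishingIdeal k V

/-- The ideal of a point in the coordinate ring of a set of points. -/
noncomputable def pointIdeal (V : Set (ι → k)) (v : ι → k) : Ideal (CoordRing V) :=
  (vanishingIdeal k {v}).map (Ideal.Quotient.mk (vanishingIdeal k V))

theorem mk_mem_pointIdeal {V : Set (ι → k)} {v : ι → k} (hv : v ∈ V) {f : MvPolynomial ι k} :
    Ideal.Quotient.mk (vanishingIdeal k V) f ∈ pointIdeal V v ↔ eval v f = 0 := by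
  have hle : vanishingIdeal k V ≤ vanishingIdeal k {v} :=
    vanishingIdeal_anti_mono (Set.singleton_subset_iff.mpr hv)
  rw [pointIdeal, Ideal.mem_quotient_iff_mem hle, mem_vanishingIdeal]
  simp

theorem pointIdeal_isMaximal {V : Set (ι → k)} {v : ι → k} (hv : v ∈ V) :
    (pointIdeal V v).IsMaximal := by
  have hle : vanishingIdeal k V ≤ vanishingIdeal k {v} :=
    vanishingIdeal_anti_mono (Set.singleton_subset_iff.mpr hv)
  refine (Ideal.map_eq_top_or_isMaximal_of_surjective _ Ideal.Quotient.mk_surjective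
    (I := vanishingIdeal k {v}) inferInstance).resolve_left fun h => ?_
  have h1 : Ideal.Quotient.mk (vanishingIdeal k V) 1 ∈ pointIdeal V v := by
    rw [pointIdeal, h]; trivial
  rw [mk_mem_pointIdeal hv] at h1
  simp at h1

theorem algebraMap_quotient_pointIdeal_surjective {V : Set (ι → k)} {v : ι → k} (hv : v ∈ V) :
    ∀ x : CoordRing V ⧸ pointIdeal V v, ∃ c : k,
      Ideal.Quotient.mk _ (algebraMap k (CoordRing V) c) = x := by
  intro x
  obtain ⟨x, rfl⟩ := Ideal.Quotient.mk_surjective x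
  obtain ⟨f, rfl⟩ := Ideal.Quotient.mk_surjective x
  refine ⟨eval v f, ?_⟩
  change Ideal.Quotient.mk _ (Ideal.Quotient.mk _ (C (eval v f))) = _
  rw [Ideal.Quotient.mk_eq_mk_iff_sub_mem, ← map_sub, mk_mem_pointIdeal hv]
  simp

variable {m : ℕ}

theorem rep_mem_submodule (p : PSpace k m) : p.rep ∈ p.submodule := by
  rw [Projectivization.submodule_eq]
  exact Submodule.mem_span_singleton_self _

theorem affineCone_isCone (Z : Set (PSpace k m)) : IsCone (k := k) (affineCone Z) := by
  rintro c x ⟨p, hp, hx⟩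
  exact ⟨p, hp, Submodule.smul_mem _ _ hx⟩

theorem mem_submodule_iff {p : PSpace k m} {v : Fin (m + 1) → k} (hv : v ∈ p.submodule)
    (hv0 : v ≠ 0) {w : Fin (m + 1) → k} : w ∈ p.submodule ↔ ∃ c : k, w = c • v := by
  rw [Projectivization.submodule_eq, Submodule.mem_span_singleton] at *
  obtain ⟨a, rfl⟩ := hv
  have ha : a ≠ 0 := by rintro rfl; simp at hv0
  constructor
  · rintro ⟨b, rfl⟩
    exact ⟨b * a⁻¹, by rw [smul_smul, mul_assoc, inv_mul_cancel₀ ha, mul_one]⟩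
  · rintro ⟨c, rfl⟩
    exact ⟨c * a, by rw [smul_smul]⟩

theorem mem_homIdeal_singleton_of_isHomogeneous {p : PSpace k m} {v : Fin (m + 1) → k}
    (hv : v ∈ p.submodule) (hv0 : v ≠ 0) {f : MvPolynomial (Fin (m + 1)) k} {d : ℕ}
    (hf : f.IsHomogeneous d) : f ∈ homIdeal {p} ↔ eval v f = 0 := by
  rw [homIdeal, mem_vanishingIdeal]
  constructor
  · intro h
    exact h v ⟨p, rfl, hv⟩
  · rintro h w ⟨q, rfl, hw⟩
    obtain ⟨c, rfl⟩ := (mem_submodule_iff hv hv0).mp hw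
    rw [eval_smul_of_isHomogeneous hf, h, mul_zero]

theorem homIdeal_hasComponents [Infinite k] (Z : Set (PSpace k m)) : HasComponents (homIdeal Z) :=
  hasComponents_vanishingIdeal (affineCone_isCone Z)

/-- The factor `linForm a` takes care of the part of the cone in the hyperplane `a = 0`, about which
the slice says nothing. -/
theorem mem_homIdeal_iff_slice {Z : Set (PSpace k m)} {a : Fin (m + 1) → k}
    (f : MvPolynomial (Fin (m + 1)) k) :
    f ∈ vanishingIdeal k (slice (affineCone Z) a) ↔
      linForm a * homogenize (linForm a) f ∈ homIdeal Z := by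
  rw [homIdeal, mem_vanishingIdeal, mem_vanishingIdeal]
  have hh := homogenize_isHomogeneous (linForm_isHomogeneous a) f
  constructor
  · intro h x hx
    rw [map_mul, eval_linForm]
    by_cases h0 : a ⬝ᵥ x = 0
    · rw [h0, zero_mul]
    · have h1 : a ⬝ᵥ ((a ⬝ᵥ x)⁻¹ • x) = 1 := by
        rw [dotProduct_smul, smul_eq_mul, inv_mul_cancel₀ h0]
      have h2 := h ((a ⬝ᵥ x)⁻¹ • x) ⟨affineCone_isCone Z _ _ hx, h1⟩
      rw [← eval_homogenize (h := linForm a) (by rw [eval_linForm, h1]),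
        eval_smul_of_isHomogeneous hh] at h2
      rw [(mul_eq_zero.mp h2).resolve_left (pow_ne_zero _ (inv_ne_zero h0)), mul_zero]
  · rintro h x ⟨hx, hx1⟩
    have := h x hx
    rwa [map_mul, eval_linForm, hx1, one_mul, eval_homogenize (by rw [eval_linForm, hx1])] at this

end LocalRing
end ProjGeom

namespace ProjGeom

open MvPolynomial

section LocalRing

variable {k : Type*} [Field k] [Infinite k] {m : ℕ}

/-- The data of a point in a chart: a vector of homogeneous coordinates of the point `p`, normalized
with respect to a linear form. -/
structure IsNormalized (p : PSpace k m) (a v : Fin (m + 1) → k) : Prop where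
  mem : v ∈ p.submodule
  dot : a ⬝ᵥ v = 1

namespace IsNormalized

variable {p : PSpace k m} {a v : Fin (m + 1) → k} (hp : IsNormalized p a v)
include hp

omit [Infinite k] in
theorem ne_zero : v ≠ 0 := by
  rintro rfl
  simpa using hp.dot

theorem mem_primeCompl {f : MvPolynomial (Fin (m + 1)) k} {d : ℕ} (hf : f.IsHomogeneous d) :
    f ∈ (homIdeal {p}).primeCompl ↔ eval v f ≠ 0 := by
  rw [Ideal.mem_primeCompl_iff, mem_homIdeal_singleton_of_isHomogeneous hp.mem hp.ne_zero hf]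

theorem linForm_pow_mem (d : ℕ) : linForm a ^ d ∈ (homIdeal {p}).primeCompl :=
  pow_mem ((hp.mem_primeCompl (linForm_isHomogeneous a)).mpr (by simp [hp.dot])) d

/-- The substitution `x ↦ x / h`, with `h` a linear form, as a map to the localization. -/
noncomputable def dehomAux : MvPolynomial (Fin (m + 1)) k →ₐ[k] Localization.AtPrime (homIdeal {p}) :=
  aeval fun i => IsLocalization.mk' _ (X i : MvPolynomial (Fin (m + 1)) k)
    (⟨linForm a ^ 1, hp.linForm_pow_mem 1⟩ : (homIdeal {p}).primeCompl)

theorem pow_mul_dehomAux {f : MvPolynomial (Fin (m + 1)) k} {d : ℕ} (hf : f.IsHomogeneous d) :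
    algebraMap _ (Localization.AtPrime (homIdeal {p})) (linForm a) ^ d * hp.dehomAux f =
      algebraMap _ _ f := by
  rw [dehomAux, ← aeval_mul_of_isHomogeneous hf]
  have : (fun i => algebraMap _ (Localization.AtPrime (homIdeal {p})) (linForm a) *
      IsLocalization.mk' _ (X i : MvPolynomial (Fin (m + 1)) k)
        (⟨linForm a ^ 1, hp.linForm_pow_mem 1⟩ : (homIdeal {p}).primeCompl)) =
      fun i => algebraMap _ (Localization.AtPrime (homIdeal {p}))
        (X i : MvPolynomial (Fin (m + 1)) k) := by
    funext i
    rw [mul_comm]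
    have := IsLocalization.mk'_spec (Localization.AtPrime (homIdeal {p}))
      (X i : MvPolynomial (Fin (m + 1)) k)
      (⟨linForm a ^ 1, hp.linForm_pow_mem 1⟩ : (homIdeal {p}).primeCompl)
    simpa only [pow_one] using this
  rw [this]
  have h2 : (aeval fun i => algebraMap _ (Localization.AtPrime (homIdeal {p}))
        (X i : MvPolynomial (Fin (m + 1)) k)) =
      IsScalarTower.toAlgHom k (MvPolynomial (Fin (m + 1)) k)
        (Localization.AtPrime (homIdeal {p})) := by
    ext i; simp
  rw [h2]; rfl

theorem pow_mul_dehomAux_eq_homogenize (f : MvPolynomial (Fin (m + 1)) k) :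
    algebraMap _ (Localization.AtPrime (homIdeal {p})) (linForm a) ^ f.totalDegree *
      hp.dehomAux f = algebraMap _ _ (homogenize (linForm a) f) := by
  conv_lhs => rw [← sum_homogeneousComponent f]
  rw [map_sum, Finset.mul_sum, homogenize, map_sum]
  refine Finset.sum_congr rfl fun d hd => ?_
  rw [map_mul, map_pow, ← hp.pow_mul_dehomAux (homogeneousComponent_isHomogeneous d f), ← mul_assoc,
    ← pow_add, sum_homogeneousComponent]
  congr 2
  rw [Finset.mem_range] at hd; omega

theorem isUnit_algebraMap_linForm :
    IsUnit (algebraMap _ (Localization.AtPrime (homIdeal {p})) (linForm a)) := by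
  have := IsLocalization.map_units (Localization.AtPrime (homIdeal {p}))
    (⟨linForm a ^ 1, hp.linForm_pow_mem 1⟩ : (homIdeal {p}).primeCompl)
  simpa only [pow_one] using this

/-- The dehomogenization of a polynomial as an element of the local ring. -/
noncomputable def dehomFun (f : MvPolynomial (Fin (m + 1)) k) : AmbientLocalRing p :=
  HomogeneousLocalization.mk
    { deg := f.totalDegree
      num := ⟨homogenize (linForm a) f, homogenize_isHomogeneous (linForm_isHomogeneous a) f⟩
      den := ⟨linForm a ^ f.totalDegree, by
        simpa using (linForm_isHomogeneous a).pow f.totalDegree⟩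
      den_mem := hp.linForm_pow_mem _ }

theorem val_dehomFun (f : MvPolynomial (Fin (m + 1)) k) : (hp.dehomFun f).val = hp.dehomAux f := by
  refine (hp.isUnit_algebraMap_linForm.pow f.totalDegree).mul_left_cancel ?_
  rw [pow_mul_dehomAux_eq_homogenize, dehomFun, HomogeneousLocalization.val_mk,
    Localization.mk_eq_mk', ← map_pow, mul_comm]
  exact IsLocalization.mk'_spec _ _ _

/-- The substitution `x ↦ x / h`, with `h` a linear form, as a map to the local ring. -/
noncomputable def dehom : MvPolynomial (Fin (m + 1)) k →+* AmbientLocalRing p where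
  toFun := hp.dehomFun
  map_one' := HomogeneousLocalization.val_injective _ (by simp [val_dehomFun])
  map_mul' _ _ := HomogeneousLocalization.val_injective _ (by simp [val_dehomFun])
  map_zero' := HomogeneousLocalization.val_injective _ (by simp [val_dehomFun])
  map_add' _ _ := HomogeneousLocalization.val_injective _ (by simp [val_dehomFun])

theorem val_dehom (f : MvPolynomial (Fin (m + 1)) k) : (hp.dehom f).val = hp.dehomAux f :=
  hp.val_dehomFun f

theorem isUnit_dehom {f : MvPolynomial (Fin (m + 1)) k} (hf : eval v f ≠ 0) :
    IsUnit (hp.dehom f) := by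
  rw [← HomogeneousLocalization.isUnit_iff_isUnit_val, val_dehom]
  have h1 : homogenize (linForm a) f ∈ (homIdeal {p}).primeCompl := by
    rw [hp.mem_primeCompl (homogenize_isHomogeneous (linForm_isHomogeneous a) f),
      eval_homogenize (by rw [eval_linForm, hp.dot])]
    exact hf
  have h2 := IsLocalization.map_units (Localization.AtPrime (homIdeal {p}))
    (⟨_, h1⟩ : (homIdeal {p}).primeCompl)
  rw [← hp.pow_mul_dehomAux_eq_homogenize] at h2
  exact isUnit_of_mul_isUnit_right h2

theorem dehom_surj (z : AmbientLocalRing p) : ∃ f g : MvPolynomial (Fin (m + 1)) k,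
    eval v g ≠ 0 ∧ z * hp.dehom g = hp.dehom f := by
  obtain ⟨⟨d, ⟨f, hf⟩, ⟨g, hg⟩, hgp⟩, rfl⟩ := HomogeneousLocalization.mk_surjective z
  refine ⟨f, g, (hp.mem_primeCompl hg).mp hgp, HomogeneousLocalization.val_injective _ ?_⟩
  rw [HomogeneousLocalization.val_mul, val_dehom, val_dehom, HomogeneousLocalization.val_mk,
    Localization.mk_eq_mk']
  refine (hp.isUnit_algebraMap_linForm.pow d).mul_left_cancel ?_
  rw [mul_left_comm, pow_mul_dehomAux hp hf, pow_mul_dehomAux hp hg]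
  exact IsLocalization.mk'_spec _ _ _

/-- Lying in the stalk means lying in the ideal after multiplication by some `s` that is a unit at
`p`. As the ideal of `Z` is homogeneous, `s` may be replaced by a component that does not vanish at
`v`; conversely an affine `s` is homogenized. -/
theorem dehom_mem_localIdeal {Z : Set (PSpace k m)} {f : MvPolynomial (Fin (m + 1)) k} :
    hp.dehom f ∈ localIdeal Z p ↔
      ∃ s, eval v s ≠ 0 ∧ s * f ∈ vanishingIdeal k (slice (affineCone Z) a) := by
  have hh := homogenize_isHomogeneous (linForm_isHomogeneous a) f
  have h1 : hp.dehom f ∈ localIdeal Z p ↔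
      ∃ s ∈ (homIdeal {p}).primeCompl, s * homogenize (linForm a) f ∈ homIdeal Z := by
    rw [localIdeal, Ideal.mem_comap, HomogeneousLocalization.algebraMap_apply, val_dehom,
      ← Ideal.unit_mul_mem_iff_mem _ (hp.isUnit_algebraMap_linForm.pow f.totalDegree),
      hp.pow_mul_dehomAux_eq_homogenize]
    exact IsLocalization.algebraMap_mem_map_algebraMap_iff _ _ _ _
  rw [h1]
  constructor
  · rintro ⟨s, hs, hsf⟩
    have : ∃ d, eval v (homogeneousComponent d s) ≠ 0 := by
      by_contra! h
      refine hs ?_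
      rw [SetLike.mem_coe, ← sum_homogeneousComponent s]
      refine Ideal.sum_mem _ fun d _ => ?_
      rw [mem_homIdeal_singleton_of_isHomogeneous hp.mem hp.ne_zero
        (homogeneousComponent_isHomogeneous d s)]
      exact h d
    obtain ⟨d, hd⟩ := this
    refine ⟨homogeneousComponent d s, hd, ?_⟩
    have h2 := homIdeal_hasComponents Z _ hsf (f.totalDegree + d)
    rw [mul_comm, homogeneousComponent_mul_of_left hh, homIdeal, mem_vanishingIdeal] at h2
    rw [mem_vanishingIdeal]
    rintro x ⟨hx, hx1⟩
    have := h2 x hx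
    rwa [map_mul, eval_homogenize (by rw [eval_linForm, hx1]), mul_comm, ← map_mul] at this
  · rintro ⟨s, hs, hsf⟩
    have hs' : linForm a * homogenize (linForm a) s ∈ (homIdeal {p}).primeCompl := by
      refine mul_mem (by simpa using hp.linForm_pow_mem 1) ?_
      rw [hp.mem_primeCompl (homogenize_isHomogeneous (linForm_isHomogeneous a) s),
        eval_homogenize (by rw [eval_linForm, hp.dot])]
      exact hs
    refine ⟨_, hs', ?_⟩
    rw [homIdeal, mem_vanishingIdeal]
    rw [mem_homIdeal_iff_slice, homIdeal, mem_vanishingIdeal] at hsf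
    intro x hx
    by_cases h0 : a ⬝ᵥ x = 0
    · simp [h0]
    have h1 : a ⬝ᵥ ((a ⬝ᵥ x)⁻¹ • x) = 1 := by
      rw [dotProduct_smul, smul_eq_mul, inv_mul_cancel₀ h0]
    have h2 := hsf _ (affineCone_isCone Z (a ⬝ᵥ x)⁻¹ _ hx)
    have e1 : eval ((a ⬝ᵥ x)⁻¹ • x) (linForm a) = 1 := by rw [eval_linForm, h1]
    rw [map_mul, eval_homogenize e1, map_mul, ← eval_homogenize e1 (f := s),
      ← eval_homogenize e1 (f := f), e1, one_mul, eval_smul_of_isHomogeneous hh,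
      eval_smul_of_isHomogeneous (homogenize_isHomogeneous (linForm_isHomogeneous a) s)] at h2
    have h3 : eval x (homogenize (linForm a) s) * eval x (homogenize (linForm a) f) = 0 := by
      rcases mul_eq_zero.mp h2 with h | h
      · rw [(mul_eq_zero.mp h).resolve_left (pow_ne_zero _ (inv_ne_zero h0)), zero_mul]
      · rw [(mul_eq_zero.mp h).resolve_left (pow_ne_zero _ (inv_ne_zero h0)), mul_zero]
    rw [map_mul, map_mul, mul_assoc, h3, mul_zero]

variable {Z : Set (PSpace k m)} (hpZ : p ∈ Z)
include hpZ

omit [Infinite k] in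
theorem mem_slice : v ∈ slice (affineCone Z) a := ⟨⟨p, hpZ, hp.mem⟩, hp.dot⟩

omit hpZ in
/-- The map from the coordinate ring of an affine chart to the local ring. -/
noncomputable def toLocalRing (Z : Set (PSpace k m)) :
    CoordRing (slice (affineCone Z) a) →+* LocalRingAt Z p :=
  Ideal.Quotient.lift _ ((Ideal.Quotient.mk (localIdeal Z p)).comp hp.dehom) fun f hf => by
    rw [RingHom.comp_apply, Ideal.Quotient.eq_zero_iff_mem, hp.dehom_mem_localIdeal]
    exact ⟨1, by simp, by rwa [one_mul]⟩

/-- Through this, the dimension and the lengths that define `mult` are computed in the coordinate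
ring of the chart `a = 1`. -/
theorem isLocalization :
    letI := (hp.toLocalRing Z).toAlgebra
    haveI := (pointIdeal_isMaximal (hp.mem_slice hpZ)).isPrime
    IsLocalization.AtPrime (LocalRingAt Z p) (pointIdeal (slice (affineCone Z) a) v) := by
  let := (hp.toLocalRing Z).toAlgebra
  have hv := hp.mem_slice hpZ
  have := (pointIdeal_isMaximal hv).isPrime
  have hprime : ∀ f, Ideal.Quotient.mk _ f ∈ (pointIdeal (slice (affineCone Z) a) v).primeCompl ↔
      eval v f ≠ 0 := fun f => by
    rw [Ideal.mem_primeCompl_iff, mk_mem_pointIdeal hv]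
  have hmap : ∀ f, algebraMap (CoordRing (slice (affineCone Z) a)) (LocalRingAt Z p)
      (Ideal.Quotient.mk _ f) = Ideal.Quotient.mk _ (hp.dehom f) := fun f => rfl
  refine (isLocalization_iff _ _).mpr ⟨?_, ?_, ?_⟩
  · rintro ⟨y, hy⟩
    obtain ⟨f, rfl⟩ := Ideal.Quotient.mk_surjective y
    rw [hprime] at hy
    exact (hp.isUnit_dehom hy).map (Ideal.Quotient.mk (localIdeal Z p))
  · intro z
    obtain ⟨z, rfl⟩ := Ideal.Quotient.mk_surjective z
    obtain ⟨f, g, hg, h⟩ := hp.dehom_surj z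
    refine ⟨⟨Ideal.Quotient.mk _ f, ⟨Ideal.Quotient.mk _ g, (hprime g).mpr hg⟩⟩, ?_⟩
    rw [hmap, hmap, ← h, map_mul]
  · intro x y hxy
    obtain ⟨f, rfl⟩ := Ideal.Quotient.mk_surjective x
    obtain ⟨g, rfl⟩ := Ideal.Quotient.mk_surjective y
    rw [hmap, hmap, Ideal.Quotient.mk_eq_mk_iff_sub_mem, ← map_sub, hp.dehom_mem_localIdeal] at hxy
    obtain ⟨s, hs, hsf⟩ := hxy
    refine ⟨⟨Ideal.Quotient.mk _ s, (hprime s).mpr hs⟩, ?_⟩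
    change Ideal.Quotient.mk _ s * _ = Ideal.Quotient.mk _ s * _
    rw [← map_mul, ← map_mul, Ideal.Quotient.mk_eq_mk_iff_sub_mem, ← mul_sub]
    exact hsf

theorem ringKrullDim_localRingAt :
    ringKrullDim (LocalRingAt Z p) = (pointIdeal (slice (affineCone Z) a) v).height := by
  let := (hp.toLocalRing Z).toAlgebra
  have := (pointIdeal_isMaximal (hp.mem_slice hpZ)).isPrime
  have := hp.isLocalization hpZ
  exact IsLocalization.AtPrime.ringKrullDim_eq_height _ _

theorem length_localRingAt (t : ℕ) :
    Module.length (LocalRingAt Z p) (LocalRingAt Z p ⧸ maximalIdealAt Z p ^ t) =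
      Module.length k (CoordRing (slice (affineCone Z) a) ⧸
        pointIdeal (slice (affineCone Z) a) v ^ t) := by
  let := (hp.toLocalRing Z).toAlgebra
  have hv := hp.mem_slice hpZ
  have hmax := pointIdeal_isMaximal hv
  have := hp.isLocalization hpZ
  have hloc := IsLocalization.AtPrime.isLocalRing (LocalRingAt Z p)
    (pointIdeal (slice (affineCone Z) a) v)
  have h : maximalIdealAt Z p = IsLocalRing.maximalIdeal (LocalRingAt Z p) :=
    IsLocalRing.map_maximalIdeal_of_surjective _ Ideal.Quotient.mk_surjective
  rw [h]
  exact length_quotient_maximalIdeal_pow _ (algebraMap_quotient_pointIdeal_surjective hv) t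

end IsNormalized

end LocalRing
end ProjGeom

namespace ProjGeom

/-! ### Reductions of ideals and comparison of colengths -/

section Comparison

/-- The hypothesis, multiplied by powers of `𝔫` and fed into its own error term, pushes that term
into `𝔫 ^ M` for any `M`. The factors `𝔪` are then split off one at a time. -/
theorem pow_le_sup_of_reduction {B : Type*} [CommRing B] {𝔪 𝔫 : Ideal B} {D : ℕ}
    (h : 𝔫 ^ (D + 1) ≤ 𝔪 * 𝔫 ^ D ⊔ 𝔫 ^ (D + 2)) (t M : ℕ) : 𝔫 ^ (D + t) ≤ 𝔪 ^ t ⊔ 𝔫 ^ M := by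
  have h0 : ∀ e, 𝔫 ^ (D + e + 1) ≤ 𝔪 * 𝔫 ^ (D + e) ⊔ 𝔫 ^ (D + e + 2) := by
    intro e
    have := Ideal.mul_mono_right (I := 𝔫 ^ e) h
    rw [Ideal.mul_sup, ← pow_add, mul_left_comm, ← pow_add, ← pow_add] at this
    convert this using 2 <;> ring_nf
  have h1 : ∀ e j, 𝔫 ^ (D + e + 1) ≤ 𝔪 * 𝔫 ^ (D + e) ⊔ 𝔫 ^ (D + e + 1 + j) := by
    intro e j
    induction j with
    | zero => exact le_sup_right
    | succ j ih =>
      refine ih.trans (sup_le le_sup_left ?_)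
      have := h0 (e + j)
      rw [show D + e + 1 + j = D + (e + j) + 1 by ring]
      refine this.trans (sup_le_sup ?_ ?_)
      · exact Ideal.mul_mono_right (Ideal.pow_le_pow_right (by omega))
      · exact Ideal.pow_le_pow_right (by omega)
  induction t with
  | zero => simp
  | succ t ih =>
    have h2 := h1 t M
    refine h2.trans (sup_le ?_ ((Ideal.pow_le_pow_right (by omega)).trans le_sup_right))
    refine (Ideal.mul_mono_right ih).trans ?_
    rw [Ideal.mul_sup, ← pow_succ']
    exact sup_le_sup le_rfl Ideal.mul_le_right

theorem prod_sup_le {B J : Type*} [CommRing B] (I : Ideal B) (K : J → Ideal B) (s : Finset J) :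
    ∏ j ∈ s, (I ⊔ K j) ≤ I ⊔ ∏ j ∈ s, K j := by
  classical
  induction s using Finset.induction_on with
  | empty => simp
  | insert j s hj ih =>
    rw [Finset.prod_insert hj, Finset.prod_insert hj]
    refine (Ideal.mul_mono_right ih).trans ?_
    rw [Ideal.mul_sup]
    refine sup_le (Ideal.mul_le_right.trans le_sup_left) ?_
    rw [Ideal.sup_mul]
    exact sup_le (Ideal.mul_le_left.trans le_sup_left) le_sup_right

/-- For coprime ideals the intersection is a product, and the product of the `𝔪 ^ t ⊔ 𝔫 j ^ M` lies
in `𝔪 ^ t ⊔ (⨅ j, 𝔫 j) ^ M`. For large `M` the second term is absorbed, by the radical hypothesis,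
so no localization is needed. -/
theorem iInf_pow_le_of_reduction {B J : Type*} [CommRing B] [IsNoetherianRing B] [Fintype J]
    {𝔪 : Ideal B} {𝔫 : J → Ideal B} {D : ℕ} (hcop : Pairwise (Function.onFun IsCoprime 𝔫))
    (hrad : ⨅ j, 𝔫 j ≤ 𝔪.radical)
    (h : ∀ j, 𝔫 j ^ (D + 1) ≤ 𝔪 * 𝔫 j ^ D ⊔ 𝔫 j ^ (D + 2)) (t : ℕ) :
    ⨅ j, 𝔫 j ^ (D + t) ≤ 𝔪 ^ t := by
  obtain ⟨M, hM⟩ : ∃ M, (⨅ j, 𝔫 j) ^ M ≤ 𝔪 ^ t := by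
    rcases Nat.eq_zero_or_pos t with rfl | ht
    · exact ⟨0, le_rfl⟩
    refine Ideal.exists_pow_le_of_le_radical_of_fg ?_ (IsNoetherian.noetherian _)
    rwa [Ideal.radical_pow _ ht.ne']
  have h1 : ⨅ j, 𝔫 j ^ (D + t) = ∏ j, 𝔫 j ^ (D + t) := by
    rw [Ideal.prod_eq_iInf_of_pairwise_isCoprime]
    · simp
    · intro i _ j _ hij
      exact (hcop hij).pow
  have h2 : ∏ j, 𝔫 j ≤ ⨅ j, 𝔫 j := by
    refine le_iInf fun j => Ideal.prod_le_inf.trans (Finset.inf_le (Finset.mem_univ j))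
  rw [h1]
  refine (Finset.prod_le_prod' fun j _ => pow_le_sup_of_reduction (h j) t M).trans ?_
  refine (prod_sup_le _ _ _).trans (sup_le le_rfl ?_)
  rw [Finset.prod_pow]
  exact (Ideal.pow_right_mono h2 M).trans hM

/-- With `I` the intersection of the `𝔫 j ^ (t + c + D)`, Artin–Rees for the image of `A` in `B`
puts `I ∩ A` inside `𝔪 ^ t`. So `A ⧸ 𝔪 ^ t` is a quotient of `A ⧸ (I ∩ A)`, which embeds in `B ⧸ I`
and thus in the product of the `B ⧸ 𝔫 j ^ (t + c + D)`. -/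
theorem exists_length_le_sum {k A B J : Type*} [Field k] [CommRing A] [CommRing B] [Algebra k A]
    [Algebra k B] [Algebra A B] [IsScalarTower k A B] [IsNoetherianRing A] [Module.Finite A B]
    [Fintype J] (hinj : Function.Injective (algebraMap A B)) {𝔪 : Ideal A} {𝔫 : J → Ideal B}
    {D : ℕ} (hcop : Pairwise (Function.onFun IsCoprime 𝔫))
    (hrad : ⨅ j, 𝔫 j ≤ (𝔪.map (algebraMap A B)).radical)
    (h : ∀ j, 𝔫 j ^ (D + 1) ≤ 𝔪.map (algebraMap A B) * 𝔫 j ^ D ⊔ 𝔫 j ^ (D + 2)) :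
    ∃ c, ∀ t, Module.length k (A ⧸ 𝔪 ^ t) ≤ ∑ j, Module.length k (B ⧸ 𝔫 j ^ (t + c)) := by
  have : IsNoetherianRing B := IsNoetherianRing.of_finite A B
  obtain ⟨c, hc⟩ := Ideal.exists_pow_inf_eq_pow_smul 𝔪 (LinearMap.range (Algebra.linearMap A B))
  refine ⟨c + D, fun t => ?_⟩
  set I := ⨅ j, 𝔫 j ^ (t + (c + D)) with hI
  have hle : I ≤ (𝔪.map (algebraMap A B)) ^ (t + c) := by
    have := iInf_pow_le_of_reduction hcop hrad h (t + c)
    rwa [show D + (t + c) = t + (c + D) by ring] at this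
  have hcomap : I.comap (algebraMap A B) ≤ 𝔪 ^ t := by
    intro x hx
    have h1 : algebraMap A B x ∈ (𝔪.map (algebraMap A B)) ^ (t + c) := hle hx
    have h2 : algebraMap A B x ∈ 𝔪 ^ (t + c) • (⊤ : Submodule A B) ⊓
        LinearMap.range (Algebra.linearMap A B) := by
      refine ⟨?_, ⟨x, rfl⟩⟩
      rw [SetLike.mem_coe, Ideal.smul_top_eq_map]
      rwa [← Ideal.map_pow] at h1
    rw [hc _ (Nat.le_add_left c t), Nat.add_sub_cancel] at h2
    have h3 : 𝔪 ^ t • (𝔪 ^ c • (⊤ : Submodule A B) ⊓ LinearMap.range (Algebra.linearMap A B)) ≤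
        Submodule.map (Algebra.linearMap A B) (𝔪 ^ t) := by
      refine (Submodule.smul_mono le_rfl inf_le_right).trans ?_
      rw [LinearMap.range_eq_map, ← Submodule.map_smul'']
      refine Submodule.map_mono ?_
      simp
    obtain ⟨y, hy, hxy⟩ := h3 h2
    rwa [← hinj hxy]
  calc Module.length k (A ⧸ 𝔪 ^ t)
      ≤ Module.length k (A ⧸ I.comap (algebraMap A B)) :=
        Module.length_le_of_surjective (Ideal.Quotient.factorₐ k hcomap).toLinearMap
          (Ideal.Quotient.factor_surjective hcomap)
    _ ≤ Module.length k (B ⧸ I) :=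
        Module.length_le_of_injective
          (Ideal.quotientMapₐ I (IsScalarTower.toAlgHom k A B) le_rfl).toLinearMap
          (Ideal.quotientMap_injective (I := I) (f := algebraMap A B))
    _ ≤ Module.length k (∀ j, B ⧸ 𝔫 j ^ (t + (c + D))) := by
        refine Module.length_le_of_injective (LinearMap.mk (AddHom.mk
          (Ideal.quotientInfToPiQuotient fun j => 𝔫 j ^ (t + (c + D))) (map_add _)) ?_)
          (Ideal.quotientInfToPiQuotient_inj _)
        intro r x
        obtain ⟨x, rfl⟩ := Ideal.Quotient.mk_surjective x
        rfl
    _ = _ := Module.length_pi_of_fintype k _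

end Comparison

end ProjGeom

namespace ProjGeom

open Filter Topology

/-! ### Upper limits of normalized length functions -/

section Limsup

theorem limsup_add_le_ennreal (u v : ℕ → ENNReal) :
    limsup (fun t => u t + v t) atTop ≤ limsup u atTop + limsup v atTop := by
  refine ENNReal.le_of_forall_pos_le_add fun ε hε hlt => ?_
  have hε' : (ε / 2 : NNReal) ≠ 0 := (half_pos hε).ne'
  have hu : limsup u atTop ≠ ⊤ := (lt_of_le_of_lt le_self_add hlt).ne
  have hv : limsup v atTop ≠ ⊤ := (lt_of_le_of_lt le_add_self hlt).ne
  have h1 := eventually_lt_of_limsup_lt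
    (ENNReal.lt_add_right hu (ENNReal.coe_ne_zero.mpr hε'))
  have h2 := eventually_lt_of_limsup_lt
    (ENNReal.lt_add_right hv (ENNReal.coe_ne_zero.mpr hε'))
  refine limsup_le_of_le (h := ?_)
  filter_upwards [h1, h2] with t ht1 ht2
  refine (add_le_add ht1.le ht2.le).trans (le_of_eq ?_)
  rw [add_add_add_comm, ← ENNReal.coe_add, add_halves]

theorem limsup_finset_sum_le {J : Type*} (s : Finset J) (u : J → ℕ → ENNReal) :
    limsup (fun t => ∑ j ∈ s, u j t) atTop ≤ ∑ j ∈ s, limsup (u j) atTop := by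
  classical
  induction s using Finset.induction_on with
  | empty => simp
  | insert j s hj ih =>
    simp only [Finset.sum_insert hj]
    exact (limsup_add_le_ennreal (u j) (fun t => ∑ j ∈ s, u j t)).trans (by gcongr)

theorem tendsto_natCast_add_div_pow (c d : ℕ) :
    Tendsto (fun t : ℕ => (((t + c : ℕ) : ENNReal) / (t : ENNReal)) ^ d) atTop (𝓝 1) := by
  have h1 : Tendsto (fun t : ℕ => 1 + (c : ENNReal) / (t : ENNReal)) atTop (𝓝 (1 + 0)) := by
    refine Tendsto.const_add _ ?_
    exact ENNReal.Tendsto.const_div ENNReal.tendsto_nat_nhds_top (by simp) |>.trans (by simp)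
  rw [add_zero] at h1
  have h2 := ENNReal.Tendsto.pow (n := d) h1
  rw [one_pow] at h2
  refine h2.congr' ?_
  filter_upwards [eventually_gt_atTop 0] with t ht
  rw [Nat.cast_add, ENNReal.add_div, ENNReal.div_self (by simpa using ht.ne') (by simp)]

/-- The correction factor `((t + c) / t) ^ d` tends to `1`. -/
theorem limsup_shift_le (d c : ℕ) (g : ℕ → ENNReal) :
    limsup (fun t : ℕ => g (t + c) / (t : ENNReal) ^ d) atTop ≤
      limsup (fun t : ℕ => g t / (t : ENNReal) ^ d) atTop := by
  have h1 : (fun t : ℕ => g (t + c) / (t : ENNReal) ^ d) =ᶠ[atTop]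
      (fun t : ℕ => (((t + c : ℕ) : ENNReal) / (t : ENNReal)) ^ d) *
        (fun t : ℕ => g (t + c) / ((t + c : ℕ) : ENNReal) ^ d) := by
    filter_upwards [eventually_gt_atTop 0] with t ht
    have h0 : (((t + c : ℕ) : ENNReal)) ^ d ≠ 0 := pow_ne_zero _ (by simp; omega)
    have h2 : (((t + c : ℕ) : ENNReal)) ^ d ≠ ⊤ := ENNReal.pow_ne_top (by simp)
    simp only [Pi.mul_apply]
    simp only [div_eq_mul_inv, mul_pow, ← ENNReal.inv_pow]
    calc g (t + c) * ((t : ENNReal) ^ d)⁻¹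
        = g (t + c) * ((t : ENNReal) ^ d)⁻¹ *
          ((((t + c : ℕ) : ENNReal)) ^ d * ((((t + c : ℕ) : ENNReal)) ^ d)⁻¹) := by
          rw [ENNReal.mul_inv_cancel h0 h2, mul_one]
      _ = _ := by ring
  have hlim := (tendsto_natCast_add_div_pow c d).limsup_eq
  rw [limsup_congr h1]
  refine (ENNReal.limsup_mul_le' (Or.inl (by rw [hlim]; simp)) (Or.inl (by rw [hlim]; simp))).trans ?_
  rw [hlim, one_mul]
  exact (limsup_nat_add (fun t : ℕ => g t / (t : ENNReal) ^ d) c).le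

/-- Subadditivity of the upper limit is enough here, so the existence of the limits plays no role.
-/
theorem limsup_le_sum_limsup {J : Type*} [Fintype J] (a : ENNReal) (d c : ℕ) {f : ℕ → ENNReal}
    {g : J → ℕ → ENNReal} (h : ∀ t, f t ≤ ∑ j, g j (t + c)) :
    limsup (fun t : ℕ => a * f t / (t : ENNReal) ^ d) atTop ≤
      ∑ j, limsup (fun t : ℕ => a * g j t / (t : ENNReal) ^ d) atTop := by
  have h1 : ∀ t : ℕ, a * f t / (t : ENNReal) ^ d ≤ ∑ j, a * g j (t + c) / (t : ENNReal) ^ d := by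
    intro t
    simp only [div_eq_mul_inv]
    rw [← Finset.sum_mul, ← Finset.mul_sum]
    gcongr
    exact h t
  refine (limsup_le_limsup (Eventually.of_forall h1)).trans ?_
  refine (limsup_finset_sum_le _ _).trans (Finset.sum_le_sum fun j _ => ?_)
  exact limsup_shift_le d c fun t => a * g j t

end Limsup

end ProjGeom

namespace ProjGeom

open MvPolynomial

/-! ### Transcendence degree along inclusions of primes -/

section Trdeg

/-- An algebra contains `d` algebraically independent elements. -/
def HasIndep (k A : Type*) [Field k] [CommRing A] [Algebra k A] (d : ℕ) : Prop :=
  ∃ x : Fin d → A, AlgebraicIndependent k x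

/-- Lifts of independent elements of `S ⧸ Q` stay independent in `S ⧸ P`, and any `f` in `Q` but not
in `P` is transcendental over them: a relation for `f`, divided by a power of `f`, has a nonzero
constant coefficient, and this vanishes modulo `Q`, against independence there. -/
theorem HasIndep.succ_of_lt {k S : Type*} [Field k] [CommRing S] [Algebra k S] {P Q : Ideal S}
    [P.IsPrime] [Q.IsPrime] (hPQ : P < Q) {d : ℕ} (h : HasIndep k (S ⧸ Q) d) :
    HasIndep k (S ⧸ P) (d + 1) := by
  obtain ⟨x, hx⟩ := h
  obtain ⟨f, hfQ, hfP⟩ := SetLike.exists_of_lt hPQ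
  choose y hy using fun i => Ideal.Quotient.mk_surjective (x i)
  let π : S ⧸ P →ₐ[k] S ⧸ Q := Ideal.Quotient.factorₐ k hPQ.le
  have hπ : ∀ s : S, π (Ideal.Quotient.mk P s) = Ideal.Quotient.mk Q s := fun s => rfl
  let y' : Fin d → S ⧸ P := fun i => Ideal.Quotient.mk P (y i)
  have hπy : π ∘ y' = x := by funext i; simp [y', hπ, hy]
  have hy' : AlgebraicIndependent k y' := AlgebraicIndependent.of_comp π (by rwa [hπy])
  have htr : Transcendental (Algebra.adjoin k (Set.range y')) (Ideal.Quotient.mk P f) := by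
    intro halg
    have hf0 : Ideal.Quotient.mk P f ≠ 0 := by rwa [Ne, Ideal.Quotient.eq_zero_iff_mem]
    obtain ⟨q, hq0, hq⟩ := halg.exists_nonzero_coeff_and_aeval_eq_zero
      (mem_nonZeroDivisors_of_ne_zero hf0)
    have h1 : ((q.coeff 0 : Algebra.adjoin k (Set.range y')) : S ⧸ P) +
        Ideal.Quotient.mk P f * Polynomial.aeval (Ideal.Quotient.mk P f) q.divX = 0 := by
      rw [← hq]
      conv_rhs => rw [← Polynomial.divX_mul_X_add q]
      rw [map_add, map_mul, Polynomial.aeval_X, Polynomial.aeval_C, add_comm, mul_comm]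
      rfl
    have h2 : π (q.coeff 0 : Algebra.adjoin k (Set.range y')) = 0 := by
      have := congrArg π h1
      rwa [map_add, map_mul, hπ, Ideal.Quotient.eq_zero_iff_mem.mpr hfQ, zero_mul, add_zero,
        map_zero] at this
    obtain ⟨c, hc⟩ := (Algebra.adjoin_range_eq_range_aeval k y').le (q.coeff 0).2
    change aeval y' c = _ at hc
    have h3 : c = 0 := by
      refine hx.eq_zero_of_aeval_eq_zero c ?_
      rw [← hπy, ← h2, ← hc]
      exact (comp_aeval_apply (R := k) y' π c).symm
    refine hq0 (Subtype.ext ?_)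
    rw [← hc, h3]
    simp
  have h4 := (hy'.option_iff_transcendental _).mpr htr
  exact ⟨_, h4.comp (finSuccEquiv d) (finSuccEquiv d).injective⟩

theorem HasIndep.le_of_isAlgebraic {k A : Type*} [Field k] [CommRing A] [IsDomain A] [Algebra k A]
    {r : Type*} [Fintype r] (y : r → A) [Algebra.IsAlgebraic (Algebra.adjoin k (Set.range y)) A]
    {d : ℕ} (h : HasIndep k A d) : d ≤ Fintype.card r := by
  obtain ⟨x, hx⟩ := h
  have h1 := hx.lift_cardinalMk_le_trdeg
  have h2 : Algebra.trdeg k A ≤ Cardinal.mk (Set.range y) :=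
    Algebra.IsAlgebraic.trdeg_le_cardinalMk k (Set.range y)
  have h3 : Cardinal.mk (Set.range y) ≤ (Fintype.card r : Cardinal) := by
    classical
    rw [Cardinal.mk_fintype]
    exact_mod_cast Fintype.card_le_of_surjective _ Set.rangeFactorization_surjective
  have h4 := Cardinal.lift_le.mpr (h2.trans h3)
  have h5 := h1.trans h4
  simpa using h5

theorem HasIndep.algebraicIndependent {k A : Type*} [Field k] [CommRing A] [IsDomain A]
    [Algebra k A] {r : Type*} [Fintype r] (y : r → A)
    [Algebra.IsAlgebraic (Algebra.adjoin k (Set.range y)) A]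
    (h : HasIndep k A (Fintype.card r)) : AlgebraicIndependent k y := by
  obtain ⟨x, hx⟩ := h
  have h1 := hx.lift_cardinalMk_le_trdeg
  refine (Algebra.IsAlgebraic.isTranscendenceBasis_of_lift_le_trdeg_of_finite k y ?_).1
  simpa using h1

theorem isAlgebraic_adjoin_of_finite {k A : Type*} [Field k] [CommRing A] [IsDomain A] [Algebra k A]
    {r : Type*} (φ : MvPolynomial r k →ₐ[k] A) (h : φ.toRingHom.Finite) :
    Algebra.IsAlgebraic (Algebra.adjoin k (Set.range fun j => φ (X j))) A := by
  have hφ : φ = aeval (fun j => φ (X j)) := by ext; simp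
  constructor
  intro x
  obtain ⟨p, hp, hpx⟩ := h.to_isIntegral x
  have hint : IsIntegral (Algebra.adjoin k (Set.range fun j => φ (X j))) x := by
    have hmem : ∀ f, φ f ∈ Algebra.adjoin k (Set.range fun j => φ (X j)) := fun f => by
      rw [Algebra.adjoin_range_eq_range_aeval, ← hφ]
      exact ⟨f, rfl⟩
    let ψ : MvPolynomial r k →+* Algebra.adjoin k (Set.range fun j => φ (X j)) :=
      (φ.codRestrict _ hmem).toRingHom
    refine ⟨p.map ψ, hp.map ψ, ?_⟩
    rw [Polynomial.eval₂_map]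
    exact hpx
  exact hint.isAlgebraic

end Trdeg

end ProjGeom

namespace ProjGeom

open MvPolynomial

/-! ### Noether normalization by linear forms -/

section Finiteness

variable {k : Type*} [Field k] {ι : Type*} [Fintype ι]

/-- A graded Nakayama argument. By the projective Nullstellensatz all forms of degree at least `D`
lie in `I` plus the ideal of the rows of `L`. So modulo `I` a form of degree greater than `D` is a
combination of the rows with coefficients of one degree less, and the monomials of degree at most
`D` generate. -/
theorem finite_linMap [IsAlgClosed k] {I : Ideal (MvPolynomial ι k)} (hI : HasComponents I)
    {r : Type*} [Fintype r] (L : Matrix r ι k)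
    (hL : ∀ x ∈ zeroLocus k I, L.mulVec x = 0 → x = 0) :
    ((Ideal.Quotient.mk I).comp (linMap L).toRingHom).Finite := by
  set φ := (Ideal.Quotient.mk I).comp (linMap L).toRingHom with hφ
  set J : Ideal (MvPolynomial ι k) := I ⊔ Ideal.span (Set.range fun j => linForm (L j)) with hJ
  obtain ⟨D, hD⟩ : ∃ D, idealOfVars ι k ^ D ≤ J := by
    refine exists_pow_idealOfVars_le fun x hx => ?_
    rw [mem_zeroLocus] at hx
    refine hL x (mem_zeroLocus.mpr fun f hf => hx f (Ideal.mem_sup_left hf)) ?_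
    funext j
    have := hx (linForm (L j)) (Ideal.mem_sup_right (Ideal.subset_span ⟨j, rfl⟩))
    rwa [eval_linForm] at this
  let alg : Algebra (MvPolynomial r k) (MvPolynomial ι k ⧸ I) := φ.toAlgebra
  let mod : Module (MvPolynomial r k) (MvPolynomial ι k ⧸ I) := alg.toModule
  have hsmul : ∀ (g : MvPolynomial r k) (f : MvPolynomial ι k),
      g • Ideal.Quotient.mk I f = Ideal.Quotient.mk I (linMap L g * f) := fun g f => rfl
  set G : Set (MvPolynomial ι k ⧸ I) :=
    (fun m : ι →₀ ℕ => Ideal.Quotient.mk I (monomial m 1)) '' {m | m.degree < D + 1} with hG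
  have hGfin : G.Finite := (Finsupp.finite_of_degree_lt (D + 1)).image _
  set M := Submodule.span (MvPolynomial r k) G with hM
  have key : ∀ e, ∀ f : MvPolynomial ι k, f.IsHomogeneous e → Ideal.Quotient.mk I f ∈ M := by
    intro e
    induction e with
    | zero =>
      intro f hf
      rw [← mem_homogeneousSubmodule, homogeneousSubmodule_zero] at hf
      obtain ⟨c, rfl⟩ := Submodule.mem_one.mp hf
      have : Ideal.Quotient.mk I (algebraMap k (MvPolynomial ι k) c) =
          (C c : MvPolynomial r k) • Ideal.Quotient.mk I (monomial 0 1) := by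
        rw [hsmul, linMap, aeval_C]
        simp
      rw [this]
      exact M.smul_mem _ (Submodule.subset_span ⟨0, by simp, rfl⟩)
    | succ e ih =>
      intro f hf
      by_cases he : e + 1 < D + 1
      · have : Ideal.Quotient.mk I f = ∑ m ∈ f.support, (C (coeff m f) : MvPolynomial r k) •
            Ideal.Quotient.mk I (monomial m 1) := by
          conv_lhs => rw [f.as_sum]
          rw [map_sum]
          refine Finset.sum_congr rfl fun m _ => ?_
          rw [hsmul, linMap, aeval_C, algebraMap_eq, C_mul_monomial, mul_one]
        rw [this]
        refine M.sum_mem fun m hm => M.smul_mem _ (Submodule.subset_span ⟨m, ?_, rfl⟩)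
        have := hf (mem_support_iff.mp hm)
        rw [Set.mem_ofPred_eq, Finsupp.degree_eq_weight_one]
        exact this ▸ he
      · have h1 : f ∈ J := hD (mem_pow_idealOfVars_of_isHomogeneous hf (by omega))
        obtain ⟨i, hi, g, hg, hig⟩ := Submodule.mem_sup.mp h1
        obtain ⟨c, rfl⟩ := (Ideal.mem_span_range_iff_exists_fun).mp hg
        have h2 := congrArg (homogeneousComponent (1 + e)) hig
        rw [map_add, map_sum, homogeneousComponent_eq_self (p := f) (by rwa [add_comm])] at h2
        rw [← h2, map_add, Ideal.Quotient.eq_zero_iff_mem.mpr (hI _ hi _), zero_add, map_sum]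
        refine M.sum_mem fun j _ => ?_
        rw [mul_comm, homogeneousComponent_mul_of_left (linForm_isHomogeneous _), ← linMap_X,
          ← hsmul]
        exact M.smul_mem _ (ih _ (homogeneousComponent_isHomogeneous _ _))
  have htop : M = ⊤ := by
    rw [eq_top_iff]
    rintro x -
    obtain ⟨f, rfl⟩ := Ideal.Quotient.mk_surjective x
    rw [← sum_homogeneousComponent f, map_sum]
    exact M.sum_mem fun d _ => key d _ (homogeneousComponent_isHomogeneous d f)
  exact ⟨⟨hGfin.toFinset, by rw [hGfin.coe_toFinset, ← hM, htop]⟩⟩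

theorem vanishingIdeal_le_slice (C : Set (ι → k)) (a : ι → k) :
    vanishingIdeal k C ≤ vanishingIdeal k (slice C a) :=
  vanishingIdeal_anti_mono fun _ hx => hx.1

/-- On the slice the `i`-th form is `1`, so the `i`-th variable acts as a constant and can be
dropped. -/
theorem finite_slice [IsAlgClosed k] {C : Set (ι → k)} (hC : IsCone (k := k) C) {d : ℕ}
    (L : Matrix (Fin (d + 1)) ι k)
    (hL : ∀ x ∈ zeroLocus k (vanishingIdeal k C), L.mulVec x = 0 → x = 0) (i : Fin (d + 1)) :
    ((Ideal.Quotient.mk (vanishingIdeal k (slice C (L i)))).comp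
      (linMap (L.submatrix i.succAbove id)).toRingHom).Finite := by
  have h1 := finite_linMap (hasComponents_vanishingIdeal hC) L hL
  have h2 : (Ideal.Quotient.factor (vanishingIdeal_le_slice C (L i))).Finite :=
    RingHom.Finite.of_surjective _ (Ideal.Quotient.factor_surjective _)
  have h3 := h2.comp h1
  let ρ : MvPolynomial (Fin (d + 1)) k →ₐ[k] MvPolynomial (Fin d) k :=
    aeval (i.insertNth 1 fun j => X j)
  have h4 : (Ideal.Quotient.factor (vanishingIdeal_le_slice C (L i))).comp
      ((Ideal.Quotient.mk (vanishingIdeal k C)).comp (linMap L).toRingHom) =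
      ((Ideal.Quotient.mk (vanishingIdeal k (slice C (L i)))).comp
      (linMap (L.submatrix i.succAbove id)).toRingHom).comp ρ.toRingHom := by
    refine MvPolynomial.ringHom_ext (fun c => ?_) fun j => ?_
    · simp [linMap, ρ]
    · refine Fin.succAboveCases i ?_ (fun j => ?_) j
      · simp only [AlgHom.toRingHom_eq_coe, RingHom.coe_comp, RingHom.coe_coe, Function.comp_apply,
          linMap_X, Ideal.Quotient.factor_mk, ρ, aeval_X, Fin.insertNth_apply_same, map_one]
        rw [← map_one (Ideal.Quotient.mk _), Ideal.Quotient.mk_eq_mk_iff_sub_mem, mem_vanishingIdeal]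
        rintro x ⟨-, hx⟩
        simp [hx]
      · simp [ρ]
        rfl
  rw [h4] at h3
  exact RingHom.Finite.of_comp_finite h3

end Finiteness

end ProjGeom

namespace ProjGeom

open MvPolynomial

/-! ### Local dimension of a chart -/

section Height

variable {k : Type*} [Field k] {ι : Type*} [Fintype ι]

theorem ringKrullDim_le_of_finite {R S : Type*} [CommRing R] [CommRing S] (φ : R →+* S)
    (hφ : φ.Finite) : ringKrullDim S ≤ ringKrullDim R := by
  algebraize [φ]
  refine Order.krullDim_le_of_strictMono (PrimeSpectrum.comap φ) fun P Q h => ?_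
  have : Algebra.IsIntegral R S := Algebra.IsIntegral.of_finite R S
  exact Ideal.IsIntegral.comap_lt_comap (A := S) h

/-- The automorphism of a polynomial ring given by a translation. -/
noncomputable def translate {σ : Type*} (z : σ → k) : MvPolynomial σ k →ₐ[k] MvPolynomial σ k :=
  aeval fun i => X i + C (z i)

@[simp] theorem eval_translate {σ : Type*} (z x : σ → k) (f : MvPolynomial σ k) :
    eval x (translate z f) = eval (x + z) f := by
  have h : (aeval x).comp (translate z) = (aeval (x + z) : MvPolynomial σ k →ₐ[k] k) := by
    ext i; simp [translate]
  have := AlgHom.congr_fun h f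
  simpa [aeval_eq_eval] using this

theorem translate_translate {σ : Type*} {z w : σ → k} (h : z + w = 0) (f : MvPolynomial σ k) :
    translate z (translate w f) = f := by
  have h' : (translate z).comp (translate w) = AlgHom.id k (MvPolynomial σ k) := by
    ext i : 1
    have := congrFun h i
    simp only [Pi.add_apply, Pi.zero_apply] at this
    simp only [AlgHom.comp_apply, translate, aeval_X, map_add, AlgHom.id_apply, algHom_C,
      algebraMap_eq]
    rw [add_assoc, ← map_add, this, map_zero, add_zero]
  exact AlgHom.congr_fun h' f

/-- Some maximal ideal realizes the Krull dimension; it is the ideal of a point, and translations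
move it to any other point. -/
theorem height_vanishingIdeal_singleton {d : ℕ} (x : Fin d → k) [IsAlgClosed k] :
    (vanishingIdeal k {x}).height = d := by
  have hdim : ringKrullDim (MvPolynomial (Fin d) k) = d := by
    rw [MvPolynomial.ringKrullDim_of_isNoetherianRing, ringKrullDim_eq_zero_of_field]
    simp
  have : FiniteRingKrullDim (MvPolynomial (Fin d) k) := by
    rw [finiteRingKrullDim_iff_ne_bot_and_top, hdim]
    exact ⟨by simp, fun h => ENat.natCast_ne_top d (WithBot.coe_injective h)⟩
  obtain ⟨M, hM, hh⟩ := Ideal.exists_isMaximal_height (R := MvPolynomial (Fin d) k)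
  obtain ⟨y, rfl⟩ := isMaximal_iff_eq_vanishingIdeal_singleton.mp hM
  rw [hdim] at hh
  let e : MvPolynomial (Fin d) k ≃+* MvPolynomial (Fin d) k :=
    { (translate (y - x)).toRingHom with
      invFun := translate (x - y)
      left_inv := fun f => translate_translate (by simp) f
      right_inv := fun f => translate_translate (by simp) f }
  have he : ∀ f, e f = translate (y - x) f := fun f => rfl
  have h1 : vanishingIdeal k {y} = (vanishingIdeal k {x}).comap e := by
    ext f
    rw [Ideal.mem_comap, mem_vanishingIdeal, mem_vanishingIdeal, he]
    simp
  rw [h1, RingEquiv.height_comap] at hh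
  exact_mod_cast hh

theorem linForm_mul_mem_of_slice {Y : Set (ι → k)} (hY : IsCone (k := k) Y) {a : ι → k}
    {f : MvPolynomial ι k} {e : ℕ} (hf : f.IsHomogeneous e) (h : ∀ x ∈ slice Y a, eval x f = 0) :
    linForm a * f ∈ vanishingIdeal k Y := by
  rw [mem_vanishingIdeal]
  intro x hx
  rw [map_mul, eval_linForm]
  by_cases h0 : a ⬝ᵥ x = 0
  · rw [h0, zero_mul]
  · have h1 : a ⬝ᵥ ((a ⬝ᵥ x)⁻¹ • x) = 1 := by
      rw [dotProduct_smul, smul_eq_mul, inv_mul_cancel₀ h0]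
    have h2 := h _ ⟨hY _ _ hx, h1⟩
    rw [eval_smul_of_isHomogeneous hf] at h2
    rw [(mul_eq_zero.mp h2).resolve_left (pow_ne_zero _ (inv_ne_zero h0)), mul_zero]

/-- Here `Y` stands for the cone over a component of full dimension through `v`. The upper bound
holds because the slice of `C` is finite over affine `d`-space. For the lower bound, the coordinate
ring of the slice of `Y` is a domain, finite and faithful over a polynomial ring, so going down
lifts a chain of length `d` to one ending at the point. -/
theorem height_pointIdeal_slice [IsAlgClosed k] {C Y : Set (ι → k)} (hC : IsCone (k := k) C)
    (hY : IsCone (k := k) Y) (hYC : Y ⊆ C) {d : ℕ} (L : Matrix (Fin (d + 1)) ι k)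
    (hL : ∀ x ∈ zeroLocus k (vanishingIdeal k C), L.mulVec x = 0 → x = 0)
    (hprime : (vanishingIdeal k Y).IsPrime) (hinj : ∀ f, linMap L f ∈ vanishingIdeal k Y → f = 0)
    (i : Fin (d + 1)) {v : ι → k} (hv : v ∈ slice Y (L i)) :
    (pointIdeal (slice C (L i)) v).height = d := by
  set ℓ := L i with hℓ
  have hvC : v ∈ slice C ℓ := ⟨hYC hv.1, hv.2⟩
  have hmax := pointIdeal_isMaximal hvC
  have hdim : ringKrullDim (MvPolynomial (Fin d) k) = d := by
    rw [MvPolynomial.ringKrullDim_of_isNoetherianRing, ringKrullDim_eq_zero_of_field]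
    simp
  refine le_antisymm ?_ ?_
  · have h1 := ringKrullDim_le_of_finite _ (finite_slice hC L hL i)
    rw [hdim] at h1
    exact_mod_cast (Ideal.height_le_ringKrullDim_of_isPrime).trans h1
  -- the coordinate ring of the slice of `Y` is a domain
  have hℓY : linForm ℓ ∉ vanishingIdeal k Y := fun h => by
    have := mem_vanishingIdeal.mp h v hv.1
    rw [eval_linForm, hv.2] at this
    exact one_ne_zero this
  have hhom : ∀ f, homogenize (linForm ℓ) f ∈ vanishingIdeal k Y → f ∈ vanishingIdeal k (slice Y ℓ) := by
    intro f hf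
    rw [mem_vanishingIdeal] at hf ⊢
    rintro x ⟨hx, hx1⟩
    rw [← eval_homogenize (h := linForm ℓ) (by rw [eval_linForm, hx1])]
    exact hf x hx
  have hdom : (vanishingIdeal k (slice Y ℓ)).IsPrime := by
    refine ⟨fun h => ?_, fun {f g} hfg => ?_⟩
    · have := mem_vanishingIdeal.mp ((Ideal.eq_top_iff_one _).mp h) v hv
      simp at this
    · have := linForm_mul_mem_of_slice hY (hf := homogenize_isHomogeneous (linForm_isHomogeneous ℓ) f |>.mul
        (homogenize_isHomogeneous (linForm_isHomogeneous ℓ) g)) fun x hx => by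
          have e1 : eval x (linForm ℓ) = 1 := by rw [eval_linForm, hx.2]
          rw [map_mul, eval_homogenize e1, eval_homogenize e1, ← map_mul]
          exact mem_vanishingIdeal.mp hfg x hx
      exact ((hprime.mem_or_mem ((hprime.mem_or_mem this).resolve_left hℓY))).imp (hhom f) (hhom g)
  set φ : MvPolynomial (Fin d) k →+* CoordRing (slice Y ℓ) :=
    (Ideal.Quotient.mk (vanishingIdeal k (slice Y ℓ))).comp
      (linMap (L.submatrix i.succAbove id)).toRingHom with hφ
  have hφfin : φ.Finite := by
    refine finite_slice hY L (fun x hx => hL x (zeroLocus_anti_mono (vanishingIdeal_anti_mono hYC) hx)) i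
  have hφinj : Function.Injective φ := by
    rw [injective_iff_map_eq_zero]
    intro f hf
    rw [hφ, RingHom.comp_apply, Ideal.Quotient.eq_zero_iff_mem, mem_vanishingIdeal] at hf
    have hlin : ∀ x ∈ slice Y ℓ, L.mulVec x =
        i.insertNth 1 ((L.submatrix i.succAbove id).mulVec x) := by
      intro x hx
      refine (Fin.insertNth_eq_iff.mpr ⟨?_, ?_⟩).symm
      · exact hx.2.symm
      · rfl
    -- Injectivity is known on the cone, so `f` is made homogeneous with the `i`-th variable, which
    -- is `1` on the slice.
    set F := homogenize (X i) (rename i.succAbove f) with hF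
    have hFh := homogenize_isHomogeneous (isHomogeneous_X k i) (rename i.succAbove f)
    have heval : ∀ t, eval (i.insertNth 1 t) F = eval t f := by
      intro t
      rw [hF, eval_homogenize (by simp), eval_rename]
      have : (i.insertNth 1 t : Fin (d + 1) → k) ∘ i.succAbove = t := by
        funext j
        simp
      rw [this]
    have h1 := linForm_mul_mem_of_slice hY (a := ℓ) (hf := linMap_isHomogeneous L hFh) fun x hx => by
      rw [eval_linMap, hlin x hx, heval, ← eval_linMap]
      exact hf x hx
    have h2 := hinj F ((hprime.mem_or_mem h1).resolve_left hℓY)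
    refine MvPolynomial.funext fun t => ?_
    rw [← heval, h2, map_zero, map_zero]
  have hle : vanishingIdeal k (slice C ℓ) ≤ vanishingIdeal k (slice Y ℓ) :=
    vanishingIdeal_anti_mono fun x hx => ⟨hYC hx.1, hx.2⟩
  algebraize [φ]
  have : Algebra.IsIntegral (MvPolynomial (Fin d) k) (CoordRing (slice Y ℓ)) :=
    Algebra.IsIntegral.of_finite _ _
  have : FaithfulSMul (MvPolynomial (Fin d) k) (CoordRing (slice Y ℓ)) :=
    (faithfulSMul_iff_algebraMap_injective _ _).mpr hφinj
  have hmaxY := pointIdeal_isMaximal hv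
  have halg : algebraMap (MvPolynomial (Fin d) k) (CoordRing (slice Y ℓ)) = φ := rfl
  set w := (L.submatrix i.succAbove id).mulVec v with hw
  have hlies : (pointIdeal (slice Y ℓ) v).LiesOver (vanishingIdeal k {w}) := by
    constructor
    ext f
    rw [Ideal.mem_under, halg, hφ, RingHom.comp_apply, mk_mem_pointIdeal hv, mem_vanishingIdeal]
    simp [hw]
  have hfin : (vanishingIdeal k {w}).FiniteHeight := ⟨Or.inr (by
    rw [height_vanishingIdeal_singleton]; exact ENat.natCast_ne_top d)⟩
  obtain ⟨l, hl, hlen⟩ := Ideal.exists_ltSeries_length_eq_height (vanishingIdeal k {w})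
  rw [height_vanishingIdeal_singleton] at hlen
  have hlies' : (pointIdeal (slice Y ℓ) v).LiesOver l.last.asIdeal := by rw [hl]; exact hlies
  obtain ⟨l', hlen', hlast', -⟩ := Ideal.exists_ltSeries_of_hasGoingDown l (pointIdeal (slice Y ℓ) v)
  have hmono : StrictMono (PrimeSpectrum.comap (Ideal.Quotient.factor hle)) := by
    intro P Q hPQ
    refine lt_of_le_of_ne (Ideal.comap_mono hPQ.le) fun h => hPQ.ne ?_
    exact PrimeSpectrum.comap_injective_of_surjective _ (Ideal.Quotient.factor_surjective hle) h
  have hlast : (l'.map _ hmono).last = ⟨pointIdeal (slice C ℓ) v, hmax.isPrime⟩ := by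
    rw [LTSeries.last_map, hlast']
    ext x
    obtain ⟨f, rfl⟩ := Ideal.Quotient.mk_surjective x
    change Ideal.Quotient.factor hle (Ideal.Quotient.mk _ f) ∈ pointIdeal (slice Y ℓ) v ↔ _
    rw [Ideal.Quotient.factor_mk, mk_mem_pointIdeal hv]
    exact (mk_mem_pointIdeal hvC).symm
  have h := Order.length_le_height_last (p := l'.map _ hmono)
  rw [hlast, ← PrimeSpectrum.height_eq_orderHeight] at h
  rw [← hlen, ← hlen']
  exact h

end Height
end ProjGeom

namespace ProjGeom

open MvPolynomial TopologicalSpace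

/-! ### The Zariski topology, homogeneous ideals and chains of closed sets -/

section Topology

variable {k : Type*} [Field k] {m : ℕ}

theorem isClosed_iff {X : Set (PSpace k m)} : IsClosed X ↔
    ∃ S : Set (MvPolynomial (Fin (m + 1)) k), (∀ f ∈ S, ∃ d, f.IsHomogeneous d) ∧ X = zeros S := by
  rw [← isOpen_compl_iff]
  change Xᶜᶜ ∈ _ ↔ _
  rw [compl_compl]
  rfl

theorem eval_rep_eq_zero_iff {p : PSpace k m} {f : MvPolynomial (Fin (m + 1)) k} {d : ℕ}
    (hf : f.IsHomogeneous d) : eval p.rep f = 0 ↔ f ∈ homIdeal {p} :=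
  (mem_homIdeal_singleton_of_isHomogeneous (rep_mem_submodule p) p.rep_nonzero hf).symm

theorem homIdeal_le_of_mem {Z : Set (PSpace k m)} {p : PSpace k m} (hp : p ∈ Z) :
    homIdeal Z ≤ homIdeal {p} :=
  vanishingIdeal_anti_mono fun _ ⟨_, hq, hv⟩ => ⟨p, hp, by rwa [Set.mem_singleton_iff.mp hq] at hv⟩

theorem homIdeal_anti {X Y : Set (PSpace k m)} (h : X ⊆ Y) : homIdeal Y ≤ homIdeal X :=
  vanishingIdeal_anti_mono fun _ ⟨p, hp, hv⟩ => ⟨p, h hp, hv⟩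

theorem mem_homIdeal_iff {Z : Set (PSpace k m)} {f : MvPolynomial (Fin (m + 1)) k} :
    f ∈ homIdeal Z ↔ ∀ p ∈ Z, f ∈ homIdeal {p} := by
  refine ⟨fun h p hp => homIdeal_le_of_mem hp h, fun h => ?_⟩
  rw [homIdeal, mem_vanishingIdeal]
  rintro v ⟨p, hp, hv⟩
  exact mem_vanishingIdeal.mp (h p hp) v ⟨p, rfl, hv⟩

theorem mem_affineCone_of_mem_zeroLocus {Z : Set (PSpace k m)} (hZ : IsClosed Z)
    {v : Fin (m + 1) → k} (hv0 : v ≠ 0) (hv : v ∈ zeroLocus k (homIdeal Z)) :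
    v ∈ affineCone Z := by
  obtain ⟨S, hS, rfl⟩ := isClosed_iff.mp hZ
  have hvp : v ∈ (Projectivization.mk k v hv0).submodule := by
    rw [Projectivization.submodule_mk]
    exact Submodule.mem_span_singleton_self _
  refine ⟨Projectivization.mk k v hv0, fun f hf => ?_, hvp⟩
  obtain ⟨d, hd⟩ := hS f hf
  rw [eval_rep_eq_zero_iff hd, mem_homIdeal_singleton_of_isHomogeneous hvp hv0 hd]
  refine mem_zeroLocus.mp hv f ?_
  rw [mem_homIdeal_iff]
  exact fun p hp => (eval_rep_eq_zero_iff hd).mp (hp f hf)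

theorem mk_mem_of_mem_affineCone {Z : Set (PSpace k m)} {v : Fin (m + 1) → k} (hv0 : v ≠ 0)
    (hv : v ∈ affineCone Z) : Projectivization.mk k v hv0 ∈ Z := by
  obtain ⟨p, hp, hvp⟩ := hv
  have : p = Projectivization.mk k v hv0 := by
    apply Projectivization.submodule_injective
    rw [Projectivization.submodule_mk]
    ext w
    rw [mem_submodule_iff hvp hv0, Submodule.mem_span_singleton]
    exact ⟨fun ⟨c, hc⟩ => ⟨c, hc.symm⟩, fun ⟨c, hc⟩ => ⟨c, hc.symm⟩⟩
  rwa [← this]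

theorem subset_of_homIdeal_le {X Y : Set (PSpace k m)} (hX : IsClosed X)
    (h : homIdeal X ≤ homIdeal Y) : Y ⊆ X := by
  intro p hp
  have h1 : p.rep ∈ zeroLocus k (homIdeal X) := by
    rw [mem_zeroLocus]
    exact fun f hf => mem_vanishingIdeal.mp (h hf) _ ⟨p, hp, rep_mem_submodule p⟩
  have := mk_mem_of_mem_affineCone p.rep_nonzero
    (mem_affineCone_of_mem_zeroLocus hX p.rep_nonzero h1)
  rwa [Projectivization.mk_rep] at this

theorem homIdeal_lt_of_lt {X Y : IrreducibleCloseds (PSpace k m)} (h : X < Y) :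
    homIdeal (Y : Set (PSpace k m)) < homIdeal (X : Set (PSpace k m)) := by
  refine lt_of_le_not_ge (homIdeal_anti (SetLike.coe_subset_coe.mpr h.le)) fun h1 => ?_
  exact h.not_ge (subset_of_homIdeal_le X.isClosed h1)

instance : NoetherianSpace (PSpace k m) := by
  refine (noetherianSpace_TFAE (PSpace k m)).out 0 1 |>.mpr ?_
  refine ⟨(InvImage.wf (fun X : Closeds (PSpace k m) => homIdeal (X : Set (PSpace k m)))
    (wellFounded_gt (α := Ideal (MvPolynomial (Fin (m + 1)) k)))).mono fun X Y h => ?_⟩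
  refine lt_of_le_not_ge (homIdeal_anti (SetLike.coe_subset_coe.mpr h.le)) fun h1 => ?_
  exact h.not_ge (subset_of_homIdeal_le X.isClosed h1)

variable [Infinite k]

theorem isClosed_setOf_mem_homIdeal (f : MvPolynomial (Fin (m + 1)) k) :
    IsClosed {p : PSpace k m | f ∈ homIdeal {p}} := by
  refine isClosed_iff.mpr ⟨Set.range fun d => homogeneousComponent d f, ?_, ?_⟩
  · rintro _ ⟨d, rfl⟩
    exact ⟨d, homogeneousComponent_isHomogeneous d f⟩
  · ext p
    simp only [zeros, Set.mem_ofPred_eq, Set.forall_mem_range,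
      eval_rep_eq_zero_iff (homogeneousComponent_isHomogeneous _ f)]
    refine ⟨fun h d => homIdeal_hasComponents _ _ h d, fun h => ?_⟩
    rw [← sum_homogeneousComponent f]
    exact Ideal.sum_mem _ fun d _ => h d

theorem homIdeal_isPrime {Y : Set (PSpace k m)} (hY : IsIrreducible Y) : (homIdeal Y).IsPrime := by
  refine ⟨fun h => ?_, fun {f g} hfg => ?_⟩
  · obtain ⟨p, hp⟩ := hY.nonempty
    have h1 := homIdeal_le_of_mem hp ((Ideal.eq_top_iff_one _).mp h)
    exact Ideal.IsPrime.one_notMem inferInstance h1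
  · have h := isPreirreducible_iff_isClosed_union_isClosed.mp hY.isPreirreducible _ _
      (isClosed_setOf_mem_homIdeal f) (isClosed_setOf_mem_homIdeal g) fun p hp =>
        Ideal.IsPrime.mem_or_mem inferInstance (homIdeal_le_of_mem hp hfg)
    exact h.imp (fun h => mem_homIdeal_iff.mpr fun p hp => h hp)
      (fun h => mem_homIdeal_iff.mpr fun p hp => h hp)

/-- The ideals of the closed sets are primes in a strict chain, and each inclusion contributes one
independent element. One more step comes from the ideal of the origin: the cone has one dimension
more than the projective set. -/
theorem hasIndep_of_ltSeries (s : LTSeries (IrreducibleCloseds (PSpace k m))) :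
    HasIndep k (MvPolynomial (Fin (m + 1)) k ⧸ homIdeal (s.last : Set (PSpace k m)))
      (s.length + 1) := by
  induction s using RelSeries.inductionOn' with
  | singleton Y =>
    have := homIdeal_isPrime Y.isIrreducible
    have hlt : homIdeal (Y : Set (PSpace k m)) < vanishingIdeal k {(0 : Fin (m + 1) → k)} := by
      obtain ⟨p, hp⟩ := Y.isIrreducible.nonempty
      refine lt_of_le_not_ge (vanishingIdeal_anti_mono ?_) fun h => p.rep_nonzero ?_
      · rintro _ rfl
        exact ⟨p, hp, Submodule.zero_mem _⟩
      · funext i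
        have h1 : X i ∈ vanishingIdeal k {(0 : Fin (m + 1) → k)} := by
          rw [mem_vanishingIdeal]; simp
        simpa using mem_vanishingIdeal.mp (h h1) _ ⟨p, hp, rep_mem_submodule p⟩
    refine HasIndep.succ_of_lt (d := 0) hlt ⟨Fin.elim0, ?_⟩
    rw [algebraicIndependent_empty_type_iff]
    exact FaithfulSMul.algebraMap_injective _ _
  | snoc s Y h ih =>
    have := homIdeal_isPrime Y.isIrreducible
    have := homIdeal_isPrime s.last.isIrreducible
    rw [RelSeries.last_snoc]
    exact HasIndep.succ_of_lt (homIdeal_lt_of_lt h) ih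

/-- All chains of irreducible closed subsets of `X` have length less than `d`. -/
def ChainsLT (X : Set (PSpace k m)) (d : ℕ) : Prop :=
  ∀ s : LTSeries (IrreducibleCloseds (PSpace k m)), (s.last : Set (PSpace k m)) ⊆ X → s.length < d

-- The closure of a point is a chain of length `0`. So the bound in `ChainsLT` stands for the
-- dimension plus one, and the bound `0` for dimension `-1`.
omit [Infinite k] in
theorem ChainsLT.eq_empty {X : Set (PSpace k m)} (hX : IsClosed X) (h : ChainsLT X 0) : X = ∅ := by
  by_contra hne
  obtain ⟨p, hp⟩ := Set.nonempty_iff_ne_empty.mpr hne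
  have := h (RelSeries.singleton _ ⟨closure {p}, isIrreducible_singleton.closure, isClosed_closure⟩)
    (closure_minimal (Set.singleton_subset_iff.mpr hp) hX)
  simp at this

/-- The points of `X` on the hyperplane with the given equation. -/
def hyperplaneSection (X : Set (PSpace k m)) (a : Fin (m + 1) → k) : Set (PSpace k m) :=
  {p ∈ X | a ⬝ᵥ p.rep = 0}

theorem isClosed_hyperplaneSection {X : Set (PSpace k m)} (hX : IsClosed X)
    (a : Fin (m + 1) → k) : IsClosed (hyperplaneSection X a) := by
  have h : hyperplaneSection X a = X ∩ {p | linForm a ∈ homIdeal {p}} := by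
    ext p
    simp only [hyperplaneSection, Set.mem_ofPred_eq, Set.mem_inter_iff,
      ← eval_rep_eq_zero_iff (linForm_isHomogeneous a), eval_linForm]
  rw [h]
  exact hX.inter (isClosed_setOf_mem_homIdeal _)

-- `F` contains one point of each of finitely many irreducible closed sets covering `X`. A
-- hyperplane that misses these points contains none of the sets, so every chain in the section can
-- be prolonged by one of them.
omit [Infinite k] in
theorem ChainsLT.exists_hyperplaneSection {X : Set (PSpace k m)} (hX : IsClosed X) {d : ℕ}
    (h : ChainsLT X (d + 1)) : ∃ F : Finset (Fin (m + 1) → k), (∀ v ∈ F, v ≠ 0) ∧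
      ∀ a, (∀ v ∈ F, a ⬝ᵥ v ≠ 0) → ChainsLT (hyperplaneSection X a) d := by
  classical
  obtain ⟨S, hSfin, hScl, hSirr, hXS⟩ := NoetherianSpace.exists_finite_set_isClosed_irreducible hX
  have hne : ∀ t ∈ S, ∃ p : PSpace k m, p ∈ t := fun t ht => (hSirr t ht).nonempty
  choose! q hq using hne
  refine ⟨hSfin.toFinset.image fun t => (q t).rep, ?_, ?_⟩
  · intro v hv
    obtain ⟨t, -, rfl⟩ := Finset.mem_image.mp hv
    exact (q t).rep_nonzero
  intro a ha s hs
  have h1 : (s.last : Set (PSpace k m)) ⊆ ⋃₀ S := fun p hp => hXS ▸ (hs hp).1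
  obtain ⟨t, ht, hst⟩ := isIrreducible_iff_sUnion_isClosed.mp s.last.isIrreducible hSfin.toFinset
    (fun t ht => hScl t (hSfin.mem_toFinset.mp ht)) (by rwa [hSfin.coe_toFinset])
  rw [hSfin.mem_toFinset] at ht
  let T : IrreducibleCloseds (PSpace k m) := ⟨t, hSirr t ht, hScl t ht⟩
  have hlt : s.last < T := by
    refine lt_of_le_not_ge (SetLike.coe_subset_coe.mp hst) fun hle => ?_
    have h2 : q t ∈ hyperplaneSection X a := hs (hle (hq t ht))
    exact ha _ (Finset.mem_image.mpr ⟨t, hSfin.mem_toFinset.mpr ht, rfl⟩) h2.2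
  have := h (s.snoc T hlt) (by
    rw [RelSeries.last_snoc, hXS]
    exact Set.subset_sUnion_of_mem ht)
  rw [RelSeries.snoc_length] at this
  omega

/-- A product of nonzero linear forms is a nonzero polynomial, hence not identically zero as a
function over an infinite field. -/
theorem exists_dotProduct_ne_zero {ι : Type*} [Fintype ι] (F : Finset (ι → k))
    (hF : ∀ v ∈ F, v ≠ 0) : ∃ a : ι → k, ∀ v ∈ F, a ⬝ᵥ v ≠ 0 := by
  by_contra! h
  have h1 : ∏ v ∈ F, linForm v = 0 := by
    refine MvPolynomial.funext fun a => ?_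
    obtain ⟨v, hv, hav⟩ := h a
    rw [map_prod, map_zero]
    refine Finset.prod_eq_zero hv ?_
    rw [eval_linForm, dotProduct_comm, hav]
  obtain ⟨v, hv, hv0⟩ := Finset.prod_eq_zero_iff.mp h1
  refine hF v hv (funext fun i => ?_)
  classical
  have := congrArg (eval (Pi.single i 1)) hv0
  simpa using this

/-- The coordinate ring of the top of the chain is finite over `r` linear forms, so it has at most
`r` independent elements, while the chain provides its length plus one. -/
theorem length_lt_of_mulVec_eq_zero [IsAlgClosed k] {X : Set (PSpace k m)} (hX : IsClosed X)
    {r : ℕ} (L : Matrix (Fin r) (Fin (m + 1)) k)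
    (hL : ∀ x ∈ affineCone X, L.mulVec x = 0 → x = 0) : ChainsLT X r := by
  intro s hs
  have hP := homIdeal_isPrime s.last.isIrreducible
  have hL' : ∀ x ∈ zeroLocus k (homIdeal (s.last : Set (PSpace k m))), L.mulVec x = 0 → x = 0 := by
    intro x hx hx0
    by_contra hne
    refine hne (hL x (mem_affineCone_of_mem_zeroLocus hX hne ?_) hx0)
    exact zeroLocus_anti_mono (homIdeal_anti hs) hx
  have hfin := finite_linMap (homIdeal_hasComponents _) L hL'
  have halg := isAlgebraic_adjoin_of_finite (((Ideal.Quotient.mkₐ k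
    (homIdeal (s.last : Set (PSpace k m)))).comp (linMap L))) hfin
  have := HasIndep.le_of_isAlgebraic (fun j => ((Ideal.Quotient.mkₐ k
    (homIdeal (s.last : Set (PSpace k m)))).comp (linMap L)) (MvPolynomial.X j)) (hasIndep_of_ltSeries s)
  rw [Fintype.card_fin] at this
  omega

end Topology
end ProjGeom

namespace ProjGeom

open MvPolynomial TopologicalSpace Topology

/-! ### Dimension of subspaces and of pure-dimensional sets -/

section Dimension

theorem isIrreducible_preimage {E X : Type*} [TopologicalSpace E] [TopologicalSpace X] {f : E → X}
    (hf : IsInducing f) {W : Set X} (hW : IsIrreducible W) (hWf : W ⊆ Set.range f) :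
    IsIrreducible (f ⁻¹' W) := by
  refine ⟨?_, fun u v hu hv ⟨a, haW, hau⟩ ⟨b, hbW, hbv⟩ => ?_⟩
  · obtain ⟨x, hx⟩ := hW.nonempty
    obtain ⟨e, rfl⟩ := hWf hx
    exact ⟨e, hx⟩
  · obtain ⟨u', hu', rfl⟩ := hf.isOpen_iff.mp hu
    obtain ⟨v', hv', rfl⟩ := hf.isOpen_iff.mp hv
    obtain ⟨x, hx, hxu, hxv⟩ :=
      hW.isPreirreducible u' v' hu' hv' ⟨f a, haW, hau⟩ ⟨f b, hbW, hbv⟩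
    obtain ⟨e, rfl⟩ := hWf hx
    exact ⟨e, hx, hxu, hxv⟩

theorem exists_ltSeries_length_eq {E X : Type*} [TopologicalSpace E] [TopologicalSpace X]
    {f : E → X} (hf : IsInducing f) (s : LTSeries (IrreducibleCloseds X))
    (hs : (s.last : Set X) ⊆ Set.range f) :
    ∃ s' : LTSeries (IrreducibleCloseds E), s'.length = s.length := by
  have hsub : ∀ i, (s i : Set X) ⊆ Set.range f := fun i =>
    (SetLike.coe_subset_coe.mpr (s.monotone (Fin.le_last i))).trans hs
  refine ⟨LTSeries.mk s.length (fun i => ⟨f ⁻¹' (s i), isIrreducible_preimage hf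
    (s i).isIrreducible (hsub i), (s i).isClosed.preimage hf.continuous⟩) fun i j hij => ?_, rfl⟩
  have hlt := s.strictMono hij
  refine lt_of_le_not_ge (fun x hx => hlt.le hx) fun hle => hlt.not_ge fun x hx => ?_
  obtain ⟨e, rfl⟩ := hsub j hx
  exact hle hx

variable {k : Type*} [Field k] {m : ℕ}

theorem IsPureDimVariety.chainsLT {Z : Set (PSpace k m)} {d : ℕ} (hZ : IsPureDimVariety Z d) :
    ChainsLT Z (d + 1) := by
  intro s hs
  obtain ⟨Y, hY, hsY⟩ := exists_mem_irreducibleComponents_subset_of_isIrreducible _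
    (isIrreducible_preimage (f := ((↑) : Z → PSpace k m)) IsInducing.subtypeVal
      s.last.isIrreducible (by rwa [Subtype.range_coe]))
  obtain ⟨s', hs'⟩ := exists_ltSeries_length_eq (f := fun y : Y => (y.1.1 : PSpace k m))
    (IsInducing.subtypeVal.comp IsInducing.subtypeVal) s
    (fun x hx => ⟨⟨⟨x, hs hx⟩, hsY hx⟩, rfl⟩)
  have h := hZ.2 Y hY
  have h1 := Order.LTSeries.length_le_krullDim s'
  unfold topologicalKrullDim at h
  rw [h, hs'] at h1
  have h2 : s.length ≤ d := by exact_mod_cast h1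
  omega

theorem HasIndep.of_le {S : Type*} [CommRing S] [Algebra k S] {P Q : Ideal S} (h : P ≤ Q) {d : ℕ}
    (hQ : HasIndep k (S ⧸ Q) d) : HasIndep k (S ⧸ P) d := by
  obtain ⟨x, hx⟩ := hQ
  choose y hy using fun i => Ideal.Quotient.mk_surjective (x i)
  have hy' : (Ideal.Quotient.factorₐ k h) ∘ (fun i => Ideal.Quotient.mk P (y i)) = x := funext hy
  exact ⟨_, AlgebraicIndependent.of_comp (Ideal.Quotient.factorₐ k h) (by rwa [hy'])⟩

/-- Purity enters here: through every point passes a component of full dimension, and its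
topological dimension is turned into independent elements of its coordinate ring. -/
theorem IsPureDimVariety.exists_hasIndep [Infinite k] {Z : Set (PSpace k m)} {d : ℕ}
    (hZ : IsPureDimVariety Z d) {p : PSpace k m} (hp : p ∈ Z) : ∃ Y ⊆ Z, IsClosed Y ∧ p ∈ Y ∧
      IsIrreducible Y ∧ HasIndep k (MvPolynomial (Fin (m + 1)) k ⧸ homIdeal Y) (d + 1) := by
  let Y := irreducibleComponent (⟨p, hp⟩ : Z)
  have hY : Y ∈ irreducibleComponents Z := irreducibleComponent_mem_irreducibleComponents _
  have hcl : IsClosed ((↑) '' Y : Set (PSpace k m)) :=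
    hZ.1.isClosedEmbedding_subtypeVal.isClosedMap _ isClosed_irreducibleComponent
  have hirr : IsIrreducible ((↑) '' Y : Set (PSpace k m)) :=
    isIrreducible_irreducibleComponent.image _ continuous_subtype_val.continuousOn
  refine ⟨(↑) '' Y, by rintro _ ⟨y, -, rfl⟩; exact y.2, hcl,
    ⟨_, mem_irreducibleComponent, rfl⟩, hirr, ?_⟩
  have h := hZ.2 Y hY
  obtain ⟨s, hs⟩ := Order.le_krullDim_iff.mp (h.ge : (d : WithBot ℕ∞) ≤ topologicalKrullDim Y)
  have hf : IsInducing fun y : Y => (y.1.1 : PSpace k m) :=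
    IsInducing.subtypeVal.comp IsInducing.subtypeVal
  let s' := s.map _ (IrreducibleCloseds.map_strictMono_of_isInducing hf)
  have h1 := hasIndep_of_ltSeries s'
  have h2 : s'.length = d := hs
  rw [h2] at h1
  refine h1.of_le (homIdeal_anti ?_)
  refine closure_minimal ?_ hcl
  rintro _ ⟨y, -, rfl⟩
  exact ⟨y.1, y.2, rfl⟩

theorem codimAtLeast_of_chainsLT {D D' : Set (PSpace k m)} (hD' : IsClosed D') (h : D ⊆ D')
    {r c : ℕ} (hr : ChainsLT D' r) (hc : r + c ≤ m + 1) : CodimAtLeast c D := by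
  refine ⟨fun hne => ?_, fun _ => by omega⟩
  -- The number `r` bounds the dimension plus one; `r = 0` would make `D'` empty.
  obtain ⟨r, rfl⟩ : ∃ r', r = r' + 1 := by
    refine Nat.exists_eq_succ_of_ne_zero ?_
    rintro rfl
    obtain ⟨p, hp⟩ := hne
    have := hr.eq_empty hD'
    exact (this ▸ h hp : p ∈ (∅ : Set (PSpace k m)))
  have h1 : topologicalKrullDim (closure D) ≤ r := by
    refine iSup_le fun s => ?_
    have hf : IsInducing ((↑) : closure D → PSpace k m) := IsInducing.subtypeVal
    have h2 := hr (s.map _ (IrreducibleCloseds.map_strictMono_of_isInducing hf)) (by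
      refine closure_minimal ?_ hD'
      rintro _ ⟨y, -, rfl⟩
      exact closure_minimal h hD' y.2)
    have h3 : s.length < r + 1 := h2
    exact_mod_cast Nat.lt_succ_iff.mp h3
  calc topologicalKrullDim (closure D) + c ≤ r + c := by gcongr
    _ ≤ m := by
      have : r + c ≤ m := by omega
      exact_mod_cast this

end Dimension

end ProjGeom

namespace ProjGeom

open MvPolynomial

/-! ### Algebraic sets and elimination theory -/

section Elimination

variable {k : Type*} [Field k] {σ τ ι : Type*}

/-- A subset of affine space is algebraic if it is the common zero set of some polynomials. -/
def IsAlgebraicSet (X : Set (σ → k)) : Prop :=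
  ∃ S : Set (MvPolynomial σ k), X = {x | ∀ f ∈ S, eval x f = 0}

theorem isAlgebraicSet_setOf_eval_eq_zero (f : MvPolynomial σ k) :
    IsAlgebraicSet {x | eval x f = 0} :=
  ⟨{f}, by simp⟩

theorem isAlgebraicSet_iInter {I : Sort*} {X : I → Set (σ → k)} (h : ∀ i, IsAlgebraicSet (X i)) :
    IsAlgebraicSet (⋂ i, X i) := by
  choose S hS using h
  refine ⟨⋃ i, S i, ?_⟩
  ext x
  simp only [hS, Set.mem_iInter, Set.mem_ofPred_eq, Set.mem_iUnion]
  exact ⟨fun h f ⟨i, hf⟩ => h i f hf, fun h i f hf => h f ⟨i, hf⟩⟩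

theorem IsAlgebraicSet.inter {X Y : Set (σ → k)} (hX : IsAlgebraicSet X) (hY : IsAlgebraicSet Y) :
    IsAlgebraicSet (X ∩ Y) := by
  rw [Set.inter_eq_iInter]
  exact isAlgebraicSet_iInter fun b => by cases b <;> assumption

theorem IsAlgebraicSet.preimage {X : Set (τ → k)} (hX : IsAlgebraicSet X)
    (φ : τ → MvPolynomial σ k) : IsAlgebraicSet {x : σ → k | (fun i => eval x (φ i)) ∈ X} := by
  obtain ⟨S, rfl⟩ := hX
  refine ⟨(bind₁ φ) '' S, ?_⟩
  ext x
  have h : ∀ f, eval x (bind₁ φ f) = eval (fun i => eval x (φ i)) f := fun f =>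
    eval₂Hom_bind₁ (RingHom.id k) x φ f
  simp [h]

theorem isAlgebraicSet_of_forall_notMem {X : Set (σ → k)}
    (h : ∀ x ∉ X, ∃ f : MvPolynomial σ k, eval x f ≠ 0 ∧ ∀ y ∈ X, eval y f = 0) :
    IsAlgebraicSet X := by
  refine ⟨{f | ∀ y ∈ X, eval y f = 0}, ?_⟩
  ext x
  refine ⟨fun hx f hf => hf x hx, fun hx => ?_⟩
  by_contra hx'
  obtain ⟨f, hf, hfX⟩ := h x hx'
  exact hf (hx f hfX)

theorem eval_map_eval_sumAlgEquiv (F : MvPolynomial (ι ⊕ σ) k) (v : ι → k) (a : σ → k) :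
    eval v (map (eval a) (sumAlgEquiv k ι σ F)) = eval (Sum.elim v a) F := by
  induction F using MvPolynomial.induction_on with
  | C c => simp
  | add p q hp hq => simp only [map_add, hp, hq]
  | mul_X p i hp =>
    rw [map_mul, map_mul, map_mul, map_mul, hp]
    cases i <;> simp

variable [IsAlgClosed k] [Fintype ι]

/-- The main theorem of elimination theory. -/
theorem IsAlgebraicSet.exists_ne_zero {X : Set (ι ⊕ σ → k)} (hX : IsAlgebraicSet X)
    (hs : ∀ v a (c : k), c ≠ 0 → Sum.elim v a ∈ X → Sum.elim (c • v) a ∈ X) :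
    IsAlgebraicSet {a : σ → k | ∃ v : ι → k, v ≠ 0 ∧ Sum.elim v a ∈ X} := by
  classical
  refine isAlgebraicSet_of_forall_notMem fun a ha => ?_
  obtain ⟨S, rfl⟩ := hX
  -- These are the polynomials vanishing on the given set, read as polynomials in `v` over the ring
  -- of functions of `a`. Specialized at the excluded `a`, they have no common zero other than
  -- possibly the origin.
  let T : Set (MvPolynomial ι (MvPolynomial σ k)) :=
    {F | ∀ v a, (∀ f ∈ S, eval (Sum.elim v a) f = 0) → eval v (map (eval a) F) = 0}
  let I : Ideal (MvPolynomial ι k) := Ideal.span (map (eval a) '' T)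
  have hI : ∀ x ∈ zeroLocus k I, x = 0 := by
    intro x hx
    by_contra hx0
    refine ha ⟨x, hx0, fun f hf => ?_⟩
    rw [← eval_map_eval_sumAlgEquiv]
    refine mem_zeroLocus.mp hx _ (Ideal.subset_span ⟨_, fun v b hvb => ?_, rfl⟩)
    rw [eval_map_eval_sumAlgEquiv]
    exact hvb f hf
  have hmemT : ∀ g ∈ I, ∃ F ∈ T, map (eval a) F = g := by
    let T' : Ideal (MvPolynomial ι (MvPolynomial σ k)) :=
      { carrier := T
        add_mem' := fun {F G} hF hG v b hvb => by
          rw [map_add, map_add, hF v b hvb, hG v b hvb, add_zero]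
        zero_mem' := fun v b _ => by simp
        smul_mem' := fun c F hF v b hvb => by
          rw [smul_eq_mul, map_mul, map_mul, hF v b hvb, mul_zero] }
    have hsurj : Function.Surjective (map (σ := ι) (eval (R := k) a)) :=
      map_surjective _ fun c => ⟨C c, eval_C c⟩
    intro g hg
    exact (Ideal.mem_map_iff_of_surjective (I := T') _ hsurj).mp hg
  obtain ⟨D, hD⟩ := exists_pow_idealOfVars_le hI
  let B : Finset (ι →₀ ℕ) := Finset.finsuppAntidiag Finset.univ D
  have hB : ∀ α : ι →₀ ℕ, α ∈ B ↔ α.degree = D := by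
    intro α
    simp [B, Finset.mem_finsuppAntidiag, Finsupp.degree_eq_sum]
  -- Every monomial of degree `D` is the specialization of a member of `T`. Invariance of the set
  -- under scaling of `v` allows passing to the component of degree `D`.
  have hF : ∀ α : B, ∃ F ∈ T, F.IsHomogeneous D ∧ map (eval a) F = monomial α.1 1 := by
    intro α
    have hhom : (monomial α.1 (1 : k)).IsHomogeneous D :=
      isHomogeneous_monomial _ ((hB _).mp α.2)
    obtain ⟨F, hFT, hFa⟩ := hmemT _ (hD (mem_pow_idealOfVars_of_isHomogeneous hhom le_rfl))
    have hcomp : ∀ (b : σ → k) (F : MvPolynomial ι (MvPolynomial σ k)),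
        map (eval b) (homogeneousComponent D F) = homogeneousComponent D (map (eval b) F) := by
      intro b F
      ext d
      rw [coeff_map, coeff_homogeneousComponent, coeff_homogeneousComponent, coeff_map]
      split_ifs <;> simp
    refine ⟨homogeneousComponent D F, fun v b hvb => ?_, homogeneousComponent_isHomogeneous _ _, ?_⟩
    · rw [hcomp]
      exact eval_homogeneousComponent_eq_zero (fun c hc => hFT _ _ (hs v b c hc hvb)) D
    · rw [hcomp, hFa, homogeneousComponent_of_mem hhom, if_pos rfl]
  choose F hFT hFh hFa using hF
  -- The coefficients of these lifts form a square matrix. It is the identity at the excluded point,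
  -- but over every `b` in the projection it kills the nonzero vector of the degree `D` monomials of
  -- `v`. So its determinant separates the excluded point from the projection.
  let M : Matrix B B (MvPolynomial σ k) := fun α β => coeff β.1 (F α)
  refine ⟨M.det, ?_, ?_⟩
  · rw [RingHom.map_det]
    have : (eval a).mapMatrix M = 1 := by
      ext α β
      have h := congrArg (coeff β.1) (hFa α)
      rw [coeff_map, coeff_monomial] at h
      rw [Matrix.one_apply, RingHom.mapMatrix_apply, Matrix.map_apply]
      simp only [Subtype.ext_iff]
      exact h
    rw [this, Matrix.det_one]
    exact one_ne_zero
  · rintro b ⟨v, hv0, hv⟩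
    rw [RingHom.map_det, ← Matrix.exists_mulVec_eq_zero_iff]
    refine ⟨fun β => ∏ i, v i ^ (β.1 i), fun h0 => ?_, ?_⟩
    · obtain ⟨i, hi⟩ := Function.ne_iff.mp hv0
      have h1 := congrFun h0 ⟨Finsupp.single i D, by rw [hB]; simp⟩
      change ∏ j, v j ^ (Finsupp.single i D j) = 0 at h1
      obtain ⟨j, -, hj⟩ := Finset.prod_eq_zero_iff.mp h1
      by_cases hij : i = j
      · subst hij
        exact hi (eq_zero_of_pow_eq_zero hj)
      · rw [Finsupp.single_eq_of_ne (Ne.symm hij), pow_zero] at hj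
        exact one_ne_zero hj
    · funext α
      have h1 := hFT α v b hv
      rw [eval_eq'] at h1
      rw [Pi.zero_apply, ← h1]
      change ∑ β : B, eval b (coeff β.1 (F α)) * ∏ i, v i ^ (β.1 i) = _
      rw [Finset.sum_coe_sort B fun β => eval b (coeff β (F α)) * ∏ i, v i ^ (β i)]
      symm
      simp only [← coeff_map]
      refine Finset.sum_subset (fun β hβ => ?_) fun β _ hβ => ?_
      · rw [hB]
        have := (hFh α).map (eval b) (mem_support_iff.mp hβ)
        rwa [Finsupp.degree_eq_weight_one]
      · rw [notMem_support_iff.mp hβ, zero_mul]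

theorem IsAlgebraicSet.exists_ne_zero_ne_zero {X : Set (ι ⊕ (ι ⊕ σ) → k)} (hX : IsAlgebraicSet X)
    (hs : ∀ v x a (c : k), c ≠ 0 → Sum.elim v (Sum.elim x a) ∈ X →
      Sum.elim (c • v) (Sum.elim x a) ∈ X)
    (hs' : ∀ v x a (c : k), c ≠ 0 → Sum.elim v (Sum.elim x a) ∈ X →
      Sum.elim v (Sum.elim (c • x) a) ∈ X) :
    IsAlgebraicSet {a : σ → k | ∃ x : ι → k, x ≠ 0 ∧ ∃ v : ι → k, v ≠ 0 ∧
      Sum.elim v (Sum.elim x a) ∈ X} := by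
  have h1 : IsAlgebraicSet {b : ι ⊕ σ → k | ∃ v : ι → k, v ≠ 0 ∧ Sum.elim v b ∈ X} := by
    refine hX.exists_ne_zero fun v b c hc hv => ?_
    rw [← Sum.elim_comp_inl_inr b] at hv ⊢
    exact hs v _ _ c hc hv
  refine h1.exists_ne_zero ?_
  rintro x a c hc ⟨v, hv0, hv⟩
  exact ⟨v, hv0, hs' v x a c hc hv⟩

end Elimination

end ProjGeom

namespace ProjGeom

open MvPolynomial

/-! ### Limit secants and their dimension -/

section Secants

theorem isIntegral_of_finite {k A B r : Type*} [Field k] [CommRing A] [CommRing B] [Algebra k A]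
    [Algebra k B] (φ : MvPolynomial r k →ₐ[k] A) (hφ : φ.toRingHom.Finite) (θ : A →ₐ[k] B)
    (S : Subalgebra k B) (h : ∀ j, θ (φ (X j)) ∈ S) (a : A) : IsIntegral S (θ a) := by
  obtain ⟨p, hp, hpx⟩ := hφ.to_isIntegral a
  have hmem : ∀ f, (θ.comp φ) f ∈ S := fun f => by
    induction f using MvPolynomial.induction_on with
    | C c => simp
    | add p q hp hq => rw [map_add]; exact S.add_mem hp hq
    | mul_X p i hp => rw [map_mul]; exact S.mul_mem hp (h i)
  let ψ : MvPolynomial r k →+* S := ((θ.comp φ).codRestrict _ hmem).toRingHom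
  refine ⟨p.map ψ, hp.map ψ, ?_⟩
  rw [Polynomial.eval₂_map]
  have h1 : (algebraMap S B).comp ψ = (θ : A →+* B).comp φ.toRingHom := rfl
  have h2 := Polynomial.hom_eval₂ p φ.toRingHom (θ : A →+* B) a
  rw [hpx, map_zero] at h2
  rw [h1]
  exact h2.symm

theorem HasIndep.of_surjective {k A B : Type*} [Field k] [CommRing A] [CommRing B] [Algebra k A]
    [Algebra k B] (f : A →ₐ[k] B) (hf : Function.Surjective f) {d : ℕ} (h : HasIndep k B d) :
    HasIndep k A d := by
  obtain ⟨x, hx⟩ := h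
  choose y hy using fun i => hf (x i)
  have : f ∘ y = x := funext hy
  exact ⟨y, AlgebraicIndependent.of_comp f (by rwa [this])⟩

variable {k : Type*} [Field k] {ι : Type*}

/-- The triples `(v, x, t)` with `t ≠ 0` such that `x` and `x + t v` both lie in `C`. -/
def secantFamily (C : Set (ι → k)) : Set (Option (ι ⊕ ι) → k) :=
  {z | z none ≠ 0 ∧ (fun i => z (some (.inr i))) ∈ C ∧
    (fun i => z (some (.inr i)) + z none * z (some (.inl i))) ∈ C}

/-- The pairs `(v, x)` in the limit, for `t → 0`, of the directions of the secants of `C` through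
`x` and `x + t v`. -/
def limitSecants (C : Set (ι → k)) : Set (ι ⊕ ι → k) :=
  {z | ∀ G ∈ vanishingIdeal k (secantFamily C), eval (fun o => o.elim 0 z) G = 0}

theorem isAlgebraicSet_limitSecants (C : Set (ι → k)) : IsAlgebraicSet (limitSecants C) := by
  have h : IsAlgebraicSet {z : Option (ι ⊕ ι) → k |
      ∀ f ∈ (vanishingIdeal k (secantFamily C) : Set (MvPolynomial (Option (ι ⊕ ι)) k)),
        eval z f = 0} := ⟨_, rfl⟩
  convert h.preimage (fun o => o.elim 0 (X : ι ⊕ ι → MvPolynomial (ι ⊕ ι) k)) using 1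
  ext z
  have : (fun o : Option (ι ⊕ ι) => eval z (o.elim 0 (X : ι ⊕ ι → MvPolynomial (ι ⊕ ι) k))) =
      fun o => o.elim 0 z := by
    funext o
    cases o <;> simp
  simp only [Set.mem_ofPred_eq, this]
  rfl

theorem base_mem_of_mem_limitSecants {C : Set (ι → k)} {v x : ι → k}
    (h : Sum.elim v x ∈ limitSecants C) : x ∈ zeroLocus k (vanishingIdeal k C) := by
  rw [mem_zeroLocus]
  intro f hf
  have h1 := h (rename (fun i => some (Sum.inr i)) f) (by
    rw [mem_vanishingIdeal]
    intro z hz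
    rw [eval_rename]
    exact mem_vanishingIdeal.mp hf _ hz.2.1)
  rw [eval_rename] at h1
  exact h1

/-- The substitution `(t, v, x) ↦ (b a⁻¹ t, a v, b x)` preserves the secant family, because `b x +
(b a⁻¹ t) (a v) = b (x + t v)`. -/
theorem smul_mem_limitSecants {C : Set (ι → k)} (hC : IsCone (k := k) C) {v x : ι → k} {a b : k}
    (ha : a ≠ 0) (hb : b ≠ 0) (h : Sum.elim v x ∈ limitSecants C) :
    Sum.elim (a • v) (b • x) ∈ limitSecants C := by
  intro G hG
  let φ : Option (ι ⊕ ι) → MvPolynomial (Option (ι ⊕ ι)) k := fun o =>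
    o.elim (MvPolynomial.C (b * a⁻¹) * X none)
      (Sum.elim (fun i => MvPolynomial.C a * X (some (.inl i)))
        (fun i => MvPolynomial.C b * X (some (.inr i))))
  have hφ : ∀ z f, eval z (bind₁ φ f) = eval (fun i => eval z (φ i)) f := fun z f =>
    eval₂Hom_bind₁ (RingHom.id k) z φ f
  have h1 := h (bind₁ φ G) (by
    rw [mem_vanishingIdeal]
    rintro z ⟨hz0, hz1, hz2⟩
    rw [hφ]
    refine mem_vanishingIdeal.mp hG _ ⟨?_, ?_, ?_⟩
    · simpa [φ] using ⟨⟨hb, ha⟩, hz0⟩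
    · have := hC b _ hz1
      convert this using 1
      funext i
      simp [φ]
    · have := hC b _ hz2
      convert this using 1
      funext i
      simp [φ]
      field_simp)
  rw [hφ] at h1
  convert h1 using 3
  funext o
  rcases o with _ | i | i <;> simp [φ]

variable [IsAlgClosed k] [Fintype ι]

theorem mem_of_forall_zeroLocus {σ : Type*} [Finite σ] {Q : Ideal (MvPolynomial σ k)} [Q.IsPrime]
    {f : MvPolynomial σ k} (h : ∀ z ∈ zeroLocus k Q, eval z f = 0) : f ∈ Q := by
  rw [← IsPrime.vanishingIdeal_zeroLocus (K := k) Q, mem_vanishingIdeal]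
  exact h

/-- On a component of the closure of the secant family, `x` and `x + t v` are integral over `2 r`
linear forms, and `v` becomes algebraic on dividing their difference by `t`. This gives dimension at
most `2 r + 1`, and the locus `t = 0` loses one. -/
theorem le_of_hasIndep_of_zeroLocus_subset_limitSecants {C : Set (ι → k)}
    (hC : IsCone (k := k) C) {r : ℕ} (L : Matrix (Fin r) ι k)
    (hL : ∀ x ∈ zeroLocus k (vanishingIdeal k C), L.mulVec x = 0 → x = 0)
    {Q : Ideal (MvPolynomial (ι ⊕ ι) k)} [hQ : Q.IsPrime] (hQC : zeroLocus k Q ⊆ limitSecants C)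
    {d : ℕ} (h : HasIndep k (MvPolynomial (ι ⊕ ι) k ⧸ Q) d) : d ≤ 2 * r := by
  let ρ : MvPolynomial (Option (ι ⊕ ι)) k →ₐ[k] MvPolynomial (ι ⊕ ι) k :=
    aeval fun o => o.elim 0 X
  have hρ : ∀ z G, eval z (ρ G) = eval (fun o => o.elim 0 z) G := by
    intro z G
    have h1 : ((aeval z).comp ρ : _ →ₐ[k] k) = aeval (fun o => o.elim 0 z) := by
      ext o
      rcases o with _ | o <;> simp [ρ]
    simpa using DFunLike.congr_fun h1 G
  let J := vanishingIdeal k (secantFamily C)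
  have hJ : J ≤ Q.comap ρ := by
    intro G hG
    refine mem_of_forall_zeroLocus (Q := Q) fun z hz => ?_
    rw [hρ]
    exact hQC hz G hG
  have h1 : HasIndep k (MvPolynomial (Option (ι ⊕ ι)) k ⧸ Q.comap ρ) d := by
    refine h.of_surjective (Ideal.quotientMapₐ Q ρ le_rfl)
      (Ideal.quotientMap_surjective (H := le_rfl) ?_)
    intro f
    refine ⟨rename some f, ?_⟩
    have h1 : ρ.comp (rename some) = AlgHom.id k _ := by ext; simp [ρ]
    exact DFunLike.congr_fun h1 f
  obtain ⟨P, hPmin, hPQ⟩ := Ideal.exists_minimalPrimes_le hJ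
  have hP : P.IsPrime := hPmin.1.1
  have hJP : J ≤ P := hPmin.1.2
  -- Since `t ≠ 0` on the secant family, `t` is not a zero divisor modulo `J`, so it lies in no
  -- minimal prime.
  have htP : (X none : MvPolynomial (Option (ι ⊕ ι)) k) ∉ P := by
    intro ht
    obtain ⟨y, hy, hty⟩ := Ideal.exists_mul_mem_of_mem_minimalPrimes hPmin ht
    refine hy ?_
    rw [mem_vanishingIdeal] at hty ⊢
    intro z hz
    have := hty z hz
    rw [map_mul, eval_X, mul_eq_zero] at this
    exact this.resolve_left hz.1
  have hlt : P < Q.comap ρ := by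
    refine lt_of_le_of_ne hPQ ?_
    rintro rfl
    refine htP ?_
    rw [Ideal.mem_comap]
    simp [ρ]
  have h2 := HasIndep.succ_of_lt hlt h1
  let B := MvPolynomial (Option (ι ⊕ ι)) k ⧸ P
  let t : B := Ideal.Quotient.mk P (X none)
  let x : ι → B := fun i => Ideal.Quotient.mk P (X (some (.inr i)))
  let v : ι → B := fun i => Ideal.Quotient.mk P (X (some (.inl i)))
  let φ : MvPolynomial (Fin r) k →ₐ[k] MvPolynomial ι k ⧸ vanishingIdeal k C :=
    (Ideal.Quotient.mkₐ k _).comp (linMap L)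
  have hφ : φ.toRingHom.Finite := finite_linMap (hasComponents_vanishingIdeal hC) L hL
  let θ₁ : (MvPolynomial ι k ⧸ vanishingIdeal k C) →ₐ[k] B :=
    Ideal.Quotient.liftₐ _ ((Ideal.Quotient.mkₐ k P).comp (rename fun i => some (.inr i))) (by
      intro f hf
      change Ideal.Quotient.mk P _ = 0
      rw [Ideal.Quotient.eq_zero_iff_mem]
      refine hJP ?_
      rw [mem_vanishingIdeal]
      intro z hz
      exact (eval_rename _ _ f).trans (mem_vanishingIdeal.mp hf _ hz.2.1))
  let θ₂ : (MvPolynomial ι k ⧸ vanishingIdeal k C) →ₐ[k] B :=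
    Ideal.Quotient.liftₐ _ ((Ideal.Quotient.mkₐ k P).comp
      (aeval fun i => X (some (.inr i)) + X none * X (some (.inl i)))) (by
      intro f hf
      change Ideal.Quotient.mk P _ = 0
      rw [Ideal.Quotient.eq_zero_iff_mem]
      refine hJP ?_
      rw [mem_vanishingIdeal]
      intro z hz
      have h3 : ((aeval z).comp (aeval fun i => X (some (.inr i)) + X none * X (some (.inl i))) :
          MvPolynomial ι k →ₐ[k] k) =
          aeval (fun i => z (some (.inr i)) + z none * z (some (.inl i))) := by
        ext i
        simp
      have h4 := DFunLike.congr_fun h3 f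
      rw [AlgHom.comp_apply, aeval_eq_eval, aeval_eq_eval] at h4
      exact h4.trans (mem_vanishingIdeal.mp hf _ hz.2.2))
  have hθ₁ : ∀ i, θ₁ (Ideal.Quotient.mk _ (X i)) = x i := fun i => by
    change Ideal.Quotient.mk P (rename _ (X i)) = _
    rw [rename_X]
  have hθ₂ : ∀ i, θ₂ (Ideal.Quotient.mk _ (X i)) = x i + t * v i := fun i => by
    change Ideal.Quotient.mk P (aeval _ (X i)) = _
    rw [aeval_X, map_add, map_mul]
  -- The `2 r + 1` algebraic generators: the forms on `x`, the forms on `x + t v`, and `t`.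
  let y : Fin r ⊕ Fin r ⊕ Unit → B :=
    Sum.elim (fun j => θ₁ (φ (X j))) (Sum.elim (fun j => θ₂ (φ (X j))) fun _ => t)
  let S := Algebra.adjoin k (Set.range y)
  have hS : ∀ j, y j ∈ S := fun j => Algebra.subset_adjoin ⟨j, rfl⟩
  have hx : ∀ i, IsAlgebraic S (x i) := fun i => by
    rw [← hθ₁]
    exact (isIntegral_of_finite φ hφ θ₁ S (fun j => hS (.inl j)) _).isAlgebraic
  have hw : ∀ i, IsAlgebraic S (x i + t * v i) := fun i => by
    rw [← hθ₂]
    exact (isIntegral_of_finite φ hφ θ₂ S (fun j => hS (.inr (.inl j))) _).isAlgebraic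
  have ht0 : t ≠ 0 := by
    rwa [Ne, Ideal.Quotient.eq_zero_iff_mem]
  let t' : S := ⟨t, hS (.inr (.inr ()))⟩
  have ht' : t' ≠ 0 := fun h => ht0 (congrArg Subtype.val h)
  have hv : ∀ i, IsAlgebraic S (v i) := fun i => by
    have h5 : IsAlgebraic S (t * v i) := by
      have := (hw i).sub (hx i)
      rwa [add_sub_cancel_left] at this
    refine IsAlgebraic.of_aeval (Polynomial.C t' * Polynomial.X) ?_ ?_ ?_
    · rw [Polynomial.natDegree_C_mul_X _ ht']
      exact one_ne_zero
    · rw [Polynomial.leadingCoeff_C_mul_X]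
      exact mem_nonZeroDivisors_of_ne_zero ht'
    · rw [map_mul, Polynomial.aeval_C, Polynomial.aeval_X]
      exact h5
  have halg : Algebra.IsAlgebraic S B := by
    constructor
    intro b
    obtain ⟨f, rfl⟩ := Ideal.Quotient.mk_surjective b
    induction f using MvPolynomial.induction_on with
    | C c => exact isAlgebraic_algebraMap (⟨_, S.algebraMap_mem c⟩ : S)
    | add p q hp hq => rw [map_add]; exact hp.add hq
    | mul_X p o hp =>
      rw [map_mul]
      refine hp.mul ?_
      rcases o with _ | i | i
      · exact isAlgebraic_algebraMap t'
      · exact hv i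
      · exact hx i
  have h3 := HasIndep.le_of_isAlgebraic y h2
  simp only [Fintype.card_sum, Fintype.card_fin, Fintype.card_unit] at h3
  omega

end Secants

end ProjGeom

namespace ProjGeom

open MvPolynomial

/-! ### Generic linear cuts of the set of limit secants -/

section GenericCuts

variable {k : Type*} [Field k]

theorem IsAlgebraicSet.zeroLocus_vanishingIdeal_subset {σ : Type*} {V : Set (σ → k)}
    (hV : IsAlgebraicSet V) : zeroLocus k (vanishingIdeal k V) ⊆ V := by
  obtain ⟨S, rfl⟩ := hV
  exact fun z hz f hf => mem_zeroLocus.mp hz f (mem_vanishingIdeal.mpr fun y hy => hy f hf)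

/-- Each new row only has to avoid finitely many hyperplanes, which may depend on the rows already
chosen. -/
theorem exists_generic_rows [Infinite k] {ι : Type*} [Fintype ι]
    {Φ : ∀ r, (Fin r → ι → k) → Prop} (h0 : Φ 0 Fin.elim0)
    (hstep : ∀ r L, Φ r L → ∃ F : Finset (ι → k), (∀ v ∈ F, v ≠ 0) ∧
      ∀ a, (∀ v ∈ F, a ⬝ᵥ v ≠ 0) → Φ (r + 1) (Fin.snoc L a)) (r : ℕ) : ∃ L, Φ r L := by
  induction r with
  | zero => exact ⟨_, h0⟩
  | succ r ih =>
    obtain ⟨L, hL⟩ := ih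
    obtain ⟨F, hF, h⟩ := hstep r L hL
    obtain ⟨a, ha⟩ := exists_dotProduct_ne_zero F hF
    exact ⟨_, h a ha⟩

variable {ι : Type*}

/-- The components of an algebraic subset of `k^ι × k^ι` that do not lie over the origin of one of
the factors have dimension at most `e`. -/
def BiDimLE (V : Set (ι ⊕ ι → k)) (e : ℕ) : Prop :=
  ∀ Q : Ideal (MvPolynomial (ι ⊕ ι) k), Q.IsPrime → zeroLocus k Q ⊆ V →
    (∃ v x : ι → k, v ≠ 0 ∧ x ≠ 0 ∧ Sum.elim v x ∈ zeroLocus k Q) →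
    ∀ d, HasIndep k (MvPolynomial (ι ⊕ ι) k ⧸ Q) d → d ≤ e

/-- `F` has a witness on each relevant component of `V`. An equation that is nonzero at all
witnesses contains none of them, so each relevant irreducible set in the cut is strictly contained
in one. For `e = 0` nothing relevant is left, and the truncated subtraction is harmless. -/
theorem BiDimLE.exists_cut [IsAlgClosed k] [Finite ι] {V : Set (ι ⊕ ι → k)}
    (hV : IsAlgebraicSet V) {e : ℕ} (h : BiDimLE V e) :
    ∃ F : Finset ((ι → k) × (ι → k)),
      (∀ z ∈ F, z.1 ≠ 0 ∧ z.2 ≠ 0 ∧ Sum.elim z.1 z.2 ∈ V) ∧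
      ∀ g : MvPolynomial (ι ⊕ ι) k, (∀ z ∈ F, eval (Sum.elim z.1 z.2) g ≠ 0) →
        BiDimLE (V ∩ {z | eval z g = 0}) (e - 1) := by
  classical
  let R := {P ∈ (vanishingIdeal k V).minimalPrimes |
    ∃ z : (ι → k) × (ι → k), z.1 ≠ 0 ∧ z.2 ≠ 0 ∧ Sum.elim z.1 z.2 ∈ zeroLocus k P}
  have hR : R.Finite := Set.Finite.subset
    (Ideal.finite_minimalPrimes_of_isNoetherianRing _ (vanishingIdeal k V)) fun _ h => h.1
  have hex : ∀ P ∈ R, ∃ z : (ι → k) × (ι → k),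
      z.1 ≠ 0 ∧ z.2 ≠ 0 ∧ Sum.elim z.1 z.2 ∈ zeroLocus k P := fun P hP => hP.2
  choose! z hz1 hz2 hzP using hex
  have hRV : ∀ P ∈ R, zeroLocus k P ⊆ V := fun P hP =>
    (zeroLocus_anti_mono hP.1.1.2).trans hV.zeroLocus_vanishingIdeal_subset
  refine ⟨hR.toFinset.image z, ?_, ?_⟩
  · intro w hw
    obtain ⟨P, hP, rfl⟩ := Finset.mem_image.mp hw
    rw [hR.mem_toFinset] at hP
    exact ⟨hz1 P hP, hz2 P hP, hRV P hP (hzP P hP)⟩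
  intro g hg Q hQ hQV ⟨v, x, hv, hx, hvx⟩ d hd
  have hVQ : vanishingIdeal k V ≤ Q := fun f hf =>
    mem_of_forall_zeroLocus fun z hz => mem_vanishingIdeal.mp hf _ (hQV hz).1
  obtain ⟨P, hPmin, hPQ⟩ := Ideal.exists_minimalPrimes_le hVQ
  have hP : P.IsPrime := hPmin.1.1
  have hPR : P ∈ R := ⟨hPmin, (v, x), hv, hx, zeroLocus_anti_mono hPQ hvx⟩
  have hlt : P < Q := by
    refine lt_of_le_of_ne hPQ ?_
    rintro rfl
    refine hg (z P) (Finset.mem_image.mpr ⟨P, hR.mem_toFinset.mpr hPR, rfl⟩) ?_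
    exact (hQV (hzP P hPR)).2
  have := h P hP (hRV P hPR) ⟨_, _, hz1 P hPR, hz2 P hPR, hzP P hPR⟩ _ (HasIndep.succ_of_lt hlt hd)
  omega

theorem hasIndep_quotient_ker {k A B : Type*} [Field k] [CommRing A] [CommRing B] [Algebra k A]
    [Algebra k B] (φ : A →ₐ[k] B) {d : ℕ} {x : Fin d → A} (h : AlgebraicIndependent k (φ ∘ x)) :
    HasIndep k (A ⧸ RingHom.ker φ) d :=
  ⟨fun i => Ideal.Quotient.mk _ (x i), AlgebraicIndependent.of_comp (Ideal.kerLiftAlg φ) h⟩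

theorem hasIndep_two_quotient_ker {k A : Type*} [Field k] [CommRing A] [Algebra k A]
    (φ : A →ₐ[k] MvPolynomial (Fin 2) k) {a b : A} (ha : φ a = X 0) (hb : φ b = X 1) :
    HasIndep k (A ⧸ RingHom.ker φ) 2 := by
  refine hasIndep_quotient_ker φ (x := ![a, b]) ?_
  have h : φ ∘ ![a, b] = X := funext_iff.mpr (Fin.forall_fin_two.mpr ⟨ha, hb⟩)
  rw [h]
  exact algebraicIndependent_X (Fin 2) k

/-- By separate scaling and closedness `V` contains the plane `k v × k x`, whose ideal is the kernel
of the restriction to two parameters; this plane has dimension two. -/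
theorem BiDimLE.notMem [IsAlgClosed k] [Finite ι] {V : Set (ι ⊕ ι → k)} (h : BiDimLE V 1)
    (hV : IsAlgebraicSet V) {v x : ι → k}
    (hs : ∀ a b : k, a ≠ 0 → b ≠ 0 → Sum.elim (a • v) (b • x) ∈ V) (hv : v ≠ 0) (hx : x ≠ 0) :
    False := by
  let φ : MvPolynomial (ι ⊕ ι) k →ₐ[k] MvPolynomial (Fin 2) k :=
    aeval (Sum.elim (fun i => C (v i) * X 0) fun i => C (x i) * X 1)
  have hφ : ∀ (c : Fin 2 → k) f, eval c (φ f) = eval (Sum.elim (c 0 • v) (c 1 • x)) f := by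
    intro c f
    have h1 : (aeval c).comp φ = aeval (Sum.elim (c 0 • v) (c 1 • x)) := by
      ext i
      rcases i with i | i <;> simp [φ, mul_comm]
    simpa using DFunLike.congr_fun h1 f
  let Q := RingHom.ker φ
  have hQ : Q.IsPrime := RingHom.ker_isPrime φ
  have hVQ : vanishingIdeal k V ≤ Q := by
    intro f hf
    -- Only the nonzero multiples are given in `V`; the extra factor takes care of the two axes.
    have h1 : φ f * (X 0 * X 1) = 0 := by
      refine MvPolynomial.funext fun c => ?_
      rw [map_mul, map_mul, eval_X, eval_X, map_zero, hφ]
      by_cases h0 : c 0 = 0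
      · simp [h0]
      by_cases h1 : c 1 = 0
      · simp [h1]
      rw [mem_vanishingIdeal.mp hf _ (hs _ _ h0 h1), zero_mul]
    exact (mul_eq_zero.mp h1).resolve_right (mul_ne_zero (X_ne_zero _) (X_ne_zero _))
  have hQz : Sum.elim v x ∈ zeroLocus k Q := by
    rw [mem_zeroLocus]
    intro f hf
    have h1 := hφ 1 f
    rw [(RingHom.mem_ker).mp hf, map_zero] at h1
    simpa using h1.symm
  obtain ⟨i, hi⟩ := Function.ne_iff.mp hv
  obtain ⟨j, hj⟩ := Function.ne_iff.mp hx
  have hφv : φ (C (v i)⁻¹ * X (.inl i)) = X 0 := by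
    rw [map_mul, algHom_C, algebraMap_eq, aeval_X, Sum.elim_inl, ← mul_assoc, ← C_mul,
      inv_mul_cancel₀ hi, C_1, one_mul]
  have hφx : φ (C (x j)⁻¹ * X (.inr j)) = X 1 := by
    rw [map_mul, algHom_C, algebraMap_eq, aeval_X, Sum.elim_inr, ← mul_assoc, ← C_mul,
      inv_mul_cancel₀ hj, C_1, one_mul]
  have := h Q hQ ((zeroLocus_anti_mono hVQ).trans hV.zeroLocus_vanishingIdeal_subset)
    ⟨v, x, hv, hx, hQz⟩ 2 (hasIndep_two_quotient_ker φ hφv hφx)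
  omega

variable {m : ℕ}

/-- The points of `X` on the hyperplanes with the given equations. -/
def linearSection (X : Set (PSpace k m)) {r : ℕ} (L : Fin r → Fin (m + 1) → k) :
    Set (PSpace k m) :=
  {p ∈ X | ∀ i, L i ⬝ᵥ p.rep = 0}

theorem linearSection_snoc (X : Set (PSpace k m)) {r : ℕ} (L : Fin r → Fin (m + 1) → k) (a) :
    linearSection X (Fin.snoc L a : Fin (r + 1) → Fin (m + 1) → k) =
      hyperplaneSection (linearSection X L) a := by
  ext p
  simp only [linearSection, hyperplaneSection, Set.mem_ofPred_eq, Fin.forall_fin_succ',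
    Fin.snoc_castSucc, Fin.snoc_last, and_assoc]

theorem isClosed_linearSection [Infinite k] {X : Set (PSpace k m)} (hX : IsClosed X) {r : ℕ}
    (L : Fin r → Fin (m + 1) → k) : IsClosed (linearSection X L) := by
  have : linearSection X L = X ∩ ⋂ i, hyperplaneSection Set.univ (L i) := by
    ext p
    simp [linearSection, hyperplaneSection]
  rw [this]
  exact hX.inter (isClosed_iInter fun i => isClosed_hyperplaneSection isClosed_univ _)

theorem mulVec_ne_zero_of_chainsLT [Infinite k] {X : Set (PSpace k m)} (hX : IsClosed X) {r : ℕ}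
    {L : Matrix (Fin r) (Fin (m + 1)) k} (h : ChainsLT (linearSection X L) 0) :
    ∀ x ∈ zeroLocus k (homIdeal X), L.mulVec x = 0 → x = 0 := by
  intro x hx hLx
  by_contra hx0
  have h1 := mk_mem_of_mem_affineCone hx0 (mem_affineCone_of_mem_zeroLocus hX hx0 hx)
  have h2 := h.eq_empty (isClosed_linearSection hX L)
  have h3 : Projectivization.mk k x hx0 ∈ linearSection X L := by
    refine ⟨h1, fun i => ?_⟩
    obtain ⟨c, hc⟩ := Projectivization.exists_smul_eq_mk_rep k x hx0
    rw [← hc]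
    have : L i ⬝ᵥ x = 0 := congrFun hLx i
    rw [Units.smul_def, dotProduct_smul, this, smul_zero]
  rw [h2] at h3
  exact h3

theorem ChainsLT.exists_cut {X : Set (PSpace k m)} (hX : IsClosed X) {d : ℕ}
    (h : ChainsLT X d) : ∃ F : Finset (Fin (m + 1) → k), (∀ v ∈ F, v ≠ 0) ∧
      ∀ a, (∀ v ∈ F, a ⬝ᵥ v ≠ 0) → ChainsLT (hyperplaneSection X a) (d - 1) := by
  cases d with
  | zero => exact ⟨∅, by simp, fun a _ s hs => absurd (h s fun p hp => (hs hp).1) (by omega)⟩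
  | succ d => exact h.exists_hyperplaneSection hX

/-- The pairs `(v, x)` in `W` such that `v` is killed by the forms `L`, and `M x` by the forms
`c`. -/
def cutPairs {r n e : ℕ} (W : Set (ι ⊕ ι → k)) [Fintype ι] (L : Fin r → ι → k)
    (M : Matrix (Fin n) ι k) (c : Fin e → Fin n → k) : Set (ι ⊕ ι → k) :=
  {z ∈ W | (∀ i, L i ⬝ᵥ (z ∘ .inl) = 0) ∧ ∀ j, c j ⬝ᵥ M.mulVec (z ∘ .inr) = 0}

theorem eval_dotProduct_X {σ τ : Type*} [Fintype τ] (a : τ → k) (f : τ → σ) (z : σ → k) :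
    eval z (rename f (linForm a)) = a ⬝ᵥ (z ∘ f) := by
  rw [eval_rename, eval_linForm]

theorem isAlgebraicSet_cutPairs {r n e : ℕ} {W : Set (ι ⊕ ι → k)} [Fintype ι]
    (hW : IsAlgebraicSet W) (L : Fin r → ι → k) (M : Matrix (Fin n) ι k)
    (c : Fin e → Fin n → k) : IsAlgebraicSet (cutPairs W L M c) := by
  have : cutPairs W L M c =
      W ∩ ((⋂ i, {z | eval z (rename Sum.inl (linForm (L i))) = 0}) ∩
        ⋂ j, {z | eval z (rename Sum.inr (linForm (Matrix.vecMul (c j) M))) = 0}) := by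
    ext z
    simp [cutPairs, eval_dotProduct_X, Matrix.dotProduct_mulVec]
    tauto
  rw [this]
  exact hW.inter ((isAlgebraicSet_iInter fun _ => isAlgebraicSet_setOf_eval_eq_zero _).inter
    (isAlgebraicSet_iInter fun _ => isAlgebraicSet_setOf_eval_eq_zero _))

theorem biDimLE_cutPairs_snoc_left [IsAlgClosed k] [Fintype ι] {r n e d : ℕ}
    {W : Set (ι ⊕ ι → k)} (hW : IsAlgebraicSet W) {L : Fin r → ι → k} {M : Matrix (Fin n) ι k}
    {c : Fin e → Fin n → k} (h : BiDimLE (cutPairs W L M c) d) :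
    ∃ F : Finset (ι → k), (∀ v ∈ F, v ≠ 0) ∧ ∀ a, (∀ v ∈ F, a ⬝ᵥ v ≠ 0) →
      BiDimLE (cutPairs W (Fin.snoc L a : Fin (r + 1) → ι → k) M c) (d - 1) := by
  classical
  obtain ⟨F, hF, h'⟩ := h.exists_cut (isAlgebraicSet_cutPairs hW L M c)
  refine ⟨F.image Prod.fst, ?_, fun a ha => ?_⟩
  · intro v hv
    obtain ⟨z, hz, rfl⟩ := Finset.mem_image.mp hv
    exact (hF z hz).1
  · have := h' (rename Sum.inl (linForm a)) fun z hz => by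
      rw [eval_dotProduct_X]
      exact ha _ (Finset.mem_image.mpr ⟨z, hz, rfl⟩)
    convert this using 1
    ext z
    simp only [cutPairs, Set.mem_ofPred_eq, Fin.forall_fin_succ', Fin.snoc_castSucc, Fin.snoc_last,
      Set.mem_inter_iff, eval_dotProduct_X]
    tauto

/-- The forms act on `M x`, so the witnesses must satisfy `M x ≠ 0` for a general form not to vanish
there; `hM` ensures this. -/
theorem biDimLE_cutPairs_snoc_right [IsAlgClosed k] [Fintype ι] {r n e d : ℕ}
    {W : Set (ι ⊕ ι → k)} (hW : IsAlgebraicSet W) {L : Fin r → ι → k} {M : Matrix (Fin n) ι k}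
    (hM : ∀ v x, Sum.elim v x ∈ W → M.mulVec x = 0 → x = 0)
    {c : Fin e → Fin n → k} (h : BiDimLE (cutPairs W L M c) d) :
    ∃ F : Finset (Fin n → k), (∀ v ∈ F, v ≠ 0) ∧ ∀ a, (∀ v ∈ F, a ⬝ᵥ v ≠ 0) →
      BiDimLE (cutPairs W L M (Fin.snoc c a : Fin (e + 1) → Fin n → k)) (d - 1) := by
  classical
  obtain ⟨F, hF, h'⟩ := h.exists_cut (isAlgebraicSet_cutPairs hW L M c)
  refine ⟨F.image fun z => M.mulVec z.2, ?_, fun a ha => ?_⟩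
  · intro v hv
    obtain ⟨z, hz, rfl⟩ := Finset.mem_image.mp hv
    exact fun h0 => (hF z hz).2.1 (hM _ _ (hF z hz).2.2.1 h0)
  · have := h' (rename Sum.inr (linForm (Matrix.vecMul a M))) fun z hz => by
      rw [eval_dotProduct_X, ← Matrix.dotProduct_mulVec]
      exact ha _ (Finset.mem_image.mpr ⟨z, hz, rfl⟩)
    convert this using 1
    ext z
    simp only [cutPairs, Set.mem_ofPred_eq, Fin.forall_fin_succ', Fin.snoc_castSucc, Fin.snoc_last,
      Set.mem_inter_iff, eval_dotProduct_X, Matrix.dotProduct_mulVec]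
    tauto

/-- A general linear projection identifies the two points of a limit secant of `Z`, and maps them
to a general linear space of codimension `n - 2`, only if the secant degenerates. -/
theorem exists_matrix_forall_limitSecants [IsAlgClosed k] {Z : Set (PSpace k m)}
    (hZ : IsClosed Z) {n : ℕ} (hn : 2 ≤ n) (hdim : ChainsLT Z n) :
    ∃ (A : Matrix (Fin (n + 1)) (Fin (m + 1)) k) (c : Fin (n - 2) → Fin (n + 1) → k),
      (∀ x ∈ zeroLocus k (homIdeal Z), (A.submatrix Fin.castSucc id).mulVec x = 0 → x = 0) ∧
      ∀ v x, v ≠ 0 → x ≠ 0 → Sum.elim v x ∈ limitSecants (affineCone Z) → A.mulVec v = 0 →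
        ¬ ∀ j, c j ⬝ᵥ A.mulVec x = 0 := by
  classical
  let W := limitSecants (affineCone Z)
  have hW : IsAlgebraicSet W := isAlgebraicSet_limitSecants _
  -- This first system without common zeros on `Z` serves only to bound the dimension of `W` by `2
  -- n`.
  obtain ⟨L, hL⟩ : ∃ L : Fin n → Fin (m + 1) → k, ChainsLT (linearSection Z L) (n - n) := by
    refine exists_generic_rows (Φ := fun r L => ChainsLT (linearSection Z L) (n - r)) ?_ ?_ n
    · exact fun s hs => hdim s fun p hp => (hs hp).1
    · intro r L h
      obtain ⟨F, hF, h'⟩ := h.exists_cut (isClosed_linearSection hZ L)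
      refine ⟨F, hF, fun a ha => ?_⟩
      rw [linearSection_snoc]
      exact h' a ha
  rw [Nat.sub_self] at hL
  have hWdim : BiDimLE W (2 * n) := fun Q hQ hQW _ d hd =>
    le_of_hasIndep_of_zeroLocus_subset_limitSecants (affineCone_isCone Z) (Matrix.of L)
      (mulVec_ne_zero_of_chainsLT hZ hL) hQW hd
  -- No conditions on `x` are imposed yet, so the matrix acting on `x` is empty.
  let M₀ : Matrix (Fin 0) (Fin (m + 1)) k := 0
  -- The first `n` rows of the matrix do two things at once: they have no common zero on `Z`, and
  -- they cut `W` down to dimension `n`.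
  obtain ⟨L, hL, hLW⟩ : ∃ L : Fin n → Fin (m + 1) → k, ChainsLT (linearSection Z L) (n - n) ∧
      BiDimLE (cutPairs W L M₀ (Fin.elim0 : Fin 0 → Fin 0 → k)) (2 * n - n) := by
    refine exists_generic_rows (Φ := fun r L => ChainsLT (linearSection Z L) (n - r) ∧
      BiDimLE (cutPairs W L M₀ (Fin.elim0 : Fin 0 → Fin 0 → k)) (2 * n - r)) ?_ ?_ n
    · refine ⟨fun s hs => hdim s fun p hp => (hs hp).1, fun Q hQ hQW h d hd => ?_⟩
      exact hWdim Q hQ (fun z hz => (hQW hz).1) h d hd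
    · rintro r L ⟨h1, h2⟩
      obtain ⟨F, hF, h1'⟩ := h1.exists_cut (isClosed_linearSection hZ L)
      obtain ⟨F', hF', h2'⟩ := biDimLE_cutPairs_snoc_left hW h2
      refine ⟨F ∪ F', fun v hv => (Finset.mem_union.mp hv).elim (hF v) (hF' v), fun a ha => ?_⟩
      rw [linearSection_snoc]
      exact ⟨h1' a fun v hv => ha v (Finset.mem_union_left _ hv),
        h2' a fun v hv => ha v (Finset.mem_union_right _ hv)⟩
  rw [Nat.sub_self] at hL
  -- The last row only has to cut `W` once more, down to dimension `n - 1`.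
  obtain ⟨F, hF, hcut⟩ := biDimLE_cutPairs_snoc_left hW hLW
  obtain ⟨a, ha⟩ := exists_dotProduct_ne_zero F hF
  let A : Matrix (Fin (n + 1)) (Fin (m + 1)) k :=
    Matrix.of (Fin.snoc L a : Fin (n + 1) → Fin (m + 1) → k)
  have hA : A.submatrix Fin.castSucc id = Matrix.of L := by
    ext i j
    simp [A]
  have hAL : ∀ x ∈ zeroLocus k (homIdeal Z),
      (A.submatrix Fin.castSucc id).mulVec x = 0 → x = 0 := by
    rw [hA]
    exact mulVec_ne_zero_of_chainsLT hZ hL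
  have hAW : ∀ v x, Sum.elim v x ∈ W → A.mulVec x = 0 → x = 0 := by
    intro v x hvx h0
    refine hAL x (base_mem_of_mem_limitSecants hvx) ?_
    funext i
    exact congrFun h0 i.castSucc
  -- Another `n - 2` conditions on `A x` lead to dimension `1`, less than the `2` that separate
  -- scaling of `v` and `x` forces.
  obtain ⟨c, hc⟩ : ∃ c : Fin (n - 2) → Fin (n + 1) → k,
      BiDimLE (cutPairs W A A c) (2 * n - n - 1 - (n - 2)) := by
    refine exists_generic_rows (Φ := fun r c => BiDimLE (cutPairs W A A c)
      (2 * n - n - 1 - r)) ?_ ?_ (n - 2)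
    · intro Q hQ hQW h d hd
      exact hcut a ha Q hQ (fun z hz => ⟨(hQW hz).1, (hQW hz).2.1, fun j => j.elim0⟩) h d hd
    · intro r c h
      exact biDimLE_cutPairs_snoc_right hW hAW h
  have h1 : 2 * n - n - 1 - (n - 2) = 1 := by omega
  rw [h1] at hc
  refine ⟨A, c, hAL, fun v x hv hx hvx hAv hAx => ?_⟩
  refine hc.notMem (isAlgebraicSet_cutPairs hW _ _ _) (v := v) (x := x) (fun s t hs ht => ?_) hv hx
  refine ⟨smul_mem_limitSecants (affineCone_isCone Z) hs ht hvx, fun i => ?_, fun j => ?_⟩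
  · rw [Sum.elim_comp_inl, dotProduct_smul]
    have : A i ⬝ᵥ v = 0 := congrFun hAv i
    rw [this, smul_zero]
  · rw [Sum.elim_comp_inr, Matrix.mulVec_smul, dotProduct_smul, hAx, smul_zero]

end GenericCuts

end ProjGeom

namespace ProjGeom

open MvPolynomial

/-! ### From limit secants to reductions of point ideals -/

section Reduction

variable {k : Type*} [Field k] {ι : Type*}

/-- Here `g (t, t⁻¹ v)` is a Laurent polynomial in `t` that vanishes for all `t ≠ 0`, and the sum is
its coefficient at `t ^ (-d)`. -/
theorem sum_homogeneousComponent_coeff_eq_zero [Infinite k] {g : Polynomial (MvPolynomial ι k)}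
    {v : ι → k} (h : ∀ t : k, t ≠ 0 → (g.map (eval (t⁻¹ • v))).eval t = 0) (d : ℕ) :
    ∑ j ∈ Finset.range (g.natDegree + 1), eval v (homogeneousComponent (j + d) (g.coeff j)) = 0 := by
  classical
  let N := g.natDegree
  -- The power `t ^ M` clears all denominators; the summands `N + d` make sure that the degrees `j +
  -- d` occur in the range of summation.
  let M := N + d + ∑ j ∈ Finset.range (N + 1), (g.coeff j).totalDegree
  have hM : ∀ j ∈ Finset.range (N + 1), (g.coeff j).totalDegree ≤ M := fun j hj =>
    (Finset.single_le_sum (f := fun j => (g.coeff j).totalDegree) (fun _ _ => Nat.zero_le _)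
      hj).trans (Nat.le_add_left _ _)
  let P : Polynomial k := ∑ j ∈ Finset.range (N + 1), ∑ e ∈ Finset.range (M + 1),
    Polynomial.monomial (j + (M - e)) (eval v (homogeneousComponent e (g.coeff j)))
  have hev : ∀ t : k, t ≠ 0 → P.eval t = 0 := by
    intro t ht
    have h1 : P.eval t = t ^ M * (g.map (eval (t⁻¹ • v))).eval t := by
      rw [Polynomial.eval_map, Polynomial.eval₂_eq_sum_range, Finset.mul_sum,
        Polynomial.eval_finsetSum]
      refine Finset.sum_congr rfl fun j hj => ?_
      rw [eval_smul_eq_sum, Polynomial.eval_finsetSum]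
      have h2 : ∑ e ∈ Finset.range ((g.coeff j).totalDegree + 1),
          t⁻¹ ^ e * eval v (homogeneousComponent e (g.coeff j)) =
          ∑ e ∈ Finset.range (M + 1), t⁻¹ ^ e * eval v (homogeneousComponent e (g.coeff j)) := by
        refine Finset.sum_subset (Finset.range_mono (Nat.succ_le_succ (hM j hj))) fun e _ he => ?_
        rw [homogeneousComponent_eq_zero _ _ (by simpa using he), map_zero, mul_zero]
      rw [h2, Finset.sum_mul, Finset.mul_sum]
      refine Finset.sum_congr rfl fun e he => ?_
      have he' : e ≤ M := Nat.lt_succ_iff.mp (Finset.mem_range.mp he)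
      rw [Polynomial.eval_monomial]
      have h3 : t ^ M = t ^ (M - e) * t ^ e := by rw [← pow_add, Nat.sub_add_cancel he']
      rw [h3, pow_add, inv_pow]
      field_simp
    rw [h1, h t ht, mul_zero]
  have hP : P = 0 := by
    have h1 : P * Polynomial.X = 0 := by
      refine Polynomial.funext fun t => ?_
      rw [Polynomial.eval_mul, Polynomial.eval_X, Polynomial.eval_zero]
      by_cases ht : t = 0
      · rw [ht, mul_zero]
      · rw [hev t ht, zero_mul]
    exact (mul_eq_zero.mp h1).resolve_right Polynomial.X_ne_zero
  have h1 : P.coeff (M - d) = 0 := by rw [hP, Polynomial.coeff_zero]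
  rw [← h1, Polynomial.finsetSum_coeff]
  refine Finset.sum_congr rfl fun j hj => ?_
  have hj' := Finset.mem_range.mp hj
  have hN : g.natDegree = N := rfl
  rw [Polynomial.finsetSum_coeff, Finset.sum_eq_single (j + d)]
  · rw [Polynomial.coeff_monomial, if_pos (by omega)]
  · intro e he hne
    have := Finset.mem_range.mp he
    rw [Polynomial.coeff_monomial, if_neg (by omega)]
  · intro hnot
    exact absurd (Finset.mem_range.mpr (by omega)) hnot

theorem mem_idealOfVars_of_eval_zero {f : MvPolynomial ι k} (h : eval 0 f = 0) :
    f ∈ idealOfVars ι k := by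
  rw [← pow_one (idealOfVars ι k), mem_pow_idealOfVars_iff]
  intro m hm
  refine Nat.one_le_iff_ne_zero.mpr fun h0 => ?_
  rw [Finsupp.degree_eq_zero_iff] at h0
  subst h0
  refine mem_support_iff.mp hm ?_
  rw [← constantCoeff_eq, ← h, eval_zero]

theorem map_translate_idealOfVars {V : Set (ι → k)} {p : ι → k} (hp : p ∈ V) :
    (idealOfVars ι k).map ((Ideal.Quotient.mkₐ k (vanishingIdeal k V)).comp (translate (-p))) =
      pointIdeal V p := by
  apply le_antisymm
  · rw [Ideal.map_le_iff_le_comap, idealOfVars, Ideal.span_le]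
    rintro _ ⟨i, rfl⟩
    change Ideal.Quotient.mk (vanishingIdeal k V) (translate (-p) (X i)) ∈ pointIdeal V p
    rw [mk_mem_pointIdeal hp]
    simp
  · intro b hb
    obtain ⟨f, rfl⟩ := Ideal.Quotient.mk_surjective b
    rw [mk_mem_pointIdeal hp] at hb
    have h1 : translate p f ∈ idealOfVars ι k :=
      mem_idealOfVars_of_eval_zero (by rw [eval_translate, zero_add, hb])
    have h2 := Ideal.mem_map_of_mem
      ((Ideal.Quotient.mkₐ k (vanishingIdeal k V)).comp (translate (-p))) h1
    rw [AlgHom.comp_apply, translate_translate (neg_add_cancel p)] at h2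
    exact h2

/-- The equations of the limit secants at `p` and the rows of `A` have only the trivial common zero,
so they generate all forms of high degree in `v`. Modulo forms of higher degree the former vanish on
`V`, with the origin moved to `p`, while the latter give elements of `𝔮`. -/
theorem exists_pow_pointIdeal_le [IsAlgClosed k] [Fintype ι] {C V : Set (ι → k)} (hVC : V ⊆ C)
    {p : ι → k} (hp : p ∈ V) {r : Type*} [Fintype r] (A : Matrix r ι k)
    (hA : ∀ v, Sum.elim v p ∈ limitSecants C → A.mulVec v = 0 → v = 0)
    (𝔮 : Ideal (CoordRing V))
    (h𝔮 : ∀ j, Ideal.Quotient.mk (vanishingIdeal k V)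
      (linForm (A j) - MvPolynomial.C (A j ⬝ᵥ p)) ∈ 𝔮) :
    ∃ D, pointIdeal V p ^ (D + 1) ≤ 𝔮 * pointIdeal V p ^ D ⊔ pointIdeal V p ^ (D + 2) := by
  classical
  let τ : MvPolynomial ι k →ₐ[k] CoordRing V :=
    (Ideal.Quotient.mkₐ k (vanishingIdeal k V)).comp (translate (-p))
  have hτ : (idealOfVars ι k).map τ = pointIdeal V p := map_translate_idealOfVars hp
  have hτpow : ∀ D, ∀ f ∈ idealOfVars ι k ^ D, τ f ∈ pointIdeal V p ^ D := by
    intro D f hf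
    rw [← hτ, ← Ideal.map_pow]
    exact Ideal.mem_map_of_mem τ hf
  let θ : MvPolynomial (Option (ι ⊕ ι)) k →ₐ[k] Polynomial (MvPolynomial ι k) :=
    aeval fun o => o.elim Polynomial.X (Sum.elim (fun i => Polynomial.C (X i))
      fun i => Polynomial.C (MvPolynomial.C (p i)))
  have hθ : ∀ (v : ι → k) (t : k) G, ((θ G).map (eval v)).eval t =
      eval (fun o => o.elim t (Sum.elim v p)) G := by
    intro v t G
    let e : Polynomial (MvPolynomial ι k) →+* k :=
      (Polynomial.evalRingHom t).comp (Polynomial.mapRingHom (eval v))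
    have h1 : e.comp θ.toRingHom = eval (fun o => o.elim t (Sum.elim v p)) := by
      refine MvPolynomial.ringHom_ext (fun c => ?_) fun o => ?_
      · simp [e, Polynomial.algebraMap_apply]
      · rcases o with _ | i | i <;> simp [e, θ]
    exact RingHom.congr_fun h1 G
  let θ₀ : MvPolynomial (Option (ι ⊕ ι)) k →+* MvPolynomial ι k :=
    (Polynomial.evalRingHom 0).comp θ.toRingHom
  have hθ₀ : ∀ G, θ₀ G = (θ G).coeff 0 := fun G => (Polynomial.coeff_zero_eq_eval_zero _).symm
  have hθ₀v : ∀ v G, eval v (θ₀ G) = eval (fun o => o.elim 0 (Sum.elim v p)) G := by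
    intro v G
    rw [← hθ, hθ₀, ← Polynomial.coeff_zero_eq_eval_zero, Polynomial.coeff_map]
  have hθ₀s : Function.Surjective θ₀ := by
    intro f
    refine ⟨rename (fun i => some (.inl i)) f, ?_⟩
    have h1 : θ₀.comp (rename fun i => some (Sum.inl i)).toRingHom = RingHom.id _ := by
      refine MvPolynomial.ringHom_ext (fun c => ?_) fun o => ?_
      · simp [θ₀, Polynomial.algebraMap_apply]
      · simp [θ₀, θ]
    exact RingHom.congr_fun h1 f
  -- Its zeros are the directions of limit secants at `p` in the kernel of `A`.
  let J : Ideal (MvPolynomial ι k) := (vanishingIdeal k (secantFamily C)).map θ₀ ⊔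
    Ideal.span (Set.range fun j => linForm (A j))
  obtain ⟨D, hD⟩ := exists_pow_idealOfVars_le (I := J) fun v hv => by
    refine hA v (fun G hG => ?_) (funext fun j => ?_)
    · rw [← hθ₀v]
      exact mem_zeroLocus.mp hv _ (Ideal.mem_sup_left (Ideal.mem_map_of_mem _ hG))
    · have := mem_zeroLocus.mp hv _ (Ideal.mem_sup_right (Ideal.subset_span ⟨j, rfl⟩))
      rwa [eval_linForm] at this
  have key : ∀ y : MvPolynomial ι k, y.IsHomogeneous (D + 1) →
      τ y ∈ 𝔮 * pointIdeal V p ^ D ⊔ pointIdeal V p ^ (D + 2) := by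
    intro y hy
    have hyJ : y ∈ J := hD (mem_pow_idealOfVars_of_isHomogeneous hy (Nat.le_succ D))
    obtain ⟨g₀, hg₀, l, hl, hgl⟩ := Submodule.mem_sup.mp hyJ
    obtain ⟨G, hG, rfl⟩ := (Ideal.mem_map_iff_of_surjective _ hθ₀s).mp hg₀
    obtain ⟨c, rfl⟩ := Ideal.mem_span_range_iff_exists_fun.mp hl
    have hy' : y = homogeneousComponent (D + 1) (θ₀ G) +
        ∑ j, linForm (A j) * homogeneousComponent D (c j) := by
      have h1 := congrArg (homogeneousComponent (D + 1)) hgl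
      rw [homogeneousComponent_of_mem hy, if_pos rfl, map_add, map_sum] at h1
      rw [← h1]
      congr 1
      refine Finset.sum_congr rfl fun j _ => ?_
      rw [mul_comm, add_comm D 1, homogeneousComponent_mul_of_left (linForm_isHomogeneous _)]
    rw [hy', map_add, map_sum]
    refine Ideal.add_mem _ ?_ (Ideal.sum_mem _ fun j _ => Ideal.mem_sup_left ?_)
    · have hH : τ (∑ j ∈ Finset.range ((θ G).natDegree + 1),
          homogeneousComponent (j + (D + 1)) ((θ G).coeff j)) = 0 := by
        change Ideal.Quotient.mk _ (translate (-p) _) = 0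
        rw [Ideal.Quotient.eq_zero_iff_mem, mem_vanishingIdeal]
        intro z hz
        rw [eval_translate, map_sum]
        refine sum_homogeneousComponent_coeff_eq_zero (fun t ht => ?_) (D + 1)
        rw [hθ]
        refine mem_vanishingIdeal.mp hG _ ⟨ht, hVC hp, ?_⟩
        convert hVC hz using 1
        funext i
        change p i + t * (t⁻¹ * ((z + -p) i)) = z i
        rw [mul_inv_cancel_left₀ ht]
        simp
      rw [Finset.sum_range_succ', map_add, zero_add, ← hθ₀] at hH
      rw [eq_neg_of_add_eq_zero_right hH, map_sum]
      refine Ideal.mem_sup_right (Ideal.neg_mem_iff _ |>.mpr (Ideal.sum_mem _ fun j _ => ?_))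
      exact hτpow _ _ (mem_pow_idealOfVars_of_isHomogeneous
        (homogeneousComponent_isHomogeneous _ _) (by omega))
    · rw [map_mul]
      refine Ideal.mul_mem_mul ?_ (hτpow _ _ (mem_pow_idealOfVars_of_isHomogeneous
        (homogeneousComponent_isHomogeneous _ _) le_rfl))
      have h1 : translate (-p) (linForm (A j)) =
          linForm (A j) - MvPolynomial.C (A j ⬝ᵥ p) := by
        refine MvPolynomial.funext fun z => ?_
        rw [eval_translate, map_sub, eval_linForm, eval_linForm, eval_C, dotProduct_add,
          dotProduct_neg, sub_eq_add_neg]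
      change Ideal.Quotient.mk _ (translate (-p) (linForm (A j))) ∈ 𝔮
      rw [h1]
      exact h𝔮 j
  refine ⟨D, ?_⟩
  conv_lhs => rw [← hτ, ← Ideal.map_pow, pow_idealOfVars_eq_span]
  rw [Ideal.map_le_iff_le_comap, Ideal.span_le]
  rintro _ ⟨α, hα, rfl⟩
  exact key _ (isHomogeneous_monomial _ hα)

end Reduction

end ProjGeom

namespace ProjGeom

open MvPolynomial

/-! ### Polynomial functions, proportional vectors and the cone over the image -/

section PolynomialFunctions

variable {k : Type*} [Field k] {σ τ : Type*}

/-- A function on affine space is a polynomial function. -/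
def IsPolyFun (g : (σ → k) → k) : Prop := ∃ p : MvPolynomial σ k, ∀ z, eval z p = g z

theorem IsPolyFun.const (c : k) : IsPolyFun fun _ : σ → k => c := ⟨C c, fun _ => eval_C c⟩

theorem IsPolyFun.coord (i : σ) : IsPolyFun fun z : σ → k => z i := ⟨X i, fun _ => eval_X i⟩

theorem IsPolyFun.sub {g h : (σ → k) → k} (hg : IsPolyFun g) (hh : IsPolyFun h) :
    IsPolyFun fun z => g z - h z := by
  obtain ⟨p, hp⟩ := hg
  obtain ⟨q, hq⟩ := hh
  exact ⟨p - q, fun z => by rw [map_sub, hp, hq]⟩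

theorem IsPolyFun.mul {g h : (σ → k) → k} (hg : IsPolyFun g) (hh : IsPolyFun h) :
    IsPolyFun fun z => g z * h z := by
  obtain ⟨p, hp⟩ := hg
  obtain ⟨q, hq⟩ := hh
  exact ⟨p * q, fun z => by rw [map_mul, hp, hq]⟩

theorem IsPolyFun.sum {I : Type*} [Fintype I] {g : I → (σ → k) → k} (h : ∀ i, IsPolyFun (g i)) :
    IsPolyFun fun z => ∑ i, g i z := by
  choose p hp using h
  exact ⟨∑ i, p i, fun z => by simp only [map_sum, hp]⟩

theorem IsPolyFun.isAlgebraicSet {g : (σ → k) → k} (hg : IsPolyFun g) :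
    IsAlgebraicSet {z | g z = 0} := by
  obtain ⟨p, hp⟩ := hg
  simp only [← hp]
  exact isAlgebraicSet_setOf_eval_eq_zero p

theorem IsAlgebraicSet.preimage_comp {V : Set (τ → k)} (hV : IsAlgebraicSet V) (f : τ → σ) :
    IsAlgebraicSet {z : σ → k | z ∘ f ∈ V} := by
  have h := hV.preimage fun i => (X (f i) : MvPolynomial σ k)
  simp only [eval_X] at h
  exact h

theorem isAlgebraicSet_zeroLocus (I : Ideal (MvPolynomial σ k)) : IsAlgebraicSet (zeroLocus k I) :=
  ⟨I, by ext x; simp⟩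

theorem HasComponents.isCone_zeroLocus {I : Ideal (MvPolynomial σ k)} (hI : HasComponents I) :
    IsCone (k := k) (zeroLocus k I) := by
  intro c x hx
  rw [mem_zeroLocus] at hx ⊢
  intro f hf
  rw [eval_smul_eq_sum]
  exact Finset.sum_eq_zero fun d _ => by rw [hx _ (hI f hf d), mul_zero]

end PolynomialFunctions

section Proportional

variable {k : Type*} [Field k] {ι : Type*}

/-- Two vectors are proportional if their `2 × 2` minors vanish. -/
def Proportional (u w : ι → k) : Prop := ∀ i j, u i * w j - u j * w i = 0

theorem Proportional.exists_eq_smul {u w : ι → k} (h : Proportional u w) (hu : u ≠ 0) :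
    ∃ c : k, w = c • u := by
  obtain ⟨i, hi⟩ := Function.ne_iff.mp hu
  refine ⟨w i / u i, funext fun j => ?_⟩
  have := h i j
  have hi' : u i ≠ 0 := hi
  rw [Pi.smul_apply, smul_eq_mul]
  field_simp
  linear_combination this

theorem proportional_smul (u : ι → k) (c : k) : Proportional u (c • u) := fun i j => by
  simp only [Pi.smul_apply, smul_eq_mul]
  ring

theorem Proportional.smul_left {u w : ι → k} (h : Proportional u w) (c : k) :
    Proportional (c • u) w := fun i j => by
  simp only [Pi.smul_apply, smul_eq_mul]
  linear_combination c * h i j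

theorem Proportional.smul_right {u w : ι → k} (h : Proportional u w) (c : k) :
    Proportional u (c • w) := fun i j => by
  simp only [Pi.smul_apply, smul_eq_mul]
  linear_combination c * h i j

theorem isAlgebraicSet_setOf_proportional {σ : Type*} {u w : (σ → k) → ι → k}
    (hu : ∀ i, IsPolyFun fun z => u z i) (hw : ∀ i, IsPolyFun fun z => w z i) :
    IsAlgebraicSet {z | Proportional (u z) (w z)} := by
  have : {z | Proportional (u z) (w z)} =
      ⋂ i, ⋂ j, {z | u z i * w z j - u z j * w z i = 0} := by
    ext z
    simp [Proportional]
  rw [this]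
  exact isAlgebraicSet_iInter fun i => isAlgebraicSet_iInter fun j =>
    (((hu i).mul (hw j)).sub ((hu j).mul (hw i))).isAlgebraicSet

end Proportional

section Image

variable {k : Type*} [Field k] {n m : ℕ} {A : Matrix (Fin (n + 1)) (Fin (m + 1)) k}
  {Z : Set (PSpace k m)}

theorem affineCone_subset_zeroLocus : affineCone Z ⊆ zeroLocus k (homIdeal Z) :=
  zeroLocus_vanishingIdeal_le _

theorem mulVec_ne_zero_of_submatrix
    (hA : ∀ x ∈ zeroLocus k (homIdeal Z), (A.submatrix Fin.castSucc id).mulVec x = 0 → x = 0)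
    {x : Fin (m + 1) → k} (hx : x ∈ zeroLocus k (homIdeal Z)) (hx0 : x ≠ 0) : A.mulVec x ≠ 0 :=
  fun h => hx0 (hA x hx (funext fun i => congrFun h i.castSucc))

theorem rep_mem_zeroLocus {p : PSpace k m} (hp : p ∈ Z) : p.rep ∈ zeroLocus k (homIdeal Z) :=
  affineCone_subset_zeroLocus ⟨p, hp, rep_mem_submodule p⟩

theorem linProj_eq_iff {p : PSpace k m} (hp : p ∉ center A) {q : PSpace k n} :
    linProj A ⟨p, hp⟩ = q ↔ A.mulVec p.rep ∈ q.submodule := by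
  have hsub : (linProj A ⟨p, hp⟩).submodule = Submodule.span k {A.mulVec p.rep} :=
    Projectivization.submodule_mk _ hp
  constructor
  · rintro rfl
    rw [hsub]
    exact Submodule.mem_span_singleton_self _
  · intro h
    apply Projectivization.submodule_injective
    rw [hsub]
    ext w
    rw [mem_submodule_iff h hp, Submodule.mem_span_singleton]
    exact ⟨fun ⟨c, hc⟩ => ⟨c, hc.symm⟩, fun ⟨c, hc⟩ => ⟨c, hc.symm⟩⟩

theorem mem_fiber_iff (hA : ∀ p ∈ Z, A.mulVec p.rep ≠ 0) {q : PSpace k n} {p : PSpace k m} :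
    p ∈ fiber A Z q ↔ p ∈ Z ∧ A.mulVec p.rep ∈ q.submodule := by
  constructor
  · rintro ⟨hp, hpZ, h⟩
    exact ⟨hpZ, (linProj_eq_iff hp).mp h⟩
  · rintro ⟨hpZ, h⟩
    exact ⟨hA p hpZ, hpZ, (linProj_eq_iff _).mpr h⟩

theorem mem_projImage_iff {q : PSpace k n} : q ∈ projImage A Z ↔ (fiber A Z q).Nonempty := by
  constructor
  · rintro ⟨p, hp, h⟩
    exact ⟨p.1, p.2, hp, h⟩
  · rintro ⟨p, hp, hpZ, h⟩
    exact ⟨⟨p, hp⟩, hpZ, h⟩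

theorem mulVec_mem_submodule {p : PSpace k m} {q : PSpace k n} (h : A.mulVec p.rep ∈ q.submodule)
    {x : Fin (m + 1) → k} (hx : x ∈ p.submodule) : A.mulVec x ∈ q.submodule := by
  obtain ⟨c, rfl⟩ := (mem_submodule_iff (rep_mem_submodule p) p.rep_nonzero).mp hx
  rw [Matrix.mulVec_smul]
  exact Submodule.smul_mem _ _ h

theorem affineCone_projImage (hA : ∀ p ∈ Z, A.mulVec p.rep ≠ 0) :
    affineCone (projImage A Z) = A.mulVec '' affineCone Z := by
  ext w
  constructor
  · rintro ⟨q, hq, hw⟩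
    obtain ⟨p, hp⟩ := mem_projImage_iff.mp hq
    rw [mem_fiber_iff hA] at hp
    obtain ⟨c, rfl⟩ := (mem_submodule_iff hp.2 (hA p hp.1)).mp hw
    exact ⟨c • p.rep, ⟨p, hp.1, Submodule.smul_mem _ _ (rep_mem_submodule p)⟩,
      Matrix.mulVec_smul _ _ _⟩
  · rintro ⟨x, ⟨p, hp, hx⟩, rfl⟩
    refine ⟨linProj A ⟨p, hA p hp⟩, ⟨⟨p, hA p hp⟩, hp, rfl⟩, ?_⟩
    exact mulVec_mem_submodule ((linProj_eq_iff (hA p hp)).mp rfl) hx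

/-- Elimination of `x` from the proportionality of `A x` and `y`. Since `A x ≠ 0`, such a `y` is a
multiple of `A x`, hence in the image of the cone. -/
theorem isAlgebraicSet_affineCone_projImage [IsAlgClosed k] (hZ : IsClosed Z) (hne : Z.Nonempty)
    (hA : ∀ x ∈ zeroLocus k (homIdeal Z), (A.submatrix Fin.castSucc id).mulVec x = 0 → x = 0) :
    IsAlgebraicSet (affineCone (projImage A Z)) := by
  have hA' : ∀ p ∈ Z, A.mulVec p.rep ≠ 0 := fun p hp =>
    mulVec_ne_zero_of_submatrix hA (rep_mem_zeroLocus hp) p.rep_nonzero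
  have h1 : IsAlgebraicSet {y : Fin (n + 1) → k | ∃ x : Fin (m + 1) → k, x ≠ 0 ∧
      Sum.elim x y ∈ {z | z ∘ Sum.inl ∈ zeroLocus k (homIdeal Z)} ∩
        {z | Proportional (A.mulVec (z ∘ Sum.inl)) (z ∘ Sum.inr)}} := by
    refine IsAlgebraicSet.exists_ne_zero ?_ ?_
    · refine ((isAlgebraicSet_zeroLocus _).preimage_comp _).inter
        (isAlgebraicSet_setOf_proportional (fun i => ?_) fun i => IsPolyFun.coord (Sum.inr i))
      exact IsPolyFun.sum fun j => (IsPolyFun.const (A i j)).mul (IsPolyFun.coord (Sum.inl j))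
    · rintro x y c - ⟨hx, hxy⟩
      refine ⟨(homIdeal_hasComponents Z).isCone_zeroLocus c _ hx, ?_⟩
      simp only [Set.mem_ofPred_eq, Sum.elim_comp_inl, Sum.elim_comp_inr, Matrix.mulVec_smul]
        at hxy ⊢
      exact hxy.smul_left c
  convert h1 using 1
  rw [affineCone_projImage hA']
  ext y
  simp only [Set.mem_inter_iff, Set.mem_ofPred_eq, Sum.elim_comp_inl, Sum.elim_comp_inr]
  constructor
  · rintro ⟨x, hx, rfl⟩
    by_cases hx0 : x = 0
    · obtain ⟨p, hp⟩ := hne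
      refine ⟨p.rep, p.rep_nonzero, rep_mem_zeroLocus hp, ?_⟩
      rw [hx0, Matrix.mulVec_zero, ← zero_smul k (A.mulVec p.rep)]
      exact proportional_smul _ _
    · refine ⟨x, hx0, affineCone_subset_zeroLocus hx, ?_⟩
      have := proportional_smul (A.mulVec x) 1
      rwa [one_smul] at this
  · rintro ⟨x, hx0, hx, hxy⟩
    obtain ⟨c, rfl⟩ := hxy.exists_eq_smul (mulVec_ne_zero_of_submatrix hA hx hx0)
    exact ⟨c • x, affineCone_isCone Z c x (mem_affineCone_of_mem_zeroLocus hZ hx0 hx),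
      Matrix.mulVec_smul _ _ _⟩

end Image

end ProjGeom

namespace ProjGeom

open MvPolynomial

/-! ### The projection between affine charts -/

section SliceProjection

variable {k : Type*} [Field k] {ι r : Type*} [Fintype ι]

/-- The map of coordinate rings induced by a linear map. -/
noncomputable def coordMap (A : Matrix r ι k) {V : Set (ι → k)} {V' : Set (r → k)}
    (h : Set.MapsTo A.mulVec V V') : CoordRing V' →ₐ[k] CoordRing V :=
  Ideal.quotientMapₐ _ (linMap A) fun f hf => by
    rw [Ideal.mem_comap, mem_vanishingIdeal]
    intro x hx
    rw [eval_linMap]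
    exact mem_vanishingIdeal.mp hf _ (h hx)

theorem coordMap_mk (A : Matrix r ι k) {V : Set (ι → k)} {V' : Set (r → k)}
    (h : Set.MapsTo A.mulVec V V') (f : MvPolynomial r k) :
    coordMap A h (Ideal.Quotient.mk _ f) = Ideal.Quotient.mk _ (linMap A f) := rfl

theorem coordMap_injective (A : Matrix r ι k) {V : Set (ι → k)} {V' : Set (r → k)}
    (h : Set.MapsTo A.mulVec V V') (hs : V' ⊆ A.mulVec '' V) :
    Function.Injective (coordMap A h) := by
  rw [injective_iff_map_eq_zero]
  intro b hb
  obtain ⟨f, rfl⟩ := Ideal.Quotient.mk_surjective b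
  rw [coordMap_mk, Ideal.Quotient.eq_zero_iff_mem, mem_vanishingIdeal] at hb
  rw [Ideal.Quotient.eq_zero_iff_mem, mem_vanishingIdeal]
  intro y hy
  obtain ⟨x, hx, rfl⟩ := hs hy
  rw [← eval_linMap]
  exact hb x hx

theorem coordMap_mem_pointIdeal_iff (A : Matrix r ι k) {V : Set (ι → k)} {V' : Set (r → k)}
    (h : Set.MapsTo A.mulVec V V') {x : ι → k} (hx : x ∈ V) (b : CoordRing V') :
    coordMap A h b ∈ pointIdeal V x ↔ b ∈ pointIdeal V' (A.mulVec x) := by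
  obtain ⟨f, rfl⟩ := Ideal.Quotient.mk_surjective b
  rw [coordMap_mk, mk_mem_pointIdeal hx, mk_mem_pointIdeal (h hx), eval_linMap]

omit [Fintype ι] in
theorem eq_of_pointIdeal_le {V : Set (ι → k)} {x y : ι → k} (hx : x ∈ V) (hy : y ∈ V)
    (h : pointIdeal V x ≤ pointIdeal V y) : x = y := by
  funext i
  have h1 : Ideal.Quotient.mk (vanishingIdeal k V) (X i - C (x i)) ∈ pointIdeal V x := by
    rw [mk_mem_pointIdeal hx]
    simp
  have h2 := (mk_mem_pointIdeal hy).mp (h h1)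
  rw [map_sub, eval_X, eval_C, sub_eq_zero] at h2
  exact h2.symm

theorem zeroLocus_vanishingIdeal_slice_subset {C : Set (ι → k)}
    (hC : zeroLocus k (vanishingIdeal k C) ⊆ C) (a : ι → k) :
    zeroLocus k (vanishingIdeal k (slice C a)) ⊆ slice C a := by
  intro z hz
  refine ⟨hC (zeroLocus_anti_mono (vanishingIdeal_le_slice C a) hz), ?_⟩
  have h := mem_zeroLocus.mp hz (linForm a - 1) (by
    rw [mem_vanishingIdeal]
    intro x hx
    rw [map_sub, eval_linForm, hx.2, map_one, sub_self])
  rwa [map_sub, eval_linForm, map_one, sub_eq_zero] at h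

variable [IsAlgClosed k]

theorem finite_coordMap_slice {C : Set (ι → k)} (hC : IsCone (k := k) C) {d : ℕ}
    {A : Matrix (Fin (d + 1 + 1)) ι k}
    (hA : ∀ x ∈ zeroLocus k (vanishingIdeal k C),
      (A.submatrix Fin.castSucc id).mulVec x = 0 → x = 0) (i : Fin (d + 1))
    {V' : Set (Fin (d + 1 + 1) → k)}
    (h : Set.MapsTo A.mulVec (slice C (A i.castSucc)) V') :
    (coordMap A h).toRingHom.Finite := by
  have h1 := finite_slice hC (A.submatrix Fin.castSucc id) hA i
  let e : Fin d → Fin (d + 1 + 1) := fun j => (i.succAbove j).castSucc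
  refine RingHom.Finite.of_comp_finite
    (f := (Ideal.Quotient.mk (vanishingIdeal k V')).comp (rename e).toRingHom) ?_
  have h2 : (linMap A).comp (rename e) =
      linMap ((A.submatrix Fin.castSucc id).submatrix i.succAbove id) := by
    ext j : 1
    rw [AlgHom.comp_apply, rename_X, linMap_X, linMap_X]
    rfl
  have h3 : (coordMap A h).toRingHom.comp
      ((Ideal.Quotient.mk (vanishingIdeal k V')).comp (rename e).toRingHom) =
      (Ideal.Quotient.mk _).comp
        (linMap ((A.submatrix Fin.castSucc id).submatrix i.succAbove id)).toRingHom :=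
    RingHom.ext fun f => congrArg (Ideal.Quotient.mk _) (DFunLike.congr_fun h2 f)
  rw [h3]
  exact h1

/-- The points of a fibre inject into the primes of a finite algebra over a fixed prime, which are
finitely many. -/
theorem finite_slice_fiber {C : Set (ι → k)} (hC : IsCone (k := k) C) {d : ℕ}
    {A : Matrix (Fin (d + 1 + 1)) ι k}
    (hA : ∀ x ∈ zeroLocus k (vanishingIdeal k C),
      (A.submatrix Fin.castSucc id).mulVec x = 0 → x = 0) (i : Fin (d + 1))
    (y : Fin (d + 1 + 1) → k) : {x ∈ slice C (A i.castSucc) | A.mulVec x = y}.Finite := by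
  have h : Set.MapsTo A.mulVec (slice C (A i.castSucc)) Set.univ := Set.mapsTo_univ _ _
  let : Algebra (CoordRing (Set.univ : Set (Fin (d + 1 + 1) → k)))
    (CoordRing (slice C (A i.castSucc))) := (coordMap A h).toRingHom.toAlgebra
  have hfin : Module.Finite (CoordRing (Set.univ : Set (Fin (d + 1 + 1) → k)))
    (CoordRing (slice C (A i.castSucc))) := finite_coordMap_slice hC hA i h
  refine Set.Finite.of_injOn (f := pointIdeal (slice C (A i.castSucc))) ?_ ?_
    (Algebra.QuasiFinite.finite_primesOver
      (pointIdeal (Set.univ : Set (Fin (d + 1 + 1) → k)) y))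
  · rintro x ⟨hx, rfl⟩
    refine ⟨(pointIdeal_isMaximal hx).isPrime, ⟨?_⟩⟩
    ext b
    exact (coordMap_mem_pointIdeal_iff A h hx b).symm
  · rintro x ⟨hx, -⟩ x' ⟨hx', -⟩ hxx'
    exact eq_of_pointIdeal_le hx hx' hxx'.le

theorem pow_le_of_pow_succ_le {B : Type*} [CommRing B] {𝔪 𝔫 : Ideal B} {D : ℕ}
    (h : 𝔫 ^ (D + 1) ≤ 𝔪 * 𝔫 ^ D ⊔ 𝔫 ^ (D + 2)) {E : ℕ} (hE : D ≤ E) :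
    𝔫 ^ (E + 1) ≤ 𝔪 * 𝔫 ^ E ⊔ 𝔫 ^ (E + 2) := by
  obtain ⟨e, rfl⟩ := Nat.exists_eq_add_of_le hE
  calc 𝔫 ^ (D + e + 1) = 𝔫 ^ (D + 1) * 𝔫 ^ e := by rw [← pow_add]; congr 1; omega
    _ ≤ (𝔪 * 𝔫 ^ D ⊔ 𝔫 ^ (D + 2)) * 𝔫 ^ e := Ideal.mul_mono_left h
    _ = 𝔪 * 𝔫 ^ (D + e) ⊔ 𝔫 ^ (D + e + 2) := by
      rw [Ideal.sup_mul, mul_assoc, ← pow_add, ← pow_add]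
      congr 2
      omega

/-- The chart ring of the image embeds in that of `Z`, and the extension is finite, so
`exists_length_le_sum` applies. The reduction property at each point comes from the absence of
contracted limit secants; the radical condition is the Nullstellensatz for the fibre over `y`. -/
theorem exists_length_pointIdeal_le_sum {C : Set (ι → k)} (hC : IsCone (k := k) C)
    (hCcl : zeroLocus k (vanishingIdeal k C) ⊆ C) {d : ℕ}
    {A : Matrix (Fin (d + 1 + 1)) ι k}
    (hA : ∀ x ∈ zeroLocus k (vanishingIdeal k C),
      (A.submatrix Fin.castSucc id).mulVec x = 0 → x = 0) (i : Fin (d + 1))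
    {V' : Set (Fin (d + 1 + 1) → k)} (hV' : A.mulVec '' slice C (A i.castSucc) = V')
    {y : Fin (d + 1 + 1) → k} {J : Type*} [Fintype J] [Nonempty J] {x : J → ι → k}
    (hxinj : Function.Injective x)
    (hx : Set.range x = {z ∈ slice C (A i.castSucc) | A.mulVec z = y})
    (hsec : ∀ j v, Sum.elim v (x j) ∈ limitSecants C → A.mulVec v = 0 → v = 0) :
    ∃ c, ∀ t, Module.length k (CoordRing V' ⧸ pointIdeal V' y ^ t) ≤
      ∑ j, Module.length k (CoordRing (slice C (A i.castSucc)) ⧸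
        pointIdeal (slice C (A i.castSucc)) (x j) ^ (t + c)) := by
  set V := slice C (A i.castSucc) with hV
  have hmaps : Set.MapsTo A.mulVec V V' := by
    rw [← hV']
    exact Set.mapsTo_image _ _
  have hmem : ∀ j, x j ∈ V ∧ A.mulVec (x j) = y := fun j => by
    have : x j ∈ {z ∈ V | A.mulVec z = y} := hx ▸ ⟨j, rfl⟩
    exact this
  let : Algebra (CoordRing V') (CoordRing V) := (coordMap A hmaps).toRingHom.toAlgebra
  have hfin : Module.Finite (CoordRing V') (CoordRing V) := finite_coordMap_slice hC hA i hmaps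
  have htower : IsScalarTower k (CoordRing V') (CoordRing V) :=
    IsScalarTower.of_algebraMap_eq' (coordMap A hmaps).comp_algebraMap.symm
  have hinj : Function.Injective (algebraMap (CoordRing V') (CoordRing V)) :=
    coordMap_injective A hmaps hV'.ge
  let 𝔮 : Ideal (CoordRing V) := (pointIdeal V' y).map (algebraMap (CoordRing V') (CoordRing V))
  have h𝔮 : ∀ l, Ideal.Quotient.mk (vanishingIdeal k V)
      (linForm (A l) - MvPolynomial.C (y l)) ∈ 𝔮 := by
    intro l
    let j := Classical.arbitrary J
    have hy : y ∈ V' := (hmem j).2 ▸ hmaps (hmem j).1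
    have h1 : Ideal.Quotient.mk (vanishingIdeal k V') (X l - MvPolynomial.C (y l)) ∈
        pointIdeal V' y := by
      rw [mk_mem_pointIdeal hy]
      simp
    have h2 := Ideal.mem_map_of_mem (algebraMap (CoordRing V') (CoordRing V)) h1
    change coordMap A hmaps _ ∈ _ at h2
    rw [coordMap_mk, map_sub, linMap_X, algHom_C] at h2
    exact h2
  have hred : ∀ j, ∃ D, pointIdeal V (x j) ^ (D + 1) ≤
      𝔮 * pointIdeal V (x j) ^ D ⊔ pointIdeal V (x j) ^ (D + 2) := by
    intro j
    refine exists_pow_pointIdeal_le (fun z hz => hz.1) (hmem j).1 A (hsec j) 𝔮 fun l => ?_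
    have h1 : A l ⬝ᵥ x j = y l := congrFun (hmem j).2 l
    rw [h1]
    exact h𝔮 l
  choose D hD using hred
  -- One exponent is needed for all points. The reduction relation persists for larger exponents, so
  -- the sum will do.
  refine exists_length_le_sum (D := ∑ j, D j) hinj ?_ ?_ fun j =>
    pow_le_of_pow_succ_le (hD j) (Finset.single_le_sum (fun _ _ => Nat.zero_le _)
      (Finset.mem_univ j))
  · intro j j' hjj'
    have h1 := pointIdeal_isMaximal (hmem j).1
    have h2 := pointIdeal_isMaximal (hmem j').1
    exact Ideal.isCoprime_of_isMaximal fun h =>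
      hjj' (hxinj (eq_of_pointIdeal_le (hmem j).1 (hmem j').1 h.le))
  · intro b hb
    obtain ⟨g, rfl⟩ := Ideal.Quotient.mk_surjective b
    rw [Ideal.mem_iInf] at hb
    have hgx : ∀ j, eval (x j) g = 0 := fun j => (mk_mem_pointIdeal (hmem j).1).mp (hb j)
    let I := vanishingIdeal k V ⊔
      Ideal.span (Set.range fun l => linForm (A l) - MvPolynomial.C (y l))
    have hg : g ∈ I.radical := by
      rw [← vanishingIdeal_zeroLocus_eq_radical (K := k), mem_vanishingIdeal]
      intro z hz
      have hzV := zeroLocus_vanishingIdeal_slice_subset hCcl _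
        (zeroLocus_anti_mono (le_sup_left : vanishingIdeal k V ≤ I) hz)
      have hzy : A.mulVec z = y := by
        funext l
        have h1 := mem_zeroLocus.mp hz _ (Ideal.mem_sup_right (Ideal.subset_span ⟨l, rfl⟩))
        rwa [map_sub, eval_linForm, eval_C, sub_eq_zero] at h1
      have hzx : z ∈ Set.range x := by
        rw [hx]
        exact ⟨hzV, hzy⟩
      obtain ⟨j, rfl⟩ := hzx
      exact hgx j
    obtain ⟨N, hN⟩ := hg
    refine ⟨N, ?_⟩
    rw [← map_pow]
    have hI : I ≤ 𝔮.comap (Ideal.Quotient.mk (vanishingIdeal k V)) := by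
      refine sup_le (fun f hf => ?_) (Ideal.span_le.mpr ?_)
      · rw [Ideal.mem_comap, Ideal.Quotient.eq_zero_iff_mem.mpr hf]
        exact Ideal.zero_mem _
      · rintro _ ⟨l, rfl⟩
        exact h𝔮 l
    exact hI hN

end SliceProjection

end ProjGeom

namespace ProjGeom

open MvPolynomial Filter

/-! ### Comparison of multiplicities along the projection -/

section MultiplicityComparison

variable {k : Type*} [Field k] {m : ℕ}

theorem IsNormalized.mult_eq [Infinite k] {Z : Set (PSpace k m)} {p : PSpace k m}
    {a v : Fin (m + 1) → k} (hp : IsNormalized p a v) (hpZ : p ∈ Z) {d : ℕ}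
    (hd : (pointIdeal (slice (affineCone Z) a) v).height = d) :
    mult Z p = limsup (fun t : ℕ => (d.factorial : ENNReal) *
      ENat.toENNReal (Module.length k (CoordRing (slice (affineCone Z) a) ⧸
        pointIdeal (slice (affineCone Z) a) v ^ t)) / (t : ENNReal) ^ d) atTop := by
  have h : ((ringKrullDim (LocalRingAt Z p)).unbotD 0).toNat = d := by
    rw [hp.ringKrullDim_localRingAt hpZ, hd]
    rfl
  simp only [mult, samuelMultiplicity, h, hp.length_localRingAt hpZ]

variable [IsAlgClosed k]

/-- The coordinate ring is algebraic over the `d` forms and contains `d` independent elements, so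
the forms themselves are independent. -/
theorem eq_zero_of_linMap_mem_homIdeal {Y : Set (PSpace k m)} (hY : IsIrreducible Y) {d : ℕ}
    (hdim : HasIndep k (MvPolynomial (Fin (m + 1)) k ⧸ homIdeal Y) d)
    (L : Matrix (Fin d) (Fin (m + 1)) k)
    (hL : ∀ x ∈ zeroLocus k (homIdeal Y), L.mulVec x = 0 → x = 0) (f : MvPolynomial (Fin d) k)
    (hf : linMap L f ∈ homIdeal Y) : f = 0 := by
  have hP := homIdeal_isPrime hY
  let φ : MvPolynomial (Fin d) k →ₐ[k] MvPolynomial (Fin (m + 1)) k ⧸ homIdeal Y :=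
    (Ideal.Quotient.mkₐ k (homIdeal Y)).comp (linMap L)
  have hfin : φ.toRingHom.Finite := finite_linMap (homIdeal_hasComponents Y) L hL
  have halg := isAlgebraic_adjoin_of_finite φ hfin
  have hcard : d = Fintype.card (Fin d) := (Fintype.card_fin d).symm
  have hind := HasIndep.algebraicIndependent (fun j => φ (X j)) (hcard ▸ hdim)
  rw [algebraicIndependent_iff] at hind
  refine hind f ?_
  have h1 : aeval (fun j => φ (X j)) = φ := by
    ext j
    simp
  rw [h1]
  exact Ideal.Quotient.eq_zero_iff_mem.mpr hf

section Heights

variable {d : ℕ} {Z : Set (PSpace k m)}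
  {A : Matrix (Fin (d + 1 + 1)) (Fin (m + 1)) k}
  (hA : ∀ x ∈ zeroLocus k (homIdeal Z), (A.submatrix Fin.castSucc id).mulVec x = 0 → x = 0)
include hA

-- Already the rows of `A` other than the last have no common zero on `Z`, so the charts of the
-- first `d + 1` coordinates cover the image.
omit [IsAlgClosed k] in
theorem exists_isNormalized {q : PSpace k (d + 1)} (hq : q ∈ projImage A Z) :
    ∃ (i : Fin (d + 1)) (y : Fin (d + 1 + 1) → k),
      IsNormalized q ((1 : Matrix (Fin (d + 1 + 1)) (Fin (d + 1 + 1)) k) i.castSucc) y := by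
  obtain ⟨p, hp⟩ := mem_projImage_iff.mp hq
  rw [mem_fiber_iff fun p hp =>
    mulVec_ne_zero_of_submatrix hA (rep_mem_zeroLocus hp) p.rep_nonzero] at hp
  have h1 : (A.submatrix Fin.castSucc id).mulVec p.rep ≠ 0 := fun h =>
    p.rep_nonzero (hA _ (rep_mem_zeroLocus hp.1) h)
  obtain ⟨i, hi⟩ := Function.ne_iff.mp h1
  have hi' : A.mulVec p.rep i.castSucc ≠ 0 := hi
  refine ⟨i, (A.mulVec p.rep i.castSucc)⁻¹ • A.mulVec p.rep, Submodule.smul_mem _ _ hp.2, ?_⟩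
  have h2 := congrFun (Matrix.one_mulVec (A.mulVec p.rep)) i.castSucc
  rw [Matrix.mulVec] at h2
  rw [dotProduct_smul, h2, smul_eq_mul, inv_mul_cancel₀ hi']

-- The row `A i.castSucc` is the pullback of the coordinate `i.castSucc`. Normalizing with both
-- makes each point of the fibre correspond to exactly one vector mapped to `y` itself, not just to
-- a multiple.
omit [IsAlgClosed k] in
theorem exists_normalized_fiber {q : PSpace k (d + 1)} {i : Fin (d + 1)} {y : Fin (d + 1 + 1) → k}
    (hy : IsNormalized q ((1 : Matrix (Fin (d + 1 + 1)) (Fin (d + 1 + 1)) k) i.castSucc) y) :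
    ∃ x : fiber A Z q → Fin (m + 1) → k, Function.Injective x ∧
      Set.range x = {z ∈ slice (affineCone Z) (A i.castSucc) | A.mulVec z = y} ∧
      ∀ j, IsNormalized j.1 (A i.castSucc) (x j) := by
  have hA' : ∀ p ∈ Z, A.mulVec p.rep ≠ 0 := fun p hp =>
    mulVec_ne_zero_of_submatrix hA (rep_mem_zeroLocus hp) p.rep_nonzero
  have hone : ∀ w : Fin (d + 1 + 1) → k,
      (1 : Matrix (Fin (d + 1 + 1)) (Fin (d + 1 + 1)) k) i.castSucc ⬝ᵥ w = w i.castSucc := fun w =>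
    congrFun (Matrix.one_mulVec w) i.castSucc
  have hyi : y i.castSucc = 1 := (hone y).symm.trans hy.dot
  have hex : ∀ j : fiber A Z q, ∃ z, z ∈ j.1.submodule ∧ A.mulVec z = y := by
    rintro ⟨p, hp⟩
    rw [mem_fiber_iff hA'] at hp
    obtain ⟨c, hc⟩ := (mem_submodule_iff hp.2 (hA' p hp.1)).mp hy.mem
    exact ⟨c • p.rep, Submodule.smul_mem _ _ (rep_mem_submodule p), by
      rw [Matrix.mulVec_smul, hc]⟩
  choose x hxmem hxy using hex
  have hnorm : ∀ j, IsNormalized j.1 (A i.castSucc) (x j) := fun j =>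
    ⟨hxmem j, by
      change A.mulVec (x j) i.castSucc = 1
      rw [hxy, hyi]⟩
  refine ⟨x, fun j j' h => ?_, ?_, hnorm⟩
  · refine Subtype.ext (Projectivization.submodule_injective ?_)
    ext w
    rw [mem_submodule_iff (hxmem j) (hnorm j).ne_zero, h,
      ← mem_submodule_iff (hxmem j') (hnorm j').ne_zero]
  · ext z
    constructor
    · rintro ⟨j, rfl⟩
      exact ⟨⟨⟨j.1, ((mem_fiber_iff hA').mp j.2).1, hxmem j⟩, (hnorm j).dot⟩, hxy j⟩
    · rintro ⟨⟨⟨p, hp, hz⟩, hz1⟩, hzy⟩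
      have hz0 : z ≠ 0 := by
        rintro rfl
        rw [dotProduct_zero] at hz1
        exact zero_ne_one hz1
      obtain ⟨c, hc⟩ := (mem_submodule_iff hz hz0).mp (rep_mem_submodule p)
      have hpf : p ∈ fiber A Z q := by
        rw [mem_fiber_iff hA']
        refine ⟨hp, ?_⟩
        rw [hc, Matrix.mulVec_smul, hzy]
        exact Submodule.smul_mem _ _ hy.mem
      refine ⟨⟨p, hpf⟩, ?_⟩
      obtain ⟨e, he⟩ := (mem_submodule_iff hz hz0).mp (hxmem ⟨p, hpf⟩)
      have h1 := (hnorm ⟨p, hpf⟩).dot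
      rw [he, dotProduct_smul, hz1, smul_eq_mul, mul_one] at h1
      rw [he, h1, one_smul]

theorem finite_fiber (q : PSpace k (d + 1)) : (fiber A Z q).Finite := by
  by_cases hq : q ∈ projImage A Z
  · obtain ⟨i, y, hy⟩ := exists_isNormalized hA hq
    obtain ⟨x, hxinj, hx, -⟩ := exists_normalized_fiber hA hy
    have h := finite_slice_fiber (affineCone_isCone Z) hA i y
    rw [← hx] at h
    rw [← Set.finite_coe_iff] at h ⊢
    exact Finite.of_injective _ (Set.rangeFactorization_injective.mpr hxinj)
  · rw [mem_projImage_iff, Set.not_nonempty_iff_eq_empty] at hq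
    rw [hq]
    exact Set.finite_empty

variable (hZ : IsPureDimVariety Z d)
include hZ

theorem height_pointIdeal_affineCone {p : PSpace k m} (hp : p ∈ Z) (i : Fin (d + 1))
    {v : Fin (m + 1) → k} (hv : IsNormalized p (A i.castSucc) v) :
    (pointIdeal (slice (affineCone Z) (A i.castSucc)) v).height = d := by
  obtain ⟨Y, hYZ, hYcl, hpY, hYirr, hdim⟩ := hZ.exists_hasIndep hp
  have hsub : affineCone Y ⊆ affineCone Z := fun x ⟨q, hq, hx⟩ => ⟨q, hYZ hq, hx⟩
  refine height_pointIdeal_slice (affineCone_isCone Z) (affineCone_isCone Y) hsub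
    (A.submatrix Fin.castSucc id) hA (homIdeal_isPrime hYirr) ?_ i
    ⟨⟨p, hpY, hv.mem⟩, hv.dot⟩
  exact eq_zero_of_linMap_mem_homIdeal hYirr hdim _ fun x hx =>
    hA x (zeroLocus_anti_mono (homIdeal_anti hYZ) hx)

/-- The image of a component `Y` of `Z` has as ideal the preimage of the ideal of `Y`, a prime, and
the first `d + 1` coordinates remain independent on it. So the height argument applies to the image
directly. -/
theorem height_pointIdeal_affineCone_projImage {q : PSpace k (d + 1)} (hq : q ∈ projImage A Z)
    (i : Fin (d + 1)) {y : Fin (d + 1 + 1) → k}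
    (hy : IsNormalized q ((1 : Matrix (Fin (d + 1 + 1)) (Fin (d + 1 + 1)) k) i.castSucc) y) :
    (pointIdeal (slice (affineCone (projImage A Z))
      ((1 : Matrix (Fin (d + 1 + 1)) (Fin (d + 1 + 1)) k) i.castSucc)) y).height = d := by
  have hA' : ∀ p ∈ Z, A.mulVec p.rep ≠ 0 := fun p hp =>
    mulVec_ne_zero_of_submatrix hA (rep_mem_zeroLocus hp) p.rep_nonzero
  obtain ⟨p, hp⟩ := mem_projImage_iff.mp hq
  rw [mem_fiber_iff hA'] at hp
  obtain ⟨Y, hYZ, hYcl, hpY, hYirr, hdim⟩ := hZ.exists_hasIndep hp.1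
  have hsub : affineCone Y ⊆ affineCone Z := fun x ⟨q, hq, hx⟩ => ⟨q, hYZ hq, hx⟩
  have himg := affineCone_projImage hA'
  let L : Matrix (Fin (d + 1)) (Fin (d + 1 + 1)) k := (1 : Matrix _ _ k).submatrix Fin.castSucc id
  have hLA : ∀ x, L.mulVec (A.mulVec x) = (A.submatrix Fin.castSucc id).mulVec x := by
    intro x
    funext j
    exact congrFun (Matrix.one_mulVec (A.mulVec x)) j.castSucc
  have hId : vanishingIdeal k (A.mulVec '' affineCone Y) = (homIdeal Y).comap (linMap A) := by
    ext f
    rw [Ideal.mem_comap, homIdeal, mem_vanishingIdeal, mem_vanishingIdeal, Set.forall_mem_image]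
    simp only [eval_linMap]
  have hprime := homIdeal_isPrime hYirr
  refine height_pointIdeal_slice (Y := A.mulVec '' affineCone Y) (affineCone_isCone _) ?_ ?_ L ?_
    ?_ ?_ i ⟨?_, hy.dot⟩
  · rintro c _ ⟨x, hx, rfl⟩
    exact ⟨c • x, affineCone_isCone Y c x hx, Matrix.mulVec_smul _ _ _⟩
  · rw [himg]
    exact Set.image_mono hsub
  · intro x hx hx0
    have h1 := (isAlgebraicSet_affineCone_projImage hZ.1 ⟨p, hp.1⟩
      hA).zeroLocus_vanishingIdeal_subset hx
    rw [himg] at h1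
    obtain ⟨z, hz, rfl⟩ := h1
    rw [hLA] at hx0
    rw [hA z (affineCone_subset_zeroLocus hz) hx0, Matrix.mulVec_zero]
  · rw [hId]
    exact Ideal.comap_isPrime _ _
  · intro f hf
    rw [hId, Ideal.mem_comap] at hf
    refine eq_zero_of_linMap_mem_homIdeal hYirr hdim (A.submatrix Fin.castSucc id) (fun x hx =>
      hA x (zeroLocus_anti_mono (homIdeal_anti hYZ) hx)) f ?_
    convert hf using 1
    refine MvPolynomial.funext fun x => ?_
    rw [eval_linMap, eval_linMap, eval_linMap, hLA]
  · obtain ⟨c, hc⟩ := (mem_submodule_iff hp.2 (hA' p hp.1)).mp hy.mem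
    exact ⟨c • p.rep, ⟨p, hpY, Submodule.smul_mem _ _ (rep_mem_submodule p)⟩,
      by rw [hc]; exact Matrix.mulVec_smul _ _ _⟩

/-- Both sides are upper limits with the same normalization, as all the point ideals have height
`d`, so the comparison of colengths passes to multiplicities. Scaling transfers `hsec` from `p.rep`
to the normalized vectors. -/
theorem mult_projImage_le {q : PSpace k (d + 1)} (hq : q ∈ projImage A Z)
    (hsec : ∀ p ∈ fiber A Z q, ∀ v, Sum.elim v p.rep ∈ limitSecants (affineCone Z) →
      A.mulVec v = 0 → v = 0) :
    mult (projImage A Z) q ≤ ∑' p : fiber A Z q, mult Z p.1 := by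
  have hA' : ∀ p ∈ Z, A.mulVec p.rep ≠ 0 := fun p hp =>
    mulVec_ne_zero_of_submatrix hA (rep_mem_zeroLocus hp) p.rep_nonzero
  obtain ⟨i, y, hy⟩ := exists_isNormalized hA hq
  obtain ⟨x, hxinj, hx, hnorm⟩ := exists_normalized_fiber hA hy
  have : Fintype (fiber A Z q) := (finite_fiber hA q).fintype
  have : Nonempty (fiber A Z q) := (mem_projImage_iff.mp hq).to_subtype
  have hmem : ∀ j : fiber A Z q, j.1 ∈ Z := fun j => ((mem_fiber_iff hA').mp j.2).1
  have hcl : zeroLocus k (vanishingIdeal k (affineCone Z)) ⊆ affineCone Z := by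
    intro z hz
    by_cases hz0 : z = 0
    · obtain ⟨j⟩ := this
      exact ⟨j.1, hmem j, hz0 ▸ Submodule.zero_mem _⟩
    · exact mem_affineCone_of_mem_zeroLocus hZ.1 hz0 hz
  have himg : A.mulVec '' slice (affineCone Z) (A i.castSucc) =
      slice (affineCone (projImage A Z))
        ((1 : Matrix (Fin (d + 1 + 1)) (Fin (d + 1 + 1)) k) i.castSucc) := by
    have hone : ∀ w : Fin (d + 1 + 1) → k,
        (1 : Matrix (Fin (d + 1 + 1)) (Fin (d + 1 + 1)) k) i.castSucc ⬝ᵥ w = w i.castSucc :=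
      fun w => congrFun (Matrix.one_mulVec w) i.castSucc
    ext w
    constructor
    · rintro ⟨z, ⟨hz, hz1⟩, rfl⟩
      refine ⟨?_, ?_⟩
      · rw [affineCone_projImage hA']
        exact ⟨z, hz, rfl⟩
      · rw [hone]
        exact hz1
    · rintro ⟨hw, hw1⟩
      rw [affineCone_projImage hA'] at hw
      obtain ⟨z, hz, rfl⟩ := hw
      rw [hone] at hw1
      exact ⟨z, ⟨hz, hw1⟩, rfl⟩
  obtain ⟨c, hc⟩ := exists_length_pointIdeal_le_sum (affineCone_isCone Z) hcl hA i himg hxinj hx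
    (by
      intro j v hv hAv
      obtain ⟨b, hb⟩ := (mem_submodule_iff (hnorm j).mem (hnorm j).ne_zero).mp
        (rep_mem_submodule j.1)
      have hb0 : b ≠ 0 := by
        rintro rfl
        rw [zero_smul] at hb
        exact j.1.rep_nonzero hb
      refine hsec j.1 j.2 v ?_ hAv
      have h1 := smul_mem_limitSecants (affineCone_isCone Z) one_ne_zero hb0 hv
      rwa [one_smul, ← hb] at h1)
  rw [tsum_fintype, hy.mult_eq hq (height_pointIdeal_affineCone_projImage hA hZ hq i hy)]
  have hmult : ∀ j : fiber A Z q, mult Z j.1 = _ := fun j =>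
    (hnorm j).mult_eq (hmem j) (height_pointIdeal_affineCone hA hZ (hmem j) i (hnorm j))
  simp only [hmult]
  refine limsup_le_sum_limsup _ d c (g := fun j t => ENat.toENNReal (Module.length k
    (CoordRing (slice (affineCone Z) (A i.castSucc)) ⧸
      pointIdeal (slice (affineCone Z) (A i.castSucc)) (x j) ^ t))) fun t => ?_
  refine (ENat.toENNReal_le.mpr (hc t)).trans_eq ?_
  exact map_sum ENat.toENNRealRingHom _ _

end Heights

end MultiplicityComparison

end ProjGeom

namespace ProjGeom

open MvPolynomial

/-! ### General matrices and the locus of contracted limit secants -/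

section GeneralMatrices

variable {k : Type*} [Field k] {r c : ℕ}

theorem ForGeneralMatrix.mono {P Q : Matrix (Fin r) (Fin c) k → Prop} (h : ForGeneralMatrix P)
    (hPQ : ∀ A, P A → Q A) : ForGeneralMatrix Q := by
  obtain ⟨F, hF, h⟩ := h
  exact ⟨F, hF, fun A hA => hPQ A (h A hA)⟩

theorem ForGeneralMatrix.and [Infinite k] {P Q : Matrix (Fin r) (Fin c) k → Prop}
    (hP : ForGeneralMatrix P) (hQ : ForGeneralMatrix Q) : ForGeneralMatrix fun A => P A ∧ Q A := by
  obtain ⟨F, ⟨A, hA⟩, hF⟩ := hP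
  obtain ⟨G, ⟨B, hB⟩, hG⟩ := hQ
  refine ⟨F * G, ?_, fun A hA => ?_⟩
  · by_contra! h
    have h0 : F * G = 0 := MvPolynomial.funext fun z => by
      rw [map_zero]
      exact h (Matrix.of fun i j => z (i, j))
    rcases mul_eq_zero.mp h0 with h1 | h1
    · exact hA (by rw [h1, map_zero])
    · exact hB (by rw [h1, map_zero])
  · rw [map_mul] at hA
    exact ⟨hF A (left_ne_zero_of_mul hA), hG A (right_ne_zero_of_mul hA)⟩

theorem IsAlgebraicSet.forGeneralMatrix {B : Set (Fin r × Fin c → k)} (hB : IsAlgebraicSet B)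
    (A : Matrix (Fin r) (Fin c) k) (hA : (fun ij => A ij.1 ij.2) ∉ B) :
    ForGeneralMatrix fun A : Matrix (Fin r) (Fin c) k => (fun ij => A ij.1 ij.2) ∉ B := by
  obtain ⟨S, rfl⟩ := hB
  simp only [Set.mem_ofPred_eq, not_forall] at hA
  obtain ⟨F, hF, hFA⟩ := hA
  exact ⟨F, ⟨A, hFA⟩, fun A hA h => hA (h F hF)⟩

theorem forGeneralMatrix_rank (h : r ≤ c) :
    ForGeneralMatrix fun A : Matrix (Fin r) (Fin c) k => A.rank = r := by
  let e := Fin.castLE h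
  have heval : ∀ A : Matrix (Fin r) (Fin c) k, eval (fun ij => A ij.1 ij.2)
      (Matrix.of fun i j => (X (i, e j) : MvPolynomial (Fin r × Fin c) k)).det =
      (A.submatrix id e).det := by
    intro A
    rw [RingHom.map_det]
    congr 1
    ext i j
    simp
  refine ⟨(Matrix.of fun i j => X (i, e j)).det,
    ⟨Matrix.of fun i j => if j = e i then 1 else 0, ?_⟩, fun A hA => ?_⟩
  · rw [heval]
    have : (Matrix.of fun i j => if j = e i then (1 : k) else 0).submatrix id e = 1 := by
      ext i j
      simp [Matrix.one_apply, e, eq_comm]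
    rw [this, Matrix.det_one]
    exact one_ne_zero
  · rw [heval] at hA
    refine le_antisymm (by simpa using A.rank_le_height) ?_
    have h1 : A * (1 : Matrix (Fin c) (Fin c) k).submatrix id e = A.submatrix id e := by
      ext i j
      simp [Matrix.mul_apply, Matrix.one_apply]
    have h2 := Matrix.rank_mul_le_left A ((1 : Matrix (Fin c) (Fin c) k).submatrix id e)
    rw [h1, Matrix.rank_of_isUnit _ ((Matrix.isUnit_iff_isUnit_det _).mpr hA.isUnit),
      Fintype.card_fin] at h2
    exact h2

end GeneralMatrices

section GenericProjection

variable {k : Type*} [Field k] [IsAlgClosed k] {n m : ℕ}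

/-- The complement consists of the matrices whose rows other than the last have no common zero on
`Z`, so the latter form an open set. -/
theorem isAlgebraicSet_setOf_exists_submatrix_mulVec_eq_zero (Z : Set (PSpace k m)) :
    IsAlgebraicSet {z : Fin (n + 1) × Fin (m + 1) → k | ∃ x : Fin (m + 1) → k, x ≠ 0 ∧
      Sum.elim x z ∈ {w | w ∘ Sum.inl ∈ zeroLocus k (homIdeal Z)} ∩
        ⋂ i : Fin n, {w | ∑ j, w (.inr (i.castSucc, j)) * w (.inl j) = 0}} := by
  refine IsAlgebraicSet.exists_ne_zero (((isAlgebraicSet_zeroLocus _).preimage_comp _).inter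
    (isAlgebraicSet_iInter fun i => IsPolyFun.isAlgebraicSet (IsPolyFun.sum fun j =>
      (IsPolyFun.coord _).mul (IsPolyFun.coord _)))) ?_
  rintro x z c - ⟨h1, h2⟩
  refine ⟨(homIdeal_hasComponents Z).isCone_zeroLocus c _ h1, ?_⟩
  rw [Set.mem_iInter] at h2 ⊢
  intro i
  have h3 : ∑ j, z (i.castSucc, j) * x j = 0 := h2 i
  change ∑ j, z (i.castSucc, j) * (c * x j) = 0
  rw [← mul_zero c, ← h3, Finset.mul_sum]
  exact Finset.sum_congr rfl fun j _ => by ring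

/-- With `c` fixed, the matrices for which the dimension count fails are closed; both `v` and `x`
are eliminated projectively, as the conditions are homogeneous in each. -/
theorem isAlgebraicSet_setOf_exists_limitSecants (Z : Set (PSpace k m)) {e : ℕ}
    (c : Fin e → Fin (n + 1) → k) :
    IsAlgebraicSet {z : Fin (n + 1) × Fin (m + 1) → k | ∃ x : Fin (m + 1) → k, x ≠ 0 ∧
      ∃ v : Fin (m + 1) → k, v ≠ 0 ∧ Sum.elim v (Sum.elim x z) ∈
        {w | w ∘ Sum.map id Sum.inl ∈ limitSecants (affineCone Z)} ∩
        ((⋂ i, {w | ∑ j, w (.inr (.inr (i, j))) * w (.inl j) = 0}) ∩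
          ⋂ l, {w | ∑ i, c l i * ∑ j, w (.inr (.inr (i, j))) * w (.inr (.inl j)) = 0})} := by
  refine IsAlgebraicSet.exists_ne_zero_ne_zero
    (((isAlgebraicSet_limitSecants _).preimage_comp _).inter
      ((isAlgebraicSet_iInter fun i => IsPolyFun.isAlgebraicSet (IsPolyFun.sum fun j =>
        (IsPolyFun.coord _).mul (IsPolyFun.coord _))).inter
      (isAlgebraicSet_iInter fun l => IsPolyFun.isAlgebraicSet (IsPolyFun.sum fun i =>
        (IsPolyFun.const _).mul (IsPolyFun.sum fun j =>
          (IsPolyFun.coord _).mul (IsPolyFun.coord _)))))) ?_ ?_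
  · rintro v x z a ha ⟨h1, h2, h3⟩
    refine ⟨?_, ?_, Set.mem_iInter.mpr fun l => Set.mem_iInter.mp h3 l⟩
    · simp only [Set.mem_ofPred_eq, Sum.elim_comp_map, Function.comp_id, Sum.elim_comp_inl] at h1 ⊢
      have := smul_mem_limitSecants (affineCone_isCone Z) ha one_ne_zero h1
      rwa [one_smul] at this
    · rw [Set.mem_iInter] at h2 ⊢
      intro i
      have h4 : ∑ j, z (i, j) * v j = 0 := h2 i
      change ∑ j, z (i, j) * (a * v j) = 0
      rw [← mul_zero a, ← h4, Finset.mul_sum]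
      exact Finset.sum_congr rfl fun j _ => by ring
  · rintro v x z a ha ⟨h1, h2, h3⟩
    refine ⟨?_, Set.mem_iInter.mpr fun i => Set.mem_iInter.mp h2 i, ?_⟩
    · simp only [Set.mem_ofPred_eq, Sum.elim_comp_map, Function.comp_id, Sum.elim_comp_inl] at h1 ⊢
      have := smul_mem_limitSecants (affineCone_isCone Z) one_ne_zero ha h1
      rwa [one_smul] at this
    · rw [Set.mem_iInter] at h3 ⊢
      intro l
      have h4 : ∑ i, c l i * ∑ j, z (i, j) * x j = 0 := h3 l
      change ∑ i, c l i * ∑ j, z (i, j) * (a * x j) = 0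
      rw [← mul_zero a, ← h4]
      simp only [Finset.mul_sum]
      exact Finset.sum_congr rfl fun i _ => Finset.sum_congr rfl fun j _ => by ring

/-- The vectors proportional to the image of a point over which the projection contracts a limit
secant. -/
def contractedLocus (A : Matrix (Fin (n + 1)) (Fin (m + 1)) k) (Z : Set (PSpace k m)) :
    Set (Fin (n + 1) → k) :=
  {y | ∃ x : Fin (m + 1) → k, x ≠ 0 ∧ ∃ v : Fin (m + 1) → k, v ≠ 0 ∧
    Sum.elim v x ∈ limitSecants (affineCone Z) ∧ A.mulVec v = 0 ∧ Proportional (A.mulVec x) y}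

omit [IsAlgClosed k] in
theorem contractedLocus_isCone (A : Matrix (Fin (n + 1)) (Fin (m + 1)) k) (Z : Set (PSpace k m)) :
    IsCone (k := k) (contractedLocus A Z) := by
  rintro c y ⟨x, hx, v, hv, h1, h2, h3⟩
  exact ⟨x, hx, v, hv, h1, h2, h3.smul_right c⟩

theorem isAlgebraicSet_contractedLocus (A : Matrix (Fin (n + 1)) (Fin (m + 1)) k)
    (Z : Set (PSpace k m)) : IsAlgebraicSet (contractedLocus A Z) := by
  have h := IsAlgebraicSet.exists_ne_zero_ne_zero (σ := Fin (n + 1)) (ι := Fin (m + 1))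
    (X := {w | w ∘ Sum.map id Sum.inl ∈ limitSecants (affineCone Z)} ∩
      ((⋂ i, {w | ∑ j, A i j * w (.inl j) = 0}) ∩
        {w | Proportional (A.mulVec (w ∘ Sum.inr ∘ Sum.inl)) (w ∘ Sum.inr ∘ Sum.inr)}))
    (((isAlgebraicSet_limitSecants _).preimage_comp _).inter
      ((isAlgebraicSet_iInter fun i => IsPolyFun.isAlgebraicSet (IsPolyFun.sum fun j =>
        (IsPolyFun.const _).mul (IsPolyFun.coord _))).inter
      (isAlgebraicSet_setOf_proportional (fun i => IsPolyFun.sum fun j =>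
        (IsPolyFun.const (A i j)).mul (IsPolyFun.coord (Sum.inr (Sum.inl j))))
        fun i => IsPolyFun.coord (Sum.inr (Sum.inr i))))) ?_ ?_
  · convert h using 1
    ext y
    simp only [contractedLocus, Set.mem_ofPred_eq, Set.mem_inter_iff, Set.mem_iInter,
      Sum.elim_comp_map, Function.comp_id, Sum.elim_comp_inl]
    refine exists_congr fun x => and_congr_right fun _ => exists_congr fun v =>
      and_congr_right fun _ => and_congr_right fun _ => and_congr ?_ Iff.rfl
    exact funext_iff
  · rintro v x y a ha ⟨h1, h2, h3⟩
    refine ⟨?_, ?_, h3⟩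
    · simp only [Set.mem_ofPred_eq, Sum.elim_comp_map, Function.comp_id, Sum.elim_comp_inl] at h1 ⊢
      have := smul_mem_limitSecants (affineCone_isCone Z) ha one_ne_zero h1
      rwa [one_smul] at this
    · rw [Set.mem_iInter] at h2 ⊢
      intro i
      have h4 : ∑ j, A i j * v j = 0 := h2 i
      change ∑ j, A i j * (a * v j) = 0
      rw [← mul_zero a, ← h4, Finset.mul_sum]
      exact Finset.sum_congr rfl fun j _ => by ring
  · rintro v x y a ha ⟨h1, h2, h3⟩
    refine ⟨?_, Set.mem_iInter.mpr fun i => Set.mem_iInter.mp h2 i, ?_⟩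
    · simp only [Set.mem_ofPred_eq, Sum.elim_comp_map, Function.comp_id, Sum.elim_comp_inl] at h1 ⊢
      have := smul_mem_limitSecants (affineCone_isCone Z) one_ne_zero ha h1
      rwa [one_smul] at this
    · have h4 : Proportional (A.mulVec x) y := h3
      change Proportional (A.mulVec (a • x)) y
      rw [Matrix.mulVec_smul]
      exact h4.smul_left a

theorem isClosed_setOf_rep_mem {V : Set (Fin (m + 1) → k)} (hV : IsAlgebraicSet V)
    (hcone : IsCone (k := k) V) : IsClosed {p : PSpace k m | p.rep ∈ V} := by
  obtain ⟨S, rfl⟩ := hV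
  have : {p : PSpace k m | p.rep ∈ {x | ∀ f ∈ S, eval x f = 0}} =
      ⋂ f ∈ S, {p | f ∈ homIdeal {p}} := by
    ext p
    simp only [Set.mem_iInter, Set.mem_ofPred_eq]
    constructor
    · intro h f hf
      rw [homIdeal, mem_vanishingIdeal]
      rintro x ⟨q, rfl, hx⟩
      obtain ⟨c, rfl⟩ := (mem_submodule_iff (rep_mem_submodule q) q.rep_nonzero).mp hx
      exact hcone c _ h f hf
    · exact fun h f hf => mem_vanishingIdeal.mp (h f hf) _ ⟨p, rfl, rep_mem_submodule p⟩
  rw [this]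
  exact isClosed_biInter fun f _ => isClosed_setOf_mem_homIdeal f

/-- Outside the contracted locus the comparison of multiplicities applies, so the excess locus lies
in this closed set. By `hc` the forms `c` have no common zero on it, and their number bounds its
dimension plus one. For `d = 1` there are no forms and the locus is empty. -/
theorem codimAtLeast_excessLocus {d : ℕ} (hd : 1 ≤ d) {Z : Set (PSpace k m)}
    (hZ : IsPureDimVariety Z d) {A : Matrix (Fin (d + 1 + 1)) (Fin (m + 1)) k}
    (hA : ∀ x ∈ zeroLocus k (homIdeal Z), (A.submatrix Fin.castSucc id).mulVec x = 0 → x = 0)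
    {c : Fin (d + 1 - 2) → Fin (d + 1 + 1) → k}
    (hc : ∀ v x, v ≠ 0 → x ≠ 0 → Sum.elim v x ∈ limitSecants (affineCone Z) → A.mulVec v = 0 →
      ¬ ∀ j, c j ⬝ᵥ A.mulVec x = 0) : CodimAtLeast 3 (excessLocus A Z) := by
  have hA' : ∀ p ∈ Z, A.mulVec p.rep ≠ 0 := fun p hp =>
    mulVec_ne_zero_of_submatrix hA (rep_mem_zeroLocus hp) p.rep_nonzero
  have hcl := isClosed_setOf_rep_mem (isAlgebraicSet_contractedLocus A Z)
    (contractedLocus_isCone A Z)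
  refine codimAtLeast_of_chainsLT hcl ?_ (length_lt_of_mulVec_eq_zero hcl (Matrix.of c) ?_)
    (by omega)
  · rintro q ⟨hq, hexc⟩
    by_contra hqD
    refine hexc.not_ge (mult_projImage_le hA hZ hq fun p hp v hv hAv => ?_)
    rw [mem_fiber_iff hA'] at hp
    by_contra hv0
    refine hqD ⟨p.rep, p.rep_nonzero, v, hv0, hv, hAv, ?_⟩
    obtain ⟨b, hb⟩ := (mem_submodule_iff hp.2 (hA' p hp.1)).mp (rep_mem_submodule q)
    rw [hb]
    exact proportional_smul _ _
  · rintro y ⟨q, hq, hy⟩ hcy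
    by_contra hy0
    obtain ⟨b, rfl⟩ := (mem_submodule_iff (rep_mem_submodule q) q.rep_nonzero).mp hy
    obtain ⟨x, hx, v, hv, hvx, hAv, hxy⟩ := contractedLocus_isCone A Z b _ hq
    obtain ⟨a, ha⟩ := hxy.exists_eq_smul
      (mulVec_ne_zero_of_submatrix hA (base_mem_of_mem_limitSecants hvx) hx)
    refine hc v x hv hx hvx hAv fun j => ?_
    have h1 : c j ⬝ᵥ (b • q.rep) = 0 := congrFun hcy j
    rw [ha, dotProduct_smul, smul_eq_mul, mul_eq_zero] at h1
    refine h1.resolve_left ?_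
    rintro rfl
    rw [zero_smul] at ha
    exact hy0 ha

end GenericProjection

end ProjGeom

/-! ### Conclusion -/

theorem mainTheorem7 {k : Type*} [Field k] [IsAlgClosed k] [CharZero k]
    (n s : ℕ) (hn : 2 ≤ n) (hs : 1 ≤ s)
    (Z : Set (ProjGeom.PSpace k (n + s))) (hZ : ProjGeom.IsPureDimVariety Z (n - 1)) :
    ProjGeom.ForGeneralMatrix fun A : Matrix (Fin (n + 1)) (Fin (n + s + 1)) k =>
      A.rank = n + 1 ∧ Disjoint Z (ProjGeom.center A) ∧
      (∀ q : ProjGeom.PSpace k n, (ProjGeom.fiber A Z q).Finite) ∧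
      ProjGeom.CodimAtLeast 3 (ProjGeom.excessLocus A Z) := by
  obtain ⟨d, rfl⟩ : ∃ d, n = d + 1 := ⟨n - 1, by omega⟩
  rw [Nat.add_sub_cancel] at hZ
  obtain ⟨A₀, c, h₁, h₂⟩ :=
    ProjGeom.exists_matrix_forall_limitSecants hZ.1 hn hZ.chainsLT
  -- The matrix `A₀` shows that both closed sets of bad matrices are proper; the forms `c` found
  -- together with `A₀` are kept for every other matrix.
  have hgen₁ := (ProjGeom.isAlgebraicSet_setOf_exists_submatrix_mulVec_eq_zero
    (n := d + 1) Z).forGeneralMatrix A₀ (by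
      rintro ⟨x, hx0, hx, hAx⟩
      exact hx0 (h₁ x hx (funext fun i => Set.mem_iInter.mp hAx i)))
  have hgen₂ := (ProjGeom.isAlgebraicSet_setOf_exists_limitSecants Z c).forGeneralMatrix A₀ (by
      rintro ⟨x, hx0, v, hv0, hvx, hAv, hAx⟩
      rw [Set.mem_ofPred_eq, Sum.elim_comp_map, Sum.elim_comp_inl, Function.comp_id] at hvx
      exact h₂ v x hv0 hx0 hvx (funext fun i => Set.mem_iInter.mp hAv i)
        fun j => Set.mem_iInter.mp hAx j)
  refine (((ProjGeom.forGeneralMatrix_rank (by omega)).and hgen₁).and hgen₂).mono ?_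
  rintro A ⟨⟨hrank, hA₁⟩, hA₂⟩
  have hA : ∀ x ∈ MvPolynomial.zeroLocus k (ProjGeom.homIdeal Z),
      (A.submatrix Fin.castSucc id).mulVec x = 0 → x = 0 := by
    intro x hx hAx
    by_contra hx0
    exact hA₁ ⟨x, hx0, hx, Set.mem_iInter.mpr fun i => congrFun hAx i⟩
  refine ⟨hrank, ?_, ProjGeom.finite_fiber hA, ?_⟩
  · rw [Set.disjoint_left]
    exact fun p hp => ProjGeom.mulVec_ne_zero_of_submatrix hA (ProjGeom.rep_mem_zeroLocus hp)
      p.rep_nonzero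
  · refine ProjGeom.codimAtLeast_excessLocus (by omega) hZ hA (c := c) ?_
    intro v x hv0 hx0 hvx hAv hAx
    refine hA₂ ⟨x, hx0, v, hv0, ?_, Set.mem_iInter.mpr fun i => congrFun hAv i,
      Set.mem_iInter.mpr hAx⟩
    rw [Set.mem_ofPred_eq, Sum.elim_comp_map, Sum.elim_comp_inl, Function.comp_id]
    exact hvx
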